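/- Let $d\in\{2,3\}$, $\Omega=(0,1)^d$, $T>0$, $0<\chi\le 1$. Let $(\mathsf u,\mathsf p)$ solve the Stokes system $\mathsf u_t-\Delta \mathsf u+\nabla \mathsf p=f$, $\nabla\cdot \mathsf u=0$ in $\Omega\times(0,T]$, $\mathsf u|_{\partial\Omega}=0$, where $\mathsf p(t)$ has zero mean and the source is smooth in time, $f\in W^{2,\infty}((0,T);L^2(\Omega)^d)$. Assume that $\mathsf u\in W^{2,\infty}((0,T);H^2(\Omega)^d)$; that $\mathsf u(t)\in H^1_0(\Omega)^d$; that $\partial_{xxyy}\mathsf u\in W^{1,\infty}((0,T);L^2)$ if $d=2$, and $\partial_{xxyy}\mathsf u,\partial_{yyzz}\mathsf u,\partial_{zzxx}\mathsf u,\partial_{xxyyzz}\mathsf u\in W^{1,\infty}((0,T);L^2)$ if $d=3$; and that $\mathsf p$ and all its spatial derivatives containing each variable at most once ($\partial_x,\partial_y,\partial_{xy}$ for $d=2$; likewise up to $\partial_{xyz}$ for $d=3$) are in $W^{2,\infty}((0,T);L^2(\Omega))$. For $0<\tau\le T$ let $t_s=s\tau$ and $K=\lfloor T/\tau\rfloor$,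 and write $\psi^{s}=\psi(t_s)$ for functions of time. Consider the following scheme, whose equations hold in $L^2(\Omega)$ and whose boundary conditions hold in the sense of traces. Set $u^0=\mathsf u(0)$, $p^{-1/2}=\mathsf p(0)$, $\phi^{-1/2}=\phi^\star$ (given, possibly depending on $\tau$). For $0\le k<K$: 1. $p^{\star,k+1/2}=p^{k-1/2}+\phi^{k-1/2}$. 2. If $d=2$, find $u^{k+1/2},u^{k+1}$ with $\frac{u^{k+1/2}-u^k}{\tau/2}-\partial_{xx}u^{k+1/2}-\partial_{yy}u^k+\nabla p^{\star,k+1/2}=f^{k+1/2}$, $u^{k+1/2}|_{x=0,1}=0$, and $\frac{u^{k+1}-u^{k+1/2}}{\tau/2}-\partial_{xx}u^{k+1/2}-\partial_{yy}u^{k+1}+\nabla p^{\star,k+1/2}=f^{k+1/2}$, $u^{k+1}|_{y=0,1}=0$. If $d=3$, find $\xi,\eta,\zeta,u^{k+1}$ with $\frac{\xi-u^k}{\tau}-\Delta u^k+\nabla p^{\star,k+1/2}=f^{k+1/2}$; $\frac{\eta-\xi}{\tau}-\frac12\partial_{xx}(\eta-u^k)=0$, $\eta|_{x=0,1}=0$;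 $\frac{\zeta-\eta}{\tau}-\frac12\partial_{yy}(\zeta-u^k)=0$, $\zeta|_{y=0,1}=0$; $\frac{u^{k+1}-\zeta}{\tau}-\frac12\partial_{zz}(u^{k+1}-u^k)=0$, $u^{k+1}|_{z=0,1}=0$. 3. Find $\phi^{k+1/2}$ of zero mean with $A\phi^{k+1/2}=-\frac1\tau\nabla\cdot u^{k+1}$, where $A=(1-\partial_{xx})(1-\partial_{yy})$ if $d=2$, with $\partial_y\phi|_{y=0,1}=0$ and $\partial_x(1-\partial_{yy})\phi|_{x=0,1}=0$; and $A=(1-\partial_{xx})(1-\partial_{yy})(1-\partial_{zz})$ if $d=3$, with $\partial_z\phi|_{z=0,1}=0$, $\partial_y(1-\partial_{zz})\phi|_{y=0,1}=0$ and $\partial_x(1-\partial_{yy})(1-\partial_{zz})\phi|_{x=0,1}=0$. 4. $p^{k+1/2}=p^{k-1/2}+\phi^{k+1/2}-\chi\,\nabla\cdot\frac{u^{k+1}+u^k}{2}$. Put $e^k=\mathsf u(t_k)-u^k$, $\delta\psi^k=\psi^k-\psi^{k-1}$ and $\bar e^{k+1/2}=\frac12(e^{k+1}+e^k)$. Then for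 every $c_0$ there is a constant $c$, depending only on $d,T,\chi,f,\mathsf u,\mathsf p,c_0$ (not on $\tau$, $\phi^\star$ or the discrete solution), such that for every $0<\tau\le T$ and every solution of the scheme with $\|\mathsf p(\tau/2)-p^{\star,1/2}\|_{H^1(\Omega)}\le c_0\tau$, every $e^k$, $0\le k\le K$, is in $H^1(\Omega)^d$ and $$\max_{1\le k\le K}\|\delta e^k\|_{L^2}^2+\tau\max_{1\le k\le K}\|\nabla\times\delta e^k\|_{L^2}^2+\tau\sum_{k=1}^{K-1}\|\nabla\times\delta\bar e^{k+1/2}\|_{L^2}^2+\tau\max_{0\le k\le K}\|\nabla\cdot e^k\|_{L^2}^2\le c\,\tau^4 .$$ -/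

import Mathlib

noncomputable section

namespace DirectionSplitting

open MeasureTheory

/-! ### The cube, `L²`, and weak derivatives -/

/-- The open unit cube `Ω = (0,1)^d`. -/
def cube (d : ℕ) : Set (Fin d → ℝ) := Set.univ.pi fun _ => Set.Ioo (0 : ℝ) 1

/-- The space `L²(Ω)`. -/
abbrev L2 (d : ℕ) : Type := Lp ℝ 2 (volume.restrict (cube d))

/-- Vector fields in `L²(Ω)^d`. -/
abbrev Field (d : ℕ) : Type := Fin d → L2 d

/-- The classical partial derivative `∂ᵢψ`. -/
def pd {d : ℕ} (i : Fin d) (ψ : (Fin d → ℝ) → ℝ) : (Fin d → ℝ) → ℝ :=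
  fun x => fderiv ℝ ψ x (Pi.single i 1)

/-- The classical iterated partial derivative along a list of directions. -/
def pdList {d : ℕ} (l : List (Fin d)) (ψ : (Fin d → ℝ) → ℝ) : (Fin d → ℝ) → ℝ :=
  l.foldr pd ψ

/-- A function that is `C^∞` on the whole space. -/
def IsSmooth {d : ℕ} (ψ : (Fin d → ℝ) → ℝ) : Prop := ContDiff ℝ ((⊤ : ℕ∞) : WithTop ℕ∞) ψ

/-- `g ∈ L²(Ω)` is the distributional derivative of `v` along the directions in `l`
(for `l = [i, j, …]` this says `∂ᵢ∂ⱼ… v = g`). -/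
def HasWeakDeriv {d : ℕ} (l : List (Fin d)) (v g : L2 d) : Prop :=
  ∀ ψ : (Fin d → ℝ) → ℝ, IsSmooth ψ → HasCompactSupport ψ → tsupport ψ ⊆ cube d →
    ∫ x in cube d, v x * pdList l ψ x = (-1 : ℝ) ^ l.length * ∫ x in cube d, g x * ψ x

/-- `∂ᵢ v = g` and `v` vanishes on the two faces `xᵢ = 0` and `xᵢ = 1`, in the sense of traces:
Green's formula in direction `i` has no boundary term, for test functions that are
smooth up to the boundary and need not vanish there. -/
def HasWeakDerivZeroTrace {d : ℕ} (i : Fin d) (v g : L2 d) : Prop :=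
  ∀ ψ : (Fin d → ℝ) → ℝ, IsSmooth ψ →
    ∫ x in cube d, v x * pd i ψ x = - ∫ x in cube d, g x * ψ x

/-- `∂ᵢᵢ v = g` with the Dirichlet condition `v = 0` at `xᵢ = 0, 1`. -/
def HasDirichletDeriv2 {d : ℕ} (i : Fin d) (v g : L2 d) : Prop :=
  ∃ v' : L2 d, HasWeakDerivZeroTrace i v v' ∧ HasWeakDeriv [i] v' g

/-- `∂ᵢᵢ v = g` with the Neumann condition `∂ᵢ v = 0` at `xᵢ = 0, 1`. -/
def HasNeumannDeriv2 {d : ℕ} (i : Fin d) (v g : L2 d) : Prop :=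
  ∃ v' : L2 d, HasWeakDeriv [i] v v' ∧ HasWeakDerivZeroTrace i v' g

/-- `v ∈ H¹₀(Ω)`: all first derivatives are in `L²(Ω)` and `v` vanishes on all faces. -/
def MemH10 {d : ℕ} (v : L2 d) : Prop :=
  ∀ i, ∃ g : L2 d, HasWeakDerivZeroTrace i v g

/-- `v ∈ H¹(Ω)`. -/
def MemH1 {d : ℕ} (v : L2 d) : Prop :=
  ∀ i, ∃ g : L2 d, HasWeakDeriv [i] v g

open Classical in
/-- The weak derivative `∂ᵢ v` as an element of `L²(Ω)`; the value is `0` if it does not exist. -/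
def wd {d : ℕ} (i : Fin d) (v : L2 d) : L2 d :=
  if h : ∃ g : L2 d, HasWeakDeriv [i] v g then h.choose else 0

/-- `g = div v`, all derivatives `∂ᵢ vᵢ` being in `L²(Ω)`. -/
def HasDiv {d : ℕ} (v : Field d) (g : L2 d) : Prop :=
  ∃ D : Fin d → L2 d, (∀ i, HasWeakDeriv [i] (v i) (D i)) ∧ g = ∑ i, D i

/-- `G = Δ v` componentwise, all second derivatives `∂ⱼⱼ vᵢ` being in `L²(Ω)`. -/
def HasLaplacian {d : ℕ} (v G : Field d) : Prop :=
  ∃ D : Fin d → Fin d → L2 d,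
    (∀ i j, HasWeakDeriv [j, j] (v i) (D i j)) ∧ ∀ i, G i = ∑ j, D i j

/-- `G = ∇ q`. -/
def HasGrad {d : ℕ} (q : L2 d) (G : Field d) : Prop :=
  ∀ i, HasWeakDeriv [i] q (G i)

/-- Functions of zero mean. -/
def ZeroMean {d : ℕ} (q : L2 d) : Prop := ∫ x in cube d, q x = 0

/-! ### Norms -/

/-- The `L²` norm of a vector field. -/
def l2Norm {d : ℕ} (v : Field d) : ℝ := Real.sqrt (∑ i, ‖v i‖ ^ 2)

/-- `‖div v‖_{L²}`. -/
def divNorm {d : ℕ} (v : Field d) : ℝ := ‖∑ i, wd i (v i)‖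

/-- `‖curl v‖_{L²}`. The numbers `∂ᵢ vⱼ - ∂ⱼ vᵢ`, `i < j`, are up to sign the components of the
curl: one scalar for `d = 2` and three components for `d = 3`. -/
def curlNorm {d : ℕ} (v : Field d) : ℝ :=
  Real.sqrt (∑ i, ∑ j ∈ Finset.univ.filter (fun j => i < j), ‖wd i (v j) - wd j (v i)‖ ^ 2)

/-- The maximum over a finite set of (nonnegative) norms. -/
def lInfSeq (s : Finset ℕ) (a : ℕ → ℝ) : ℝ := ((s.sup fun k => (a k).toNNReal : NNReal) : ℝ)

/-- The discrete `ℓ²` norm with time step `τ`. -/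
def lTwoSeq (τ : ℝ) (s : Finset ℕ) (a : ℕ → ℝ) : ℝ := Real.sqrt (τ * ∑ k ∈ s, a k ^ 2)

/-! ### Time regularity -/

/-- `g ∈ W^{m,∞}((0,T); E)`. For `m ≥ 1`, `g` is moreover the continuous representative,
so that its values on `[0,T]` are meaningful. -/
def MemWInf {E : Type*} [NormedAddCommGroup E] [NormedSpace ℝ E] (T : ℝ) :
    ℕ → (ℝ → E) → Prop
  | 0, g => MemLp g ⊤ (volume.restrict (Set.Ioc 0 T))
  | m + 1, g => ∃ g' : ℝ → E, MemWInf T m g' ∧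
      ∀ t ∈ Set.Icc (0 : ℝ) T, g t = g 0 + ∫ s in (0 : ℝ)..t, g' s

/-- The spatial derivative of `v` along `l` exists at all times and is in `W^{m,∞}((0,T); L²)`. -/
def DerivMemWInf {d : ℕ} (T : ℝ) (m : ℕ) (l : List (Fin d)) (v : ℝ → L2 d) : Prop :=
  ∃ g : ℝ → L2 d, (∀ t ∈ Set.Icc (0 : ℝ) T, HasWeakDeriv l (v t) (g t)) ∧ MemWInf T m g

/-- `u ∈ W^{2,∞}(H²) ∩ W^{1,∞}(D(B))`: derivatives of order at most two are in `W^{2,∞}(L²)`;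
`u(t) ∈ H¹₀`; and the derivatives that make up `B`, i.e. `∂_{xxyy}` for `d = 2` and
`∂_{xxyy}, ∂_{yyzz}, ∂_{zzxx}, ∂_{xxyyzz}` for `d = 3`, are in `W^{1,∞}(L²)`. -/
structure VelocityRegular {d : ℕ} (T : ℝ) (u : ℝ → Field d) : Prop where
  h2 : ∀ i, ∀ l : List (Fin d), l.length ≤ 2 → DerivMemWInf T 2 l (fun t => u t i)
  h10 : ∀ i, ∀ t ∈ Set.Icc (0 : ℝ) T, MemH10 (u t i)
  dB : ∀ i, ∀ l : List (Fin d), l.Nodup → 2 ≤ l.length →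
    DerivMemWInf T 1 (l ++ l) (fun t => u t i)

/-- `p ∈ W^{2,∞}(Y)`: `p(t)` has zero mean, and all derivatives that contain each direction at
most once are in `W^{2,∞}(L²)`. -/
structure PressureRegular {d : ℕ} (T : ℝ) (p : ℝ → L2 d) : Prop where
  zeroMean : ∀ t ∈ Set.Icc (0 : ℝ) T, ZeroMean (p t)
  mixed : ∀ l : List (Fin d), l.Nodup → DerivMemWInf T 2 l p

/-! ### The Stokes system -/

/-- `(u, p)` solves `u_t - Δu + ∇p = f`, `div u = 0`, `u = 0` on `∂Ω`. -/
structure IsStokesSolution {d : ℕ} (T : ℝ) (f u : ℝ → Field d) (p : ℝ → L2 d) : Prop where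
  momentum : ∀ t ∈ Set.Ioc (0 : ℝ) T, ∃ L G : Field d,
    HasLaplacian (u t) L ∧ HasGrad (p t) G ∧
    HasDerivWithinAt u (L - G + f t) (Set.Icc 0 T) t
  divFree : ∀ t ∈ Set.Icc (0 : ℝ) T, HasDiv (u t) 0
  boundary : ∀ t ∈ Set.Ioc (0 : ℝ) T, ∀ i, MemH10 (u t i)

/-! ### The direction splitting scheme -/

/-- `g = (1 - ∂ᵢᵢ) v` with `∂ᵢ v = 0` at `xᵢ = 0, 1`. -/
def HasHelmholtz {d : ℕ} (i : Fin d) (v g : L2 d) : Prop :=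
  ∃ v'' : L2 d, HasNeumannDeriv2 i v v'' ∧ g = v - v''

/-- `q ∈ D(A)` and `A q = g`, where `A = (1 - ∂_{xx})(1 - ∂_{yy})` for `d = 2` and
`A = (1 - ∂_{xx})(1 - ∂_{yy})(1 - ∂_{zz})` for `d = 3`. -/
def HasA : (d : ℕ) → L2 d → L2 d → Prop
  | 2, q, g => ZeroMean q ∧ ∃ w : L2 2, HasHelmholtz 1 q w ∧ HasHelmholtz 0 w g
  | 3, q, g => ZeroMean q ∧ ∃ w₁ w₂ : L2 3,
      HasHelmholtz 2 q w₁ ∧ HasHelmholtz 1 w₁ w₂ ∧ HasHelmholtz 0 w₂ g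
  | _, _, _ => False

/-- The two-dimensional velocity update `u ↦ v` with pressure predictor `q` and source `F`;
`w` is the half-step velocity. -/
def VelocityStep2 (τ : ℝ) (F : Field 2) (q : L2 2) (u v : Field 2) : Prop :=
  ∃ w wxx uyy vyy G : Field 2,
    (∀ i, HasDirichletDeriv2 0 (w i) (wxx i)) ∧
    (∀ i, HasWeakDeriv [1, 1] (u i) (uyy i)) ∧
    (∀ i, HasDirichletDeriv2 1 (v i) (vyy i)) ∧
    HasGrad q G ∧
    (τ / 2)⁻¹ • (w - u) - wxx - uyy + G = F ∧
    (τ / 2)⁻¹ • (v - w) - wxx - vyy + G = F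

/-- The three-dimensional velocity update `u ↦ v` with pressure predictor `q` and source `F`.
The field `ξ` is given explicitly by the first equation. -/
def VelocityStep3 (τ : ℝ) (F : Field 3) (q : L2 3) (u v : Field 3) : Prop :=
  ∃ ξ η ζ L G uxx uyy uzz ηxx ζyy vzz : Field 3,
    HasLaplacian u L ∧ HasGrad q G ∧
    (∀ i, HasWeakDeriv [0, 0] (u i) (uxx i)) ∧
    (∀ i, HasWeakDeriv [1, 1] (u i) (uyy i)) ∧
    (∀ i, HasWeakDeriv [2, 2] (u i) (uzz i)) ∧
    (∀ i, HasDirichletDeriv2 0 (η i) (ηxx i)) ∧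
    (∀ i, HasDirichletDeriv2 1 (ζ i) (ζyy i)) ∧
    (∀ i, HasDirichletDeriv2 2 (v i) (vzz i)) ∧
    τ⁻¹ • (ξ - u) - L + G = F ∧
    τ⁻¹ • (η - ξ) - (1 / 2 : ℝ) • (ηxx - uxx) = 0 ∧
    τ⁻¹ • (ζ - η) - (1 / 2 : ℝ) • (ζyy - uyy) = 0 ∧
    τ⁻¹ • (v - ζ) - (1 / 2 : ℝ) • (vzz - uzz) = 0

/-- The velocity update in dimension two or three. -/
def VelocityStep : (d : ℕ) → ℝ → Field d → L2 d → Field d → Field d → Prop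
  | 2, τ, F, q, u, v => VelocityStep2 τ F q u v
  | 3, τ, F, q, u, v => VelocityStep3 τ F q u v
  | _, _, _, _, _, _ => False

/-- The sequences `u k = u^k`, `φ k = φ^{k-1/2}`, `p k = p^{k-1/2}` are produced by `K` steps of
the scheme with time step `τ`, parameter `χ`, source `f`, initial velocity `u₀`, initial pressure
`p₀` and initial pressure increment `φs`. -/
structure IsSchemeSolution {d : ℕ} (K : ℕ) (τ χ : ℝ) (f : ℝ → Field d)
    (u₀ : Field d) (p₀ φs : L2 d) (u : ℕ → Field d) (φ p : ℕ → L2 d) : Prop where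
  init_u : u 0 = u₀
  init_p : p 0 = p₀
  init_φ : φ 0 = φs
  /-- Velocity update, with the pressure predictor `p^{k-1/2} + φ^{k-1/2}`. -/
  velocity : ∀ k < K,
    VelocityStep d τ (f (((k : ℝ) + 1 / 2) * τ)) (p k + φ k) (u k) (u (k + 1))
  penalty : ∀ k < K, ∃ D : L2 d, HasDiv (u (k + 1)) D ∧ HasA d (φ (k + 1)) (-(τ⁻¹ • D))
  pressure : ∀ k < K, ∃ D : L2 d, HasDiv ((1 / 2 : ℝ) • (u (k + 1) + u k)) D ∧
    p (k + 1) = p k + φ (k + 1) - χ • D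

/-- `q ∈ H¹(Ω)` and its `H¹` norm is at most `r`. -/
def H1NormLE {d : ℕ} (q : L2 d) (r : ℝ) : Prop :=
  ∃ G : Field d, HasGrad q G ∧ Real.sqrt (‖q‖ ^ 2 + l2Norm G ^ 2) ≤ r

/-! ### Errors -/

/-- The velocity error `e^k = u(t_k) - u^k`, with `t_k = kτ`. -/
def velErr {d : ℕ} (τ : ℝ) (uE : ℝ → Field d) (u : ℕ → Field d) (k : ℕ) : Field d :=
  uE ((k : ℝ) * τ) - u k

/-- The time increment `δψ^k = ψ^k - ψ^{k-1}`, used for `k ≥ 1`. -/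
def incr {d : ℕ} (ψ : ℕ → Field d) (k : ℕ) : Field d := ψ k - ψ (k - 1)

/-- The time average `(ψ^{k+1} + ψ^k) / 2`, indexed by `k`. -/
def avg {d : ℕ} (ψ : ℕ → Field d) (k : ℕ) : Field d := (1 / 2 : ℝ) • (ψ (k + 1) + ψ k)

end DirectionSplitting

end

noncomputable section

namespace DirectionSplitting

open MeasureTheory

/-! ### Continuous functions as elements of `L²` -/

/-! Expansion in products of sines and cosines turns the scheme into algebra. Each boundary
condition selects the system in which its operator is diagonal: sines for the velocity, cosines for
the pressure increment. Eliminating the intermediate velocities gives, in both dimensions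
(`velocityStep_coef`), B (u^{k+1} - u^k) = τ (Δu^k - ∇p* + f), B = ∏ᵢ (1 - (τ/2) ∂ᵢᵢ). The exact
solution satisfies the same equation with a residual of size τ² (`residual_bound`). So the errors
satisfy the closed system `ErrorSystem`, whose constant does not depend on the discretization.

The difference of two consecutive error equations is tested with the newest increment δe. Since B ≥
1 - (τ/2) Δ (`one_add_Lam_le_wt`), `energy_component` makes ⟨B δe, δe⟩ telescope and leaves two
nonnegative terms: ‖δ²e‖², and (τ/2) ‖∇(e^{k+2} - e^k)‖², which splits into a divergence and a curl
part (`grad_eq_div_add_curl`).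

After integration by parts the pressure is paired with an increment of div e = τ A φ. In the energy
norm of A (`JRel`) the extrapolation 2φ^{k+1} - φ^k makes τ² ‖Q‖² telescope, where Q is the error of
the pressure increment (`extrapolation_identity`). One term of the wrong sign remains, τ² ‖δ²Q‖². As
A dominates -Δ, the divergence is bounded from L² into the dual norm of A with constant one
(`norm_J_sq_le`), so this term is absorbed exactly by ‖δ²e‖², up to consistency errors. The penalty
with χ also telescopes, up to (χτ/2) ‖div(e^{k+2} - e^k)‖² (`penalty_identity`), which the
divergence part of the gradient absorbs because χ ≤ 1. The curl part survives and gives the summed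
term of the estimate.

The remaining terms are consistency errors. Each step adds O(τ³) S + O(τ⁶), where S² bounds all
energies, and the first step adds O(τ²) S once. Over at most T/τ steps this gives S² ≤ c τ⁴ + c τ²
S, hence S² = O(τ⁴), without a Gronwall argument (`energy_recursion`). The discrete energy controls
every norm of the statement. -/

lemma measurableSet_cube (d : ℕ) : MeasurableSet (cube d) :=
  MeasurableSet.univ_pi fun _ => measurableSet_Ioo

lemma isOpen_cube (d : ℕ) : IsOpen (cube d) :=
  isOpen_set_pi Set.finite_univ fun _ _ => isOpen_Ioo

lemma cube_subset_Icc (d : ℕ) : cube d ⊆ Set.Icc (0 : Fin d → ℝ) 1 := fun _ hx =>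
  ⟨fun i => (hx i (Set.mem_univ i)).1.le, fun i => (hx i (Set.mem_univ i)).2.le⟩

lemma restrict_cube (d : ℕ) : (volume : Measure (Fin d → ℝ)).restrict (cube d) =
    Measure.pi fun _ => (volume : Measure ℝ).restrict (Set.Ioo 0 1) :=
  Measure.restrict_pi_pi _ _

instance isFiniteMeasure_cube (d : ℕ) :
    IsFiniteMeasure ((volume : Measure (Fin d → ℝ)).restrict (cube d)) := by
  rw [restrict_cube]; infer_instance

lemma exists_bound_on_cube {d : ℕ} {ψ : (Fin d → ℝ) → ℝ} (h : Continuous ψ) :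
    ∃ C, ∀ x ∈ cube d, ‖ψ x‖ ≤ C := by
  obtain ⟨C, hC⟩ := (isCompact_Icc (a := (0 : Fin d → ℝ)) (b := 1)).exists_bound_of_continuousOn
    h.continuousOn
  exact ⟨C, fun x hx => hC x (cube_subset_Icc d hx)⟩

lemma memLp_of_continuous {d : ℕ} {ψ : (Fin d → ℝ) → ℝ} (h : Continuous ψ) {p : ENNReal} :
    MemLp ψ p (volume.restrict (cube d)) := by
  obtain ⟨C, hC⟩ := exists_bound_on_cube h
  exact MemLp.of_bound h.aestronglyMeasurable C
    ((ae_restrict_iff' (measurableSet_cube d)).2 (Filter.Eventually.of_forall hC))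

open Classical in
/-- The class in `L²(Ω)` of a function on the whole space, `0` if it is not square integrable. -/
def toL {d : ℕ} (ψ : (Fin d → ℝ) → ℝ) : L2 d :=
  if h : MemLp ψ 2 (volume.restrict (cube d)) then h.toLp ψ else 0

lemma coeFn_toL {d : ℕ} {ψ : (Fin d → ℝ) → ℝ} (h : Continuous ψ) :
    toL ψ =ᵐ[volume.restrict (cube d)] ψ := by
  rw [toL, dif_pos (memLp_of_continuous h)]
  exact MemLp.coeFn_toLp _

lemma inner_eq_integral {d : ℕ} (v w : L2 d) : inner ℝ v w = ∫ x in cube d, v x * w x := by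
  rw [L2.inner_def]
  refine integral_congr_ae (Filter.Eventually.of_forall fun x => ?_)
  simp [mul_comm]

lemma inner_toL {d : ℕ} (v : L2 d) {ψ : (Fin d → ℝ) → ℝ} (h : Continuous ψ) :
    inner ℝ v (toL ψ) = ∫ x in cube d, v x * ψ x := by
  rw [inner_eq_integral]
  refine integral_congr_ae ?_
  filter_upwards [coeFn_toL h] with x hx
  rw [hx]

lemma integrable_L2_mul {d : ℕ} (v : L2 d) {ψ : (Fin d → ℝ) → ℝ} (h : Continuous ψ) :
    Integrable (fun x => v x * ψ x) (volume.restrict (cube d)) :=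
  MemLp.integrable_mul (p := 2) (q := 2) (Lp.memLp v) (memLp_of_continuous h)

lemma eq_zero_of_integral_smooth {d : ℕ} {F : (Fin d → ℝ) → ℝ}
    (hF : Integrable F (volume.restrict (cube d)))
    (h : ∀ ψ : (Fin d → ℝ) → ℝ, IsSmooth ψ → HasCompactSupport ψ → tsupport ψ ⊆ cube d →
      ∫ x in cube d, F x * ψ x = 0) : F =ᵐ[volume.restrict (cube d)] 0 := by
  have := (isOpen_cube d).ae_eq_zero_of_integral_contDiff_smul_eq_zero
    (f := F) (μ := volume) (IntegrableOn.locallyIntegrableOn hF) (fun g hg hc ht => by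
      rw [← h g hg hc ht, ← setIntegral_eq_integral_of_forall_compl_eq_zero (s := cube d)]
      · simp [mul_comm]
      · intro x hx
        have : g x = 0 := by
          by_contra h0
          exact hx (ht (subset_tsupport g h0))
        simp [this])
  exact (ae_restrict_iff' (measurableSet_cube d)).2 this

lemma L2_eq_of_integral_smooth {d : ℕ} {v w : L2 d}
    (h : ∀ ψ : (Fin d → ℝ) → ℝ, IsSmooth ψ → HasCompactSupport ψ → tsupport ψ ⊆ cube d →
      ∫ x in cube d, v x * ψ x = ∫ x in cube d, w x * ψ x) : v = w := by
  rw [← sub_eq_zero]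
  refine Lp.ext ?_
  have h0 : (fun x => (v - w : L2 d) x) =ᵐ[volume.restrict (cube d)] 0 := by
    refine eq_zero_of_integral_smooth ((Lp.memLp (v - w)).integrable one_le_two) ?_
    intro ψ hψ hc ht
    rw [← inner_toL _ hψ.continuous, inner_sub_left, inner_toL _ hψ.continuous,
      inner_toL _ hψ.continuous, h ψ hψ hc ht, sub_self]
  exact h0.trans (Lp.coeFn_zero _ _ _).symm

lemma HasWeakDeriv.unique {d : ℕ} {l : List (Fin d)} {v g g' : L2 d}
    (h : HasWeakDeriv l v g) (h' : HasWeakDeriv l v g') : g = g' := by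
  refine L2_eq_of_integral_smooth fun ψ hψ hc ht => ?_
  have := (h ψ hψ hc ht).symm.trans (h' ψ hψ hc ht)
  exact mul_left_cancel₀ (pow_ne_zero _ (by norm_num)) this

/-! ### The trigonometric systems -/

/-- The normalized functions `√2 sin(πkx)` (`s = true`) and `cos(πkx)` (`s = false`). -/
def trig (s : Bool) (k : ℕ) (x : ℝ) : ℝ :=
  bif s then √2 * Real.sin (Real.pi * k * x)
  else (if k = 0 then 1 else √2) * Real.cos (Real.pi * k * x)

/-- Tensor products of functions of one variable. -/
def tens {d : ℕ} (α : Fin d → ℝ → ℝ) (x : Fin d → ℝ) : ℝ := ∏ l, α l (x l)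

/-- Products of sines in the directions of `σ` and cosines in the others. -/
def bas {d : ℕ} (σ : Fin d → Bool) (n : Fin d → ℕ) : (Fin d → ℝ) → ℝ :=
  tens fun l => trig (σ l) (n l)

/-- The coefficients of `v` in the trigonometric system `σ`. -/
def coef {d : ℕ} (σ : Fin d → Bool) (v : L2 d) (n : Fin d → ℕ) : ℝ :=
  inner ℝ v (toL (bas σ n))

/-- The indices of the functions that do not vanish. -/
def Good {d : ℕ} (σ : Fin d → Bool) (n : Fin d → ℕ) : Prop := ∀ l, σ l = true → n l ≠ 0

lemma contDiff_trig (s : Bool) (k : ℕ) : ContDiff ℝ ((⊤ : ℕ∞) : WithTop ℕ∞) (trig s k) := by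
  cases s <;> unfold trig <;> dsimp only [cond_true, cond_false] <;> fun_prop

lemma contDiff_tens {d : ℕ} {α : Fin d → ℝ → ℝ}
    (h : ∀ l, ContDiff ℝ ((⊤ : ℕ∞) : WithTop ℕ∞) (α l)) : IsSmooth (tens α) := by
  unfold IsSmooth tens
  exact contDiff_prod fun l _ => (h l).comp (contDiff_apply ℝ ℝ l)

lemma continuous_tens {d : ℕ} {α : Fin d → ℝ → ℝ} (h : ∀ l, Continuous (α l)) :
    Continuous (tens α) := by
  unfold tens
  exact continuous_finsetProd _ fun l _ => (h l).comp (continuous_apply l)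

lemma isSmooth_bas {d : ℕ} (σ : Fin d → Bool) (n : Fin d → ℕ) : IsSmooth (bas σ n) :=
  contDiff_tens fun _ => contDiff_trig _ _

lemma continuous_bas {d : ℕ} (σ : Fin d → Bool) (n : Fin d → ℕ) : Continuous (bas σ n) :=
  (isSmooth_bas σ n).continuous

lemma coef_eq_integral {d : ℕ} (σ : Fin d → Bool) (v : L2 d) (n : Fin d → ℕ) :
    coef σ v n = ∫ x in cube d, v x * bas σ n x := inner_toL v (continuous_bas σ n)

lemma bas_eq_zero {d : ℕ} {σ : Fin d → Bool} {n : Fin d → ℕ} (h : ¬ Good σ n) : bas σ n = 0 := by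
  simp only [Good, not_forall, not_not] at h
  obtain ⟨l, hl, hn⟩ := h
  funext x
  exact Finset.prod_eq_zero (Finset.mem_univ l) (by simp [trig, hl, hn])

lemma coef_eq_zero {d : ℕ} {σ : Fin d → Bool} {n : Fin d → ℕ} (h : ¬ Good σ n) (v : L2 d) :
    coef σ v n = 0 := by
  rw [coef_eq_integral, bas_eq_zero h]; simp

lemma integral_cos_int (m : ℤ) :
    ∫ x in Set.Ioo (0 : ℝ) 1, Real.cos (Real.pi * m * x) = if m = 0 then 1 else 0 := by
  rw [← integral_Ioc_eq_integral_Ioo, ← intervalIntegral.integral_of_le zero_le_one]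
  split_ifs with h
  · simp [h]
  · have hm : Real.pi * m ≠ 0 := mul_ne_zero Real.pi_ne_zero (by exact_mod_cast h)
    rw [intervalIntegral.integral_comp_mul_left (fun y => Real.cos y) hm]
    simp [mul_comm Real.pi, Real.sin_int_mul_pi]

lemma integral_trig_mul (s : Bool) (j k : ℕ) :
    ∫ x in Set.Ioo (0 : ℝ) 1, trig s j x * trig s k x =
      if j = k ∧ (s = true → k ≠ 0) then 1 else 0 := by
  have h1 := integral_cos_int ((j : ℤ) - k)
  have h2 := integral_cos_int ((j : ℤ) + k)
  have i1 : ∀ m : ℤ, Integrable (fun x => Real.cos (Real.pi * m * x))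
      (volume.restrict (Set.Ioo (0 : ℝ) 1)) := fun m =>
    (Continuous.integrableOn_Icc (by fun_prop)).mono_set Set.Ioo_subset_Icc_self
  have e0 : √2 * √2 = 2 := Real.mul_self_sqrt (by norm_num)
  cases s with
  | true =>
    have : ∀ x, trig true j x * trig true k x =
        Real.cos (Real.pi * ((j : ℤ) - k : ℤ) * x) - Real.cos (Real.pi * ((j : ℤ) + k : ℤ) * x) := by
      intro x
      have a1 : Real.pi * ((j : ℤ) - k : ℤ) * x = Real.pi * j * x - Real.pi * k * x := by
        push_cast; ring
      have a2 : Real.pi * ((j : ℤ) + k : ℤ) * x = Real.pi * j * x + Real.pi * k * x := by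
        push_cast; ring
      rw [a1, a2, Real.cos_sub, Real.cos_add]
      simp only [trig, cond_true]
      linear_combination Real.sin (Real.pi * j * x) * Real.sin (Real.pi * k * x) * e0
    simp_rw [this]
    rw [integral_sub (i1 _) (i1 _), h1, h2]
    grind
  | false =>
    have : ∀ x, trig false j x * trig false k x =
        ((if j = 0 then 1 else √2) * (if k = 0 then 1 else √2) / 2) *
        (Real.cos (Real.pi * ((j : ℤ) - k : ℤ) * x) +
          Real.cos (Real.pi * ((j : ℤ) + k : ℤ) * x)) := by
      intro x
      have a1 : Real.pi * ((j : ℤ) - k : ℤ) * x = Real.pi * j * x - Real.pi * k * x := by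
        push_cast; ring
      have a2 : Real.pi * ((j : ℤ) + k : ℤ) * x = Real.pi * j * x + Real.pi * k * x := by
        push_cast; ring
      rw [a1, a2, Real.cos_sub, Real.cos_add]
      simp only [trig, cond_false]
      ring
    simp_rw [this]
    rw [integral_const_mul, integral_add (i1 _) (i1 _), h1, h2]
    rcases eq_or_ne j 0 with hj | hj <;> rcases eq_or_ne k 0 with hk | hk
    · simp [hj, hk]; norm_num
    · have : (0 : ℤ) - k ≠ 0 := by omega
      simp [hj, hk, hk.symm]
    · simp [hj, hk]
    · have : ¬ ((j : ℤ) + k = 0) := by omega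
      by_cases hjk : j = k
      · subst hjk; simp [hj, e0]
      · have : ¬ ((j : ℤ) - k = 0) := by omega
        simp [*]

lemma integral_tens {d : ℕ} (α : Fin d → ℝ → ℝ) :
    ∫ x in cube d, tens α x = ∏ l, ∫ x in Set.Ioo (0 : ℝ) 1, α l x := by
  rw [restrict_cube]
  exact integral_fintype_prod_eq_prod α

open Classical in
lemma inner_bas {d : ℕ} (σ : Fin d → Bool) (n m : Fin d → ℕ) :
    inner ℝ (toL (bas σ n)) (toL (bas σ m)) = if n = m ∧ Good σ m then 1 else 0 := by
  rw [inner_toL _ (continuous_bas σ m)]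
  have : ∫ x in cube d, (toL (bas σ n) : L2 d) x * bas σ m x =
      ∫ x in cube d, tens (fun l y => trig (σ l) (n l) y * trig (σ l) (m l) y) x := by
    refine integral_congr_ae ?_
    filter_upwards [coeFn_toL (continuous_bas σ n)] with x hx
    rw [hx]
    simp [bas, tens, Finset.prod_mul_distrib]
  rw [this, integral_tens]
  simp_rw [integral_trig_mul]
  split_ifs with h
  · refine Finset.prod_eq_one fun l _ => if_pos ⟨congrFun h.1 l, h.2 l⟩
  · have : ∃ l, ¬ (n l = m l ∧ (σ l = true → m l ≠ 0)) := by
      by_contra hc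
      push Not at hc
      exact h ⟨funext fun l => (hc l).1, fun l => (hc l).2⟩
    obtain ⟨l, hl⟩ := this
    exact Finset.prod_eq_zero (Finset.mem_univ l) (if_neg hl)

/-! ### Completeness of the trigonometric systems -/

lemma tens_eq_mul {d : ℕ} (α : Fin d → ℝ → ℝ) (i : Fin d) (x : Fin d → ℝ) :
    tens α x = α i (x i) * ∏ l ∈ Finset.univ.erase i, α l (x l) :=
  (Finset.mul_prod_erase _ (fun l => α l (x l)) (Finset.mem_univ i)).symm

lemma tens_update {d : ℕ} (α : Fin d → ℝ → ℝ) (i : Fin d) (β : ℝ → ℝ) (x : Fin d → ℝ) :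
    tens (Function.update α i β) x = β (x i) * ∏ l ∈ Finset.univ.erase i, α l (x l) := by
  rw [tens_eq_mul _ i, Function.update_self]
  congr 1
  exact Finset.prod_congr rfl fun l hl => by
    rw [Function.update_of_ne (Finset.ne_of_mem_erase hl)]

lemma bas_update_index {d : ℕ} (σ : Fin d → Bool) (n : Fin d → ℕ) (i : Fin d) (k : ℕ) :
    bas σ (Function.update n i k) = tens (Function.update (fun l => trig (σ l) (n l)) i
      (trig (σ i) k)) := by
  unfold bas
  congr 1
  funext l
  by_cases h : l = i
  · subst h; simp
  · simp [Function.update_of_ne h]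

/-- Product-to-sum formulas. They make the span of every mixed sine and cosine system a module over
the polynomials in the coordinate cosines, which is the route to completeness. -/
lemma trig_mul_cos (s : Bool) (k : ℕ) : ∃ (a b : ℝ) (k₁ k₂ : ℕ), ∀ x,
    trig s k x * Real.cos (Real.pi * x) = a * trig s k₁ x + b * trig s k₂ x := by
  have key : ∀ m : ℕ, ∀ x : ℝ,
      Real.sin (Real.pi * (m + 1 : ℕ) * x) * Real.cos (Real.pi * x) * 2 =
        Real.sin (Real.pi * (m + 2 : ℕ) * x) + Real.sin (Real.pi * m * x) ∧
      Real.cos (Real.pi * (m + 1 : ℕ) * x) * Real.cos (Real.pi * x) * 2 =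
        Real.cos (Real.pi * (m + 2 : ℕ) * x) + Real.cos (Real.pi * m * x) := by
    intro m x
    have a1 : Real.pi * (m + 2 : ℕ) * x = Real.pi * (m + 1 : ℕ) * x + Real.pi * x := by
      push_cast; ring
    have a2 : Real.pi * (m : ℕ) * x = Real.pi * (m + 1 : ℕ) * x - Real.pi * x := by
      push_cast; ring
    rw [a1, a2, Real.sin_add, Real.sin_sub, Real.cos_add, Real.cos_sub]
    constructor <;> ring
  have e0 : √2 * √2 = 2 := Real.mul_self_sqrt (by norm_num)
  cases s with
  | true =>
    cases k with
    | zero => exact ⟨0, 0, 0, 0, fun x => by simp [trig]⟩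
    | succ m =>
      refine ⟨1 / 2, 1 / 2, m + 2, m, fun x => ?_⟩
      simp only [trig, cond_true]
      linear_combination √2 / 2 * (key m x).1
  | false =>
    match k with
    | 0 =>
      refine ⟨√2 / 2, 0, 1, 0, fun x => ?_⟩
      simp only [trig, cond_false]
      simp
      linear_combination - Real.cos (Real.pi * x) / 2 * e0
    | 1 =>
      refine ⟨1 / 2, √2 / 2, 2, 0, fun x => ?_⟩
      have := (key 0 x).2
      simp only [trig, cond_false]
      simp at this ⊢
      linear_combination √2 / 2 * this
    | m + 2 =>
      refine ⟨1 / 2, 1 / 2, m + 3, m + 1, fun x => ?_⟩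
      have := (key (m + 1) x).2
      rw [show m + 1 + 1 = m + 2 from rfl, show m + 1 + 2 = m + 3 from rfl] at this
      simp only [trig, cond_false, Nat.add_eq_zero_iff, OfNat.ofNat_ne_zero, one_ne_zero, and_false,
        if_false]
      linear_combination √2 / 2 * this

lemma mul_cos_mem_span {d : ℕ} (σ : Fin d → Bool) (i : Fin d) (h : (Fin d → ℝ) → ℝ)
    (hh : h ∈ Submodule.span ℝ (Set.range (bas σ))) :
    (fun x => h x * Real.cos (Real.pi * x i)) ∈ Submodule.span ℝ (Set.range (bas σ)) := by
  induction hh using Submodule.span_induction with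
  | mem h hh =>
    obtain ⟨n, rfl⟩ := hh
    obtain ⟨a, b, k₁, k₂, hk⟩ := trig_mul_cos (σ i) (n i)
    have : (fun x => bas σ n x * Real.cos (Real.pi * x i)) =
        a • bas σ (Function.update n i k₁) + b • bas σ (Function.update n i k₂) := by
      funext x
      simp only [Pi.add_apply, Pi.smul_apply, smul_eq_mul, bas_update_index, tens_update]
      have h1 : bas σ n x = _ := tens_eq_mul _ i x
      rw [h1]
      linear_combination (∏ l ∈ Finset.univ.erase i, trig (σ l) (n l) (x l)) * hk (x i)
    rw [this]
    exact Submodule.add_mem _ (Submodule.smul_mem _ _ (Submodule.subset_span ⟨_, rfl⟩))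
      (Submodule.smul_mem _ _ (Submodule.subset_span ⟨_, rfl⟩))
  | zero =>
    convert Submodule.zero_mem (Submodule.span ℝ (Set.range (bas σ))) using 1
    funext z; simp
  | add x y _ _ hx hy =>
    convert Submodule.add_mem _ hx hy using 1
    funext z; simp [add_mul]
  | smul a x _ hx =>
    convert Submodule.smul_mem _ a hx using 1
    funext z; simp [mul_assoc]

/-- The coordinate cosines on the closed cube. -/
def cosMap {d : ℕ} (i : Fin d) : C(Set.Icc (0 : Fin d → ℝ) 1, ℝ) :=
  ⟨fun x => Real.cos (Real.pi * x.1 i),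
    Real.continuous_cos.comp (continuous_const.mul ((continuous_apply i).comp continuous_subtype_val))⟩

lemma mul_adjoin_mem_span {d : ℕ} (σ : Fin d → Bool) {p : C(Set.Icc (0 : Fin d → ℝ) 1, ℝ)}
    (hp : p ∈ Algebra.adjoin ℝ (Set.range (cosMap (d := d)))) :
    ∀ h ∈ Submodule.span ℝ (Set.range (bas σ)), ∃ h' ∈ Submodule.span ℝ (Set.range (bas σ)),
      ∀ x : Set.Icc (0 : Fin d → ℝ) 1, h' x.1 = p x * h x.1 := by
  induction hp using Algebra.adjoin_induction with
  | mem p hp =>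
    obtain ⟨i, rfl⟩ := hp
    intro h hh
    exact ⟨_, mul_cos_mem_span σ i h hh, fun x => mul_comm _ _⟩
  | algebraMap r =>
    intro h hh
    exact ⟨r • h, Submodule.smul_mem _ _ hh, fun x => by simp⟩
  | add p q _ _ ihp ihq =>
    intro h hh
    obtain ⟨h1, m1, e1⟩ := ihp h hh
    obtain ⟨h2, m2, e2⟩ := ihq h hh
    exact ⟨h1 + h2, Submodule.add_mem _ m1 m2, fun x => by simp [e1, e2, add_mul]⟩
  | mul p q _ _ ihp ihq =>
    intro h hh
    obtain ⟨h1, m1, e1⟩ := ihq h hh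
    obtain ⟨h2, m2, e2⟩ := ihp h1 m1
    exact ⟨h2, m2, fun x => by simp [e1, e2, mul_assoc]⟩

/-- Stone–Weierstrass: cos(π ·) is injective on [0,1], so the coordinate cosines separate the points
of the closed cube. -/
lemma adjoin_cosMap_dense (d : ℕ) :
    (Algebra.adjoin ℝ (Set.range (cosMap (d := d)))).topologicalClosure = ⊤ := by
  apply ContinuousMap.subalgebra_topologicalClosure_eq_top_of_separatesPoints
  intro x y hxy
  obtain ⟨i, hi⟩ : ∃ i, x.1 i ≠ y.1 i := by
    by_contra hc
    push Not at hc
    exact hxy (Subtype.ext (funext hc))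
  refine ⟨cosMap i, ⟨cosMap i, Algebra.subset_adjoin ⟨i, rfl⟩, rfl⟩, fun h => hi ?_⟩
  have hpi := Real.pi_pos
  have hm : ∀ z : Set.Icc (0 : Fin d → ℝ) 1, Real.pi * z.1 i ∈ Set.Icc 0 Real.pi := fun z =>
    ⟨mul_nonneg hpi.le (z.2.1 i), by have := z.2.2 i; simp at this; nlinarith⟩
  exact mul_left_cancel₀ hpi.ne' (Real.injOn_cos (hm x) (hm y) h)

lemma continuous_of_mem_span {d : ℕ} {σ : Fin d → Bool} {h : (Fin d → ℝ) → ℝ}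
    (hh : h ∈ Submodule.span ℝ (Set.range (bas σ))) : Continuous h := by
  induction hh using Submodule.span_induction with
  | mem h hh => obtain ⟨n, rfl⟩ := hh; exact continuous_bas σ n
  | zero => exact continuous_zero
  | add x y _ _ hx hy => exact hx.add hy
  | smul a x _ hx => exact hx.const_smul a

lemma integral_mul_span_eq_zero {d : ℕ} {σ : Fin d → Bool} {v : L2 d}
    (hv : ∀ n, coef σ v n = 0) {h : (Fin d → ℝ) → ℝ}
    (hh : h ∈ Submodule.span ℝ (Set.range (bas σ))) : ∫ x in cube d, v x * h x = 0 := by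
  induction hh using Submodule.span_induction with
  | mem h hh => obtain ⟨n, rfl⟩ := hh; rw [← coef_eq_integral, hv]
  | zero => simp
  | add x y hx hy ihx ihy =>
    simp only [Pi.add_apply, mul_add]
    rw [integral_add (integrable_L2_mul v (continuous_of_mem_span hx))
      (integrable_L2_mul v (continuous_of_mem_span hy)), ihx, ihy, add_zero]
  | smul a x _ hx =>
    simp only [Pi.smul_apply, smul_eq_mul, mul_left_comm _ a]
    rw [integral_const_mul, hx, mul_zero]

/-- The first function of the system `σ`, which is positive on the cube. -/
def firstIndex {d : ℕ} (σ : Fin d → Bool) : Fin d → ℕ := fun l => bif σ l then 1 else 0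

lemma bas_firstIndex_pos {d : ℕ} (σ : Fin d → Bool) {x : Fin d → ℝ} (hx : x ∈ cube d) :
    0 < bas σ (firstIndex σ) x := by
  unfold bas tens
  refine Finset.prod_pos fun l _ => ?_
  have hxl := hx l (Set.mem_univ l)
  have hpi := Real.pi_pos
  cases h : σ l with
  | true =>
    simp only [trig, firstIndex, h, cond_true]
    refine mul_pos (by positivity) (Real.sin_pos_of_pos_of_lt_pi ?_ ?_)
    · have := hxl.1; simp; positivity
    · have := hxl.2; simp; nlinarith
  | false => simp [trig, firstIndex, h]

/-- The system itself is not an algebra when sines occur. But with `h0` its first function, `p * h0`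
lies in the span for every polynomial `p` in the cosines, so `v * h0` is orthogonal to a dense set
of continuous functions and vanishes. As `h0` is positive on the cube, so does `v`. -/
lemma eq_zero_of_coef_eq_zero {d : ℕ} {σ : Fin d → Bool} {v : L2 d}
    (hv : ∀ n, coef σ v n = 0) : v = 0 := by
  set h0 := bas σ (firstIndex σ) with hh0
  have hint := integrable_L2_mul v (continuous_bas σ (firstIndex σ))
  have hz : (fun x => v x * h0 x) =ᵐ[volume.restrict (cube d)] 0 := by
    refine eq_zero_of_integral_smooth hint ?_
    intro ψ hψ _ _
    set C := ∫ x in cube d, ‖v x * h0 x‖ with hC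
    have hC0 : 0 ≤ C := integral_nonneg fun x => norm_nonneg _
    refine abs_nonpos_iff.1 (le_of_forall_pos_le_add fun ε hε => ?_)
    set g : C(Set.Icc (0 : Fin d → ℝ) 1, ℝ) := ⟨fun x => ψ x.1, by
      have := hψ.continuous; fun_prop⟩
    have hg : g ∈ (Algebra.adjoin ℝ (Set.range (cosMap (d := d)))).topologicalClosure := by
      rw [adjoin_cosMap_dense]; trivial
    -- The tolerance is relative to the L¹ norm `C` of `v * h0`; the added 1 covers `C = 0`.
    obtain ⟨p, hpA, hpd⟩ := Metric.mem_closure_iff.1 hg (ε / (C + 1)) (by positivity)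
    obtain ⟨h', hm, he⟩ := mul_adjoin_mem_span σ hpA h0 (Submodule.subset_span ⟨_, rfl⟩)
    have hi1 : Integrable (fun x => v x * h0 x * ψ x) (volume.restrict (cube d)) := by
      have := integrable_L2_mul v ((continuous_bas σ (firstIndex σ)).mul hψ.continuous)
      simpa [mul_assoc] using this
    have hi2 := integrable_L2_mul v (continuous_of_mem_span hm)
    have hz2 := integral_mul_span_eq_zero hv hm
    have : ∫ x in cube d, v x * h0 x * ψ x = ∫ x in cube d, (v x * h0 x * ψ x - v x * h' x) := by
      rw [integral_sub hi1 hi2, hz2, sub_zero]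
    rw [this, zero_add, ← Real.norm_eq_abs]
    calc ‖∫ x in cube d, (v x * h0 x * ψ x - v x * h' x)‖
        ≤ ∫ x in cube d, ‖v x * h0 x‖ * (ε / (C + 1)) := by
          refine norm_integral_le_of_norm_le (hint.norm.mul_const _) ?_
          refine (ae_restrict_iff' (measurableSet_cube d)).2 (Filter.Eventually.of_forall ?_)
          intro x hx
          have hxI := cube_subset_Icc d hx
          have e1 := he ⟨x, hxI⟩
          have e2 : ‖g ⟨x, hxI⟩ - p ⟨x, hxI⟩‖ ≤ ε / (C + 1) := by
            rw [← dist_eq_norm]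
            exact (ContinuousMap.dist_apply_le_dist _).trans hpd.le
          simp only at e1
          rw [e1, show v x * h0 x * ψ x - v x * (p ⟨x, hxI⟩ * h0 x) =
            (v x * h0 x) * (g ⟨x, hxI⟩ - p ⟨x, hxI⟩) by simp [g]; ring, norm_mul]
          exact mul_le_mul_of_nonneg_left e2 (norm_nonneg _)
      _ = C * (ε / (C + 1)) := by rw [integral_mul_const]
      _ ≤ ε := by
          rw [mul_div_assoc', div_le_iff₀ (by positivity)]
          nlinarith
  refine Lp.ext ?_
  have hm := ae_restrict_mem (μ := volume) (measurableSet_cube d)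
  filter_upwards [hz, hm, Lp.coeFn_zero ℝ 2 (volume.restrict (cube d))] with x hx hxm h0
  rw [h0]
  have := (bas_firstIndex_pos σ hxm).ne'
  simpa [hh0, this] using hx

lemma orthonormal_bas {d : ℕ} (σ : Fin d → Bool) :
    Orthonormal ℝ fun n : {n // Good σ n} => (toL (bas σ n.1) : L2 d) := by
  classical
  rw [orthonormal_iff_ite]
  intro n m
  rw [inner_bas]
  simp [m.2, Subtype.ext_iff]

/-- The trigonometric system as a Hilbert basis of `L²(Ω)`. -/
def hbasis {d : ℕ} (σ : Fin d → Bool) : HilbertBasis {n // Good σ n} ℝ (L2 d) :=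
  HilbertBasis.mkOfOrthogonalEqBot (orthonormal_bas σ) (by
    rw [Submodule.eq_bot_iff]
    intro v hv
    refine eq_zero_of_coef_eq_zero (σ := σ) fun n => ?_
    by_cases h : Good σ n
    · rw [coef, real_inner_comm]
      exact (Submodule.mem_orthogonal _ _).1 hv _ (Submodule.subset_span ⟨⟨n, h⟩, rfl⟩)
    · exact coef_eq_zero h v)

lemma hbasis_apply {d : ℕ} (σ : Fin d → Bool) (n : {n // Good σ n}) :
    hbasis σ n = toL (bas σ n.1) := by
  simp [hbasis]

/-- The sum runs over all multi-indices, since the ones that are not `Good` contribute zero.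
Parseval sums in different systems then have a common index set and can be compared term by term;
all integrations by parts below are such comparisons. -/
lemma parseval {d : ℕ} (σ : Fin d → Bool) (v w : L2 d) :
    HasSum (fun n => coef σ v n * coef σ w n) (inner ℝ v w) := by
  have h := (hbasis σ).hasSum_inner_mul_inner v w
  refine (Function.Injective.hasSum_iff Subtype.val_injective ?_).1 (h.congr_fun ?_)
  · intro n hn
    rw [coef_eq_zero (fun hg => hn ⟨⟨n, hg⟩, rfl⟩), zero_mul]
  · intro n
    simp only [Function.comp, hbasis_apply, coef]
    rw [real_inner_comm w]

lemma parseval_norm {d : ℕ} (σ : Fin d → Bool) (v : L2 d) :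
    HasSum (fun n => coef σ v n ^ 2) (‖v‖ ^ 2) := by
  simpa [pow_two, real_inner_self_eq_norm_mul_norm] using parseval σ v v

lemma eq_of_coef_eq {d : ℕ} (σ : Fin d → Bool) {v w : L2 d}
    (h : ∀ n, coef σ v n = coef σ w n) : v = w := by
  rw [← sub_eq_zero]
  refine eq_zero_of_coef_eq_zero (σ := σ) fun n => ?_
  rw [coef, inner_sub_left]
  exact sub_eq_zero.2 (h n)

lemma exists_of_coef {d : ℕ} (σ : Fin d → Bool) (c : (Fin d → ℕ) → ℝ)
    (hc : Summable fun n => c n ^ 2) (h0 : ∀ n, ¬ Good σ n → c n = 0) :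
    ∃ g : L2 d, ∀ n, coef σ g n = c n := by
  have hmem : Memℓp (fun n : {n // Good σ n} => c n.1) 2 := by
    apply memℓp_gen
    have := hc.subtype (fun n => Good σ n)
    simpa [Function.comp_def] using this
  refine ⟨(hbasis σ).repr.symm ⟨_, hmem⟩, fun n => ?_⟩
  by_cases h : Good σ n
  · have := (hbasis σ).repr_apply_apply ((hbasis σ).repr.symm ⟨_, hmem⟩) ⟨n, h⟩
    rw [LinearIsometryEquiv.apply_symm_apply, hbasis_apply, real_inner_comm] at this
    exact this.symm
  · rw [coef_eq_zero h, h0 n h]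

lemma coef_add {d : ℕ} (σ : Fin d → Bool) (v w : L2 d) (n : Fin d → ℕ) :
    coef σ (v + w) n = coef σ v n + coef σ w n := inner_add_left _ _ _

lemma coef_sub {d : ℕ} (σ : Fin d → Bool) (v w : L2 d) (n : Fin d → ℕ) :
    coef σ (v - w) n = coef σ v n - coef σ w n := inner_sub_left _ _ _

lemma coef_neg {d : ℕ} (σ : Fin d → Bool) (v : L2 d) (n : Fin d → ℕ) :
    coef σ (-v) n = - coef σ v n := inner_neg_left _ _

lemma coef_smul {d : ℕ} (σ : Fin d → Bool) (a : ℝ) (v : L2 d) (n : Fin d → ℕ) :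
    coef σ (a • v) n = a * coef σ v n := real_inner_smul_left _ _ _

lemma coef_zero {d : ℕ} (σ : Fin d → Bool) (n : Fin d → ℕ) :
    coef σ (0 : L2 d) n = 0 := inner_zero_left _

lemma coef_sum {d : ℕ} {ι : Type*} (σ : Fin d → Bool) (s : Finset ι) (v : ι → L2 d)
    (n : Fin d → ℕ) : coef σ (∑ i ∈ s, v i) n = ∑ i ∈ s, coef σ (v i) n := sum_inner _ _ _

/-! ### Classical partial derivatives -/

lemma IsSmooth.pd {d : ℕ} {ψ : (Fin d → ℝ) → ℝ} (h : IsSmooth ψ) (i : Fin d) :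
    IsSmooth (pd i ψ) := by
  unfold IsSmooth DirectionSplitting.pd at *
  exact (h.fderiv_right (m := ((⊤ : ℕ∞) : WithTop ℕ∞)) le_rfl).clm_apply contDiff_const

lemma hasCompactSupport_pd {d : ℕ} {ψ : (Fin d → ℝ) → ℝ} (h : HasCompactSupport ψ) (i : Fin d) :
    HasCompactSupport (pd i ψ) := h.fderiv_apply ℝ _

lemma tsupport_pd {d : ℕ} (ψ : (Fin d → ℝ) → ℝ) (i : Fin d) :
    tsupport (pd i ψ) ⊆ tsupport ψ := tsupport_fderiv_apply_subset ℝ _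

lemma pd_comm {d : ℕ} {ψ : (Fin d → ℝ) → ℝ} (h : IsSmooth ψ) (i j : Fin d) :
    pd i (pd j ψ) = pd j (pd i ψ) := by
  funext x
  have hs : IsSymmSndFDerivAt ℝ ψ x :=
    (ContDiff.contDiffAt h).isSymmSndFDerivAt (by
      rw [minSmoothness_of_isRCLikeNormedField]; exact WithTop.coe_le_coe.2 le_top)
  have hd : DifferentiableAt ℝ (fderiv ℝ ψ) x :=
    ((ContDiff.fderiv_right (m := ((⊤ : ℕ∞) : WithTop ℕ∞)) h le_rfl).differentiable
      (by simp)).differentiableAt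
  have key : ∀ a b : Fin d, pd a (pd b ψ) x =
      fderiv ℝ (fderiv ℝ ψ) x (Pi.single a 1) (Pi.single b 1) := by
    intro a b
    unfold pd
    rw [fderiv_clm_apply hd (differentiableAt_const _)]
    simp
  rw [key, key, hs]

lemma IsSmooth.pdList {d : ℕ} {ψ : (Fin d → ℝ) → ℝ} (h : IsSmooth ψ) (l : List (Fin d)) :
    IsSmooth (pdList l ψ) := by
  induction l with
  | nil => exact h
  | cons i l ih => exact ih.pd i

lemma pdList_append {d : ℕ} (l l' : List (Fin d)) (ψ : (Fin d → ℝ) → ℝ) :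
    pdList (l ++ l') ψ = pdList l (pdList l' ψ) := List.foldr_append

lemma pdList_pd {d : ℕ} {ψ : (Fin d → ℝ) → ℝ} (h : IsSmooth ψ) (l : List (Fin d)) (i : Fin d) :
    pdList l (pd i ψ) = pd i (pdList l ψ) := by
  induction l with
  | nil => rfl
  | cons j l ih =>
    change pd j (pdList l (pd i ψ)) = pd i (pd j (pdList l ψ))
    rw [ih, pd_comm (h.pdList l)]

lemma pd_tens {d : ℕ} {α : Fin d → ℝ → ℝ} (h : ∀ l, Differentiable ℝ (α l)) (i : Fin d) :
    pd i (tens α) = tens (Function.update α i (deriv (α i))) := by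
  funext x
  have hp : HasFDerivAt (tens α) _ x := HasFDerivAt.finsetProd (u := Finset.univ)
    (g := fun l (y : Fin d → ℝ) => α l (y l)) (x := x) fun l _ =>
      ((h l (x l)).hasDerivAt.hasFDerivAt).comp x
        (hasFDerivAt_apply (𝕜 := ℝ) (F' := fun _ : Fin d => ℝ) l x)
  unfold pd
  rw [hp.fderiv, tens_update, sum_apply,
    Finset.sum_eq_single i]
  · simp [mul_comm]
  · intro b _ hb
    simp [hb]
  · simp

lemma deriv_trig_true (k : ℕ) : deriv (trig true k) = fun x => Real.pi * k * trig false k x := by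
  funext x
  have : HasDerivAt (trig true k) (√2 * (Real.cos (Real.pi * k * x) * (Real.pi * k))) x := by
    unfold trig
    have := ((hasDerivAt_id x).const_mul (Real.pi * k)).sin.const_mul √2
    simpa using this
  rw [this.deriv]
  simp only [trig, cond_false]
  rcases Nat.eq_zero_or_pos k with h | h
  · simp [h]
  · rw [if_neg h.ne']; ring

lemma deriv_trig_false (k : ℕ) :
    deriv (trig false k) = fun x => - (Real.pi * k) * trig true k x := by
  funext x
  have : HasDerivAt (trig false k) ((if k = 0 then 1 else √2) *
      (-Real.sin (Real.pi * k * x) * (Real.pi * k))) x := by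
    unfold trig
    have := ((hasDerivAt_id x).const_mul (Real.pi * k)).cos.const_mul (if k = 0 then 1 else √2)
    simpa using this
  rw [this.deriv]
  simp only [trig, cond_true]
  rcases Nat.eq_zero_or_pos k with h | h
  · simp [h]
  · rw [if_neg h.ne']; ring

/-! ### Pairing with tensor products -/

/-- The pairing of `v` with a tensor product. -/
def pr {d : ℕ} (v : L2 d) (α : Fin d → ℝ → ℝ) : ℝ := ∫ x in cube d, v x * tens α x

lemma pr_update_const_mul {d : ℕ} (v : L2 d) (α : Fin d → ℝ → ℝ) (i : Fin d) (c : ℝ) (β : ℝ → ℝ) :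
    pr v (Function.update α i fun x => c * β x) = c * pr v (Function.update α i β) := by
  unfold pr
  rw [← integral_const_mul]
  congr 1
  funext x
  rw [tens_update, tens_update]
  ring

lemma tendsto_pr {d : ℕ} (v : L2 d) {α : ℕ → Fin d → ℝ → ℝ} {β : Fin d → ℝ → ℝ} {C : Fin d → ℝ}
    (hc : ∀ m l, Continuous (α m l))
    (hb : ∀ m l, ∀ x ∈ Set.Ioo (0 : ℝ) 1, |α m l x| ≤ C l)
    (ht : ∀ l, ∀ x ∈ Set.Ioo (0 : ℝ) 1,
      Filter.Tendsto (fun m => α m l x) Filter.atTop (nhds (β l x))) :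
    Filter.Tendsto (fun m => pr v (α m)) Filter.atTop (nhds (pr v β)) := by
  unfold pr
  refine tendsto_integral_of_dominated_convergence (fun x => ‖v x‖ * ∏ l, C l) ?_ ?_ ?_ ?_
  · intro m
    exact (Lp.aestronglyMeasurable v).mul (continuous_tens (hc m)).aestronglyMeasurable
  · exact (((Lp.memLp v).integrable one_le_two).norm).mul_const _
  · intro m
    refine (ae_restrict_iff' (measurableSet_cube d)).2 (Filter.Eventually.of_forall fun x hx => ?_)
    rw [norm_mul]
    refine mul_le_mul_of_nonneg_left ?_ (norm_nonneg _)
    rw [tens, Real.norm_eq_abs, Finset.abs_prod]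
    exact Finset.prod_le_prod (fun _ _ => abs_nonneg _) fun l _ => hb m l _ (hx l (Set.mem_univ l))
  · refine (ae_restrict_iff' (measurableSet_cube d)).2 (Filter.Eventually.of_forall fun x hx => ?_)
    exact (tendsto_finsetProd _ fun l _ => ht l _ (hx l (Set.mem_univ l))).const_mul _

/-! ### Cut-off functions -/

/-- A smooth function that vanishes near `0` and `1` and is `1` on most of the interval. -/
def cutoff (m : ℕ) (x : ℝ) : ℝ :=
  Real.smoothTransition ((m + 1) * x - 1) * Real.smoothTransition ((m + 1) * (1 - x) - 1)

lemma contDiff_cutoff (m : ℕ) : ContDiff ℝ ((⊤ : ℕ∞) : WithTop ℕ∞) (cutoff m) := by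
  unfold cutoff
  exact (Real.smoothTransition.contDiff.comp (by fun_prop)).mul
    (Real.smoothTransition.contDiff.comp (by fun_prop))

lemma abs_cutoff_le (m : ℕ) (x : ℝ) : |cutoff m x| ≤ 1 := by
  unfold cutoff
  rw [abs_of_nonneg (mul_nonneg (Real.smoothTransition.nonneg _) (Real.smoothTransition.nonneg _))]
  exact mul_le_one₀ (Real.smoothTransition.le_one _) (Real.smoothTransition.nonneg _)
    (Real.smoothTransition.le_one _)

lemma tsupport_cutoff (m : ℕ) : tsupport (cutoff m) ⊆ Set.Ioo 0 1 := by
  have hm : (0 : ℝ) < m + 1 := by positivity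
  have h : tsupport (cutoff m) ⊆ Set.Icc (1 / (m + 1 : ℝ)) (1 - 1 / (m + 1)) := by
    refine closure_minimal ?_ isClosed_Icc
    intro x hx
    rw [Function.mem_support, cutoff] at hx
    have h1 : ¬ ((m + 1) * x - 1 ≤ 0) := fun h => hx (by
      rw [Real.smoothTransition.zero_of_nonpos h, zero_mul])
    have h2 : ¬ ((m + 1) * (1 - x) - 1 ≤ 0) := fun h => hx (by
      rw [Real.smoothTransition.zero_of_nonpos h, mul_zero])
    constructor
    · rw [div_le_iff₀ hm]; nlinarith
    · have : 1 / (m + 1 : ℝ) ≤ 1 - x := by rw [div_le_iff₀ hm]; nlinarith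
      linarith
  intro x hx
  have := h hx
  have hp : 0 < 1 / (m + 1 : ℝ) := by positivity
  exact ⟨by linarith [this.1], by linarith [this.2]⟩

lemma cutoff_eventually_eq {x : ℝ} (hx : x ∈ Set.Ioo (0 : ℝ) 1) :
    ∀ᶠ m in Filter.atTop, cutoff m =ᶠ[nhds x] fun _ => 1 := by
  obtain ⟨N, hN⟩ := exists_nat_gt (2 / x)
  obtain ⟨N', hN'⟩ := exists_nat_gt (2 / (1 - x))
  have hx1 : 0 < 1 - x := by linarith [hx.2]
  rw [div_lt_iff₀ hx.1] at hN
  rw [div_lt_iff₀ hx1] at hN'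
  filter_upwards [Filter.eventually_ge_atTop (max N N')] with m hm
  have h1 : (N : ℝ) ≤ m := by exact_mod_cast (le_max_left _ _).trans hm
  have h2 : (N' : ℝ) ≤ m := by exact_mod_cast (le_max_right _ _).trans hm
  have c1 : ∀ᶠ y in nhds x, 1 < (m + 1 : ℝ) * y - 1 :=
    Filter.Tendsto.eventually_const_lt (v := (m + 1 : ℝ) * x - 1) (by nlinarith [hx.1])
      (by fun_prop : Continuous fun y : ℝ => (m + 1 : ℝ) * y - 1).continuousAt
  have c2 : ∀ᶠ y in nhds x, 1 < (m + 1 : ℝ) * (1 - y) - 1 :=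
    Filter.Tendsto.eventually_const_lt (v := (m + 1 : ℝ) * (1 - x) - 1) (by nlinarith)
      (by fun_prop : Continuous fun y : ℝ => (m + 1 : ℝ) * (1 - y) - 1).continuousAt
  filter_upwards [c1, c2] with y h1 h2
  rw [cutoff, Real.smoothTransition.one_of_one_le h1.le, Real.smoothTransition.one_of_one_le h2.le,
    mul_one]

/-- At y = (m+1)x - 1 the factor y + 1 is (m+1)x, so this bounds the slope of the cutoff times the
distance to the endpoint, uniformly in m. -/
lemma exists_bound_deriv_smoothTransition :
    ∃ C, 0 ≤ C ∧ ∀ y, |deriv Real.smoothTransition y * (y + 1)| ≤ C := by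
  have hcd : Continuous (deriv Real.smoothTransition) :=
    (Real.smoothTransition.contDiff (n := 1)).continuous_deriv le_rfl
  obtain ⟨C, hC⟩ := (isCompact_Icc (a := (0 : ℝ)) (b := 1)).exists_bound_of_continuousOn
    (f := fun y => deriv Real.smoothTransition y * (y + 1)) (by fun_prop)
  refine ⟨max C 0, le_max_right _ _, fun y => ?_⟩
  by_cases h : y ∈ Set.Icc (0 : ℝ) 1
  · exact (hC y h).trans (le_max_left _ _)
  · have : deriv Real.smoothTransition y = 0 := by
      rw [Set.mem_Icc, not_and_or, not_le, not_le] at h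
      rcases h with h | h
      · have : Real.smoothTransition =ᶠ[nhds y] fun _ => 0 := by
          filter_upwards [gt_mem_nhds h] with z hz
          exact Real.smoothTransition.zero_of_nonpos hz.le
        rw [this.deriv_eq, deriv_const]
      · have : Real.smoothTransition =ᶠ[nhds y] fun _ => 1 := by
          filter_upwards [lt_mem_nhds h] with z hz
          exact Real.smoothTransition.one_of_one_le hz.le
        rw [this.deriv_eq, deriv_const]
    simp [this]

/-- The cutoff has slope of order m, but only at distance of order 1/m from the endpoints, where a
function vanishing there is of order 1/m as well. This supplies the dominating function for removing
the cutoff under a derivative. -/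
lemma exists_bound_deriv_cutoff_mul {α : ℝ → ℝ} (hα : ContDiff ℝ ((⊤ : ℕ∞) : WithTop ℕ∞) α)
    (h0 : α 0 = 0) (h1 : α 1 = 0) :
    ∃ C, ∀ m, ∀ x ∈ Set.Ioo (0 : ℝ) 1, |deriv (fun y => cutoff m y * α y) x| ≤ C := by
  obtain ⟨S, hS0, hS⟩ := exists_bound_deriv_smoothTransition
  have hd : Differentiable ℝ α := hα.differentiable (by simp)
  obtain ⟨L, hL⟩ := (isCompact_Icc (a := (0 : ℝ)) (b := 1)).exists_bound_of_continuousOn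
    (hα.continuous_deriv (by simp)).continuousOn
  have hlip : ∀ x ∈ Set.Icc (0 : ℝ) 1, ∀ y ∈ Set.Icc (0 : ℝ) 1, ‖α y - α x‖ ≤ L * ‖y - x‖ :=
    fun x hx y hy => Convex.norm_image_sub_le_of_norm_deriv_le (fun z _ => hd z) hL
      (convex_Icc 0 1) hx hy
  -- One term `S * L` for the slope at each endpoint, and `L` for the derivative of `α` itself.
  refine ⟨S * L + S * L + L, fun m x hx => ?_⟩
  have hxI : x ∈ Set.Icc (0 : ℝ) 1 := ⟨hx.1.le, hx.2.le⟩
  have hL0 : 0 ≤ L := (norm_nonneg _).trans (hL x hxI)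
  have hm : (0 : ℝ) < m + 1 := by positivity
  set A := (m + 1 : ℝ) * x - 1 with hA
  set B := (m + 1 : ℝ) * (1 - x) - 1 with hB
  have hst : Differentiable ℝ Real.smoothTransition :=
    (Real.smoothTransition.contDiff (n := 1)).differentiable (by simp)
  have dA : HasDerivAt (fun y : ℝ => Real.smoothTransition ((m + 1) * y - 1))
      (deriv Real.smoothTransition A * (m + 1)) x := by
    have h2 : HasDerivAt (fun y : ℝ => (m + 1 : ℝ) * y - 1) (m + 1 : ℝ) x := by
      simpa using ((hasDerivAt_id x).const_mul (m + 1 : ℝ)).sub_const 1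
    exact HasDerivAt.comp x (hst A).hasDerivAt h2
  have dB : HasDerivAt (fun y : ℝ => Real.smoothTransition ((m + 1) * (1 - y) - 1))
      (deriv Real.smoothTransition B * (-(m + 1))) x := by
    have h2 : HasDerivAt (fun y : ℝ => (m + 1 : ℝ) * (1 - y) - 1) (-(m + 1 : ℝ)) x := by
      have := ((((hasDerivAt_id x).const_sub 1)).const_mul (m + 1 : ℝ)).sub_const 1
      simpa [mul_comm, add_comm] using this
    exact HasDerivAt.comp x (hst B).hasDerivAt h2
  have dall := (dA.mul dB).mul (hd x).hasDerivAt
  have : deriv (fun y => cutoff m y * α y) x = _ := dall.deriv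
  rw [this]
  have a1 : |α x| ≤ L * x := by
    have := hlip 0 (by simp) x hxI
    rwa [h0, sub_zero, sub_zero, Real.norm_eq_abs, Real.norm_eq_abs, abs_of_pos hx.1] at this
  have a2 : |α x| ≤ L * (1 - x) := by
    have := hlip x hxI 1 (by simp)
    rwa [h1, zero_sub, norm_neg, Real.norm_eq_abs, Real.norm_eq_abs,
      abs_of_pos (sub_pos.2 hx.2)] at this
  have t1 : |deriv Real.smoothTransition A * (m + 1) * α x| ≤ S * L := by
    have e := hS A
    rw [show A + 1 = (m + 1) * x by rw [hA]; ring, abs_mul, abs_of_pos (mul_pos hm hx.1)] at e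
    rw [abs_mul, abs_mul, abs_of_pos hm]
    calc |deriv Real.smoothTransition A| * (m + 1) * |α x|
        ≤ |deriv Real.smoothTransition A| * (m + 1) * (L * x) := by gcongr
      _ = (|deriv Real.smoothTransition A| * ((m + 1) * x)) * L := by ring
      _ ≤ S * L := by gcongr
  have hx1 : 0 < 1 - x := by linarith [hx.2]
  have t2 : |deriv Real.smoothTransition B * (-(m + 1)) * α x| ≤ S * L := by
    have e := hS B
    rw [show B + 1 = (m + 1) * (1 - x) by rw [hB]; ring, abs_mul, abs_of_pos (mul_pos hm hx1)] at e
    rw [abs_mul, abs_mul, abs_neg, abs_of_pos hm]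
    calc |deriv Real.smoothTransition B| * (m + 1) * |α x|
        ≤ |deriv Real.smoothTransition B| * (m + 1) * (L * (1 - x)) := by gcongr
      _ = (|deriv Real.smoothTransition B| * ((m + 1) * (1 - x))) * L := by ring
      _ ≤ S * L := by gcongr
  have s1 : |Real.smoothTransition A| ≤ 1 := by
    rw [abs_of_nonneg (Real.smoothTransition.nonneg _)]; exact Real.smoothTransition.le_one _
  have s2 : |Real.smoothTransition B| ≤ 1 := by
    rw [abs_of_nonneg (Real.smoothTransition.nonneg _)]; exact Real.smoothTransition.le_one _
  have hdx : |deriv α x| ≤ L := hL x hxI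
  simp only [Pi.mul_apply]
  rw [show (deriv Real.smoothTransition A * (m + 1) * Real.smoothTransition B +
      Real.smoothTransition A * (deriv Real.smoothTransition B * (-(m + 1)))) * α x +
      Real.smoothTransition A * Real.smoothTransition B * deriv α x =
      (deriv Real.smoothTransition A * (m + 1) * α x) * Real.smoothTransition B +
      Real.smoothTransition A * (deriv Real.smoothTransition B * (-(m + 1)) * α x) +
      Real.smoothTransition A * Real.smoothTransition B * deriv α x by ring]
  refine (abs_add_three _ _ _).trans (add_le_add_three ?_ ?_ ?_)
  · rw [abs_mul]; exact (mul_le_of_le_one_right (abs_nonneg _) s2).trans t1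
  · rw [abs_mul]; exact (mul_le_of_le_one_left (abs_nonneg _) s1).trans t2
  · rw [abs_mul, abs_mul]
    calc _ ≤ 1 * 1 * L := by gcongr
      _ = L := by ring

/-! ### Weak derivatives tested with tensor products -/

lemma tsupport_tens {d : ℕ} {α : Fin d → ℝ → ℝ} (h : ∀ l, tsupport (α l) ⊆ Set.Ioo 0 1) :
    HasCompactSupport (tens α) ∧ tsupport (tens α) ⊆ cube d := by
  have hsub : tsupport (tens α) ⊆ Set.univ.pi fun l => tsupport (α l) := by
    refine closure_minimal ?_ (isClosed_set_pi fun l _ => isClosed_tsupport _)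
    intro x hx l _
    refine subset_tsupport _ ?_
    rw [Function.mem_support] at hx ⊢
    intro h0
    exact hx (Finset.prod_eq_zero (Finset.mem_univ l) h0)
  have hc : ∀ l, IsCompact (tsupport (α l)) := fun l =>
    isCompact_Icc.of_isClosed_subset (isClosed_tsupport _) ((h l).trans Set.Ioo_subset_Icc_self)
  exact ⟨(isCompact_univ_pi hc).of_isClosed_subset (isClosed_tsupport _) hsub,
    hsub.trans (Set.pi_mono fun l _ => h l)⟩

lemma tsupport_cutoff_mul (m : ℕ) (α : ℝ → ℝ) :
    tsupport (fun y => cutoff m y * α y) ⊆ Set.Ioo 0 1 :=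
  (tsupport_mul_subset_left (f := cutoff m) (g := α)).trans (tsupport_cutoff m)

lemma contDiff_cutoff_mul (m : ℕ) {α : ℝ → ℝ} (hα : ContDiff ℝ ((⊤ : ℕ∞) : WithTop ℕ∞) α) :
    ContDiff ℝ ((⊤ : ℕ∞) : WithTop ℕ∞) (fun y => cutoff m y * α y) := (contDiff_cutoff m).mul hα

lemma contDiff_deriv {α : ℝ → ℝ} (hα : ContDiff ℝ ((⊤ : ℕ∞) : WithTop ℕ∞) α) :
    ContDiff ℝ ((⊤ : ℕ∞) : WithTop ℕ∞) (deriv α) := (contDiff_infty_iff_deriv.1 hα).2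

lemma differentiable_of_contDiff {α : ℝ → ℝ} (hα : ContDiff ℝ ((⊤ : ℕ∞) : WithTop ℕ∞) α) :
    Differentiable ℝ α := (contDiff_infty_iff_deriv.1 hα).1

lemma exists_bound_cutoff_mul {α : ℝ → ℝ} (hα : Continuous α) :
    ∃ C, ∀ m, ∀ x ∈ Set.Ioo (0 : ℝ) 1, |cutoff m x * α x| ≤ C := by
  obtain ⟨L, hL⟩ := (isCompact_Icc (a := (0 : ℝ)) (b := 1)).exists_bound_of_continuousOn
    hα.continuousOn
  refine ⟨L, fun m x hx => ?_⟩
  have := hL x ⟨hx.1.le, hx.2.le⟩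
  rw [Real.norm_eq_abs] at this
  rw [abs_mul]
  nlinarith [abs_cutoff_le m x, abs_nonneg (α x)]

lemma tendsto_cutoff_mul (α : ℝ → ℝ) {x : ℝ} (hx : x ∈ Set.Ioo (0 : ℝ) 1) :
    Filter.Tendsto (fun m => cutoff m x * α x) Filter.atTop (nhds (α x)) := by
  refine tendsto_const_nhds.congr' ?_
  filter_upwards [cutoff_eventually_eq hx] with m hm
  rw [hm.self_of_nhds, one_mul]

lemma tendsto_deriv_cutoff_mul (α : ℝ → ℝ) {x : ℝ} (hx : x ∈ Set.Ioo (0 : ℝ) 1) :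
    Filter.Tendsto (fun m => deriv (fun y => cutoff m y * α y) x) Filter.atTop
      (nhds (deriv α x)) := by
  refine tendsto_const_nhds.congr' ?_
  filter_upwards [cutoff_eventually_eq hx] with m hm
  refine Filter.EventuallyEq.deriv_eq ?_
  filter_upwards [hm] with y hy
  rw [hy, one_mul]

lemma HasWeakDerivZeroTrace.pr_deriv {d : ℕ} {i : Fin d} {v g : L2 d}
    (h : HasWeakDerivZeroTrace i v g) {α : Fin d → ℝ → ℝ}
    (hα : ∀ l, ContDiff ℝ ((⊤ : ℕ∞) : WithTop ℕ∞) (α l)) :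
    pr v (Function.update α i (deriv (α i))) = - pr g α := by
  have := h (tens α) (contDiff_tens hα)
  rwa [pd_tens fun l => differentiable_of_contDiff (hα l)] at this

/-- A weak derivative in direction `i` may be tested with products that vanish only at the two faces
in that direction, without compact support: cut off in all variables and pass to the limit by
dominated convergence. This admits sines in direction `i` and anything smooth in the others. -/
lemma HasWeakDeriv.pr_deriv {d : ℕ} {i : Fin d} {v g : L2 d}
    (h : HasWeakDeriv [i] v g) {α : Fin d → ℝ → ℝ}
    (hα : ∀ l, ContDiff ℝ ((⊤ : ℕ∞) : WithTop ℕ∞) (α l)) (h0 : α i 0 = 0) (h1 : α i 1 = 0) :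
    pr v (Function.update α i (deriv (α i))) = - pr g α := by
  set β : ℕ → Fin d → ℝ → ℝ := fun m l y => cutoff m y * α l y with hβ
  have hβs : ∀ m l, ContDiff ℝ ((⊤ : ℕ∞) : WithTop ℕ∞) (β m l) := fun m l =>
    contDiff_cutoff_mul m (hα l)
  have key : ∀ m, pr v (Function.update (β m) i (deriv (β m i))) = - pr g (β m) := by
    intro m
    have hs := tsupport_tens (α := β m) fun l => tsupport_cutoff_mul m (α l)
    have := h (tens (β m)) (contDiff_tens (hβs m)) hs.1 hs.2
    change ∫ x in cube d, v x * pd i (tens (β m)) x = _ at this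
    rw [pd_tens fun l => differentiable_of_contDiff (hβs m l)] at this
    simpa [pr] using this
  choose C hC using fun l => exists_bound_cutoff_mul (hα l).continuous
  obtain ⟨C', hC'⟩ := exists_bound_deriv_cutoff_mul (hα i) h0 h1
  have t1 : Filter.Tendsto (fun m => pr g (β m)) Filter.atTop (nhds (pr g α)) :=
    tendsto_pr g (C := C) (fun m l => (hβs m l).continuous) (fun m l x hx => hC l m x hx)
      fun l x hx => tendsto_cutoff_mul _ hx
  have t2 : Filter.Tendsto (fun m => pr v (Function.update (β m) i (deriv (β m i)))) Filter.atTop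
      (nhds (pr v (Function.update α i (deriv (α i))))) := by
    refine tendsto_pr v (C := Function.update C i C') ?_ ?_ ?_
    · intro m l
      by_cases hl : l = i
      · subst hl; simpa using (contDiff_deriv (hβs m l)).continuous
      · simpa [Function.update_of_ne hl] using (hβs m l).continuous
    · intro m l x hx
      by_cases hl : l = i
      · subst hl; simpa using hC' m x hx
      · simpa [Function.update_of_ne hl, hβ] using hC l m x hx
    · intro l x hx
      by_cases hl : l = i
      · subst hl; simpa using tendsto_deriv_cutoff_mul _ hx
      · simpa [Function.update_of_ne hl] using tendsto_cutoff_mul _ hx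
  simp_rw [key] at t2
  exact tendsto_nhds_unique t2 t1.neg

lemma HasWeakDeriv.pr_deriv_deriv {d : ℕ} {i : Fin d} {v g : L2 d}
    (h : HasWeakDeriv [i, i] v g) {α : Fin d → ℝ → ℝ}
    (hα : ∀ l, ContDiff ℝ ((⊤ : ℕ∞) : WithTop ℕ∞) (α l)) (hs : tsupport (α i) ⊆ Set.Ioo 0 1) :
    pr v (Function.update α i (deriv (deriv (α i)))) = pr g α := by
  -- Only the other directions are cut off. The factor in direction `i` has compact support already,
  -- and two derivatives of a cutoff there would not stay bounded.
  set β : ℕ → Fin d → ℝ → ℝ := fun m =>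
    Function.update (fun l y => cutoff m y * α l y) i (α i) with hβ
  have hβi : ∀ m, β m i = α i := fun m => Function.update_self _ _ _
  have hβl : ∀ m l, l ≠ i → β m l = fun y => cutoff m y * α l y := fun m l hl =>
    Function.update_of_ne hl _ _
  have hβs : ∀ m l, ContDiff ℝ ((⊤ : ℕ∞) : WithTop ℕ∞) (β m l) := by
    intro m l
    by_cases hl : l = i
    · subst hl; rw [hβi]; exact hα l
    · rw [hβl m l hl]; exact contDiff_cutoff_mul m (hα l)
  have key : ∀ m, pr v (Function.update (β m) i (deriv (deriv (α i)))) = pr g (β m) := by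
    intro m
    have hsm : ∀ l, tsupport (β m l) ⊆ Set.Ioo 0 1 := by
      intro l
      by_cases hl : l = i
      · subst hl; rw [hβi]; exact hs
      · rw [hβl m l hl]; exact tsupport_cutoff_mul m _
    have hs := tsupport_tens hsm
    have := h (tens (β m)) (contDiff_tens (hβs m)) hs.1 hs.2
    change ∫ x in cube d, v x * pd i (pd i (tens (β m))) x = _ at this
    rw [pd_tens fun l => differentiable_of_contDiff (hβs m l), pd_tens] at this
    · simpa [pr, hβi] using this
    · intro l
      by_cases hl : l = i
      · subst hl
        simpa using differentiable_of_contDiff (contDiff_deriv (hβs m l))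
      · simpa [Function.update_of_ne hl] using differentiable_of_contDiff (hβs m l)
  choose C hC using fun l => exists_bound_cutoff_mul (hα l).continuous
  have hcpt : ∀ γ : ℝ → ℝ, Continuous γ → ∃ C, ∀ x ∈ Set.Ioo (0 : ℝ) 1, |γ x| ≤ C := by
    intro γ hγ
    obtain ⟨L, hL⟩ := (isCompact_Icc (a := (0 : ℝ)) (b := 1)).exists_bound_of_continuousOn
      hγ.continuousOn
    exact ⟨L, fun x hx => hL x ⟨hx.1.le, hx.2.le⟩⟩
  have tgen : ∀ (w : L2 d) (γ : ℝ → ℝ), Continuous γ →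
      Filter.Tendsto (fun m => pr w (Function.update (β m) i γ)) Filter.atTop
        (nhds (pr w (Function.update α i γ))) := by
    intro w γ hγ
    obtain ⟨C', hC'⟩ := hcpt γ hγ
    refine tendsto_pr w (C := Function.update C i C') ?_ ?_ ?_
    · intro m l
      by_cases hl : l = i
      · subst hl; simpa using hγ
      · simpa [Function.update_of_ne hl] using (hβs m l).continuous
    · intro m l x hx
      by_cases hl : l = i
      · subst hl; simpa using hC' x hx
      · simpa [Function.update_of_ne hl, hβl m l hl] using hC l m x hx
    · intro l x hx
      by_cases hl : l = i
      · subst hl; simp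
      · simpa [Function.update_of_ne hl, hβl _ l hl] using tendsto_cutoff_mul _ hx
  have t2 := tgen v _ (contDiff_deriv (contDiff_deriv (hα i))).continuous
  have t1 := tgen g _ (hα i).continuous
  have e : ∀ m, Function.update (β m) i (α i) = β m := fun m => by
    rw [← hβi m, Function.update_eq_self]
  simp_rw [e, Function.update_eq_self] at t1
  simp_rw [key] at t2
  exact tendsto_nhds_unique t2 t1

/-- No derivative falls on the factor in direction `i`, so its cutoff can be removed without any
boundary condition. -/
lemma pr_eq_of_compact_support {d : ℕ} {i : Fin d} {v w : L2 d} {c : ℝ} {α : Fin d → ℝ → ℝ}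
    (hα : ∀ l, ContDiff ℝ ((⊤ : ℕ∞) : WithTop ℕ∞) (α l))
    (h : ∀ β : ℝ → ℝ, ContDiff ℝ ((⊤ : ℕ∞) : WithTop ℕ∞) β → tsupport β ⊆ Set.Ioo 0 1 →
      pr v (Function.update α i β) = c * pr w (Function.update α i β)) :
    pr v α = c * pr w α := by
  have key : ∀ m, pr v (Function.update α i fun y => cutoff m y * α i y) =
      c * pr w (Function.update α i fun y => cutoff m y * α i y) := fun m =>
    h _ (contDiff_cutoff_mul m (hα i)) (tsupport_cutoff_mul m _)
  have hcpt : ∀ l, ∃ C, ∀ x ∈ Set.Ioo (0 : ℝ) 1, |α l x| ≤ C := by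
    intro l
    obtain ⟨L, hL⟩ := (isCompact_Icc (a := (0 : ℝ)) (b := 1)).exists_bound_of_continuousOn
      (hα l).continuous.continuousOn
    exact ⟨L, fun x hx => hL x ⟨hx.1.le, hx.2.le⟩⟩
  choose C hC using hcpt
  obtain ⟨C', hC'⟩ := exists_bound_cutoff_mul (hα i).continuous
  have tgen : ∀ u : L2 d, Filter.Tendsto
      (fun m => pr u (Function.update α i fun y => cutoff m y * α i y)) Filter.atTop
        (nhds (pr u α)) := by
    intro u
    refine tendsto_pr u (C := Function.update C i C') ?_ ?_ ?_
    · intro m l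
      by_cases hl : l = i
      · subst hl; simpa using (contDiff_cutoff_mul m (hα l)).continuous
      · simpa [Function.update_of_ne hl] using (hα l).continuous
    · intro m l x hx
      by_cases hl : l = i
      · subst hl; simpa using hC' m x hx
      · simpa [Function.update_of_ne hl] using hC l x hx
    · intro l x hx
      by_cases hl : l = i
      · subst hl; simpa using tendsto_cutoff_mul _ hx
      · simp [Function.update_of_ne hl]
  have t1 := tgen v
  simp_rw [key] at t1
  exact tendsto_nhds_unique t1 ((tgen w).const_mul c)

/-! ### Linearity of weak derivatives -/

lemma hasWeakDeriv_iff {d : ℕ} {l : List (Fin d)} {v g : L2 d} : HasWeakDeriv l v g ↔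
    ∀ ψ : (Fin d → ℝ) → ℝ, IsSmooth ψ → HasCompactSupport ψ → tsupport ψ ⊆ cube d →
      inner ℝ v (toL (pdList l ψ)) = (-1 : ℝ) ^ l.length * inner ℝ g (toL ψ) := by
  unfold HasWeakDeriv
  refine forall_congr' fun ψ => forall_congr' fun hψ => forall_congr' fun _ =>
    forall_congr' fun _ => ?_
  rw [inner_toL _ (hψ.pdList l).continuous, inner_toL _ hψ.continuous]

lemma hasWeakDerivZeroTrace_iff {d : ℕ} {i : Fin d} {v g : L2 d} : HasWeakDerivZeroTrace i v g ↔
    ∀ ψ : (Fin d → ℝ) → ℝ, IsSmooth ψ →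
      inner ℝ v (toL (pd i ψ)) = - inner ℝ g (toL ψ) := by
  unfold HasWeakDerivZeroTrace
  refine forall_congr' fun ψ => forall_congr' fun hψ => ?_
  rw [inner_toL _ (hψ.pd i).continuous, inner_toL _ hψ.continuous]

lemma HasWeakDeriv.add {d : ℕ} {l : List (Fin d)} {v g v' g' : L2 d} (h : HasWeakDeriv l v g)
    (h' : HasWeakDeriv l v' g') : HasWeakDeriv l (v + v') (g + g') := by
  rw [hasWeakDeriv_iff] at *
  intro ψ h1 h2 h3
  rw [inner_add_left, inner_add_left, h ψ h1 h2 h3, h' ψ h1 h2 h3]; ring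

lemma HasWeakDeriv.smul {d : ℕ} {l : List (Fin d)} {v g : L2 d} (h : HasWeakDeriv l v g)
    (c : ℝ) : HasWeakDeriv l (c • v) (c • g) := by
  rw [hasWeakDeriv_iff] at *
  intro ψ h1 h2 h3
  rw [real_inner_smul_left, real_inner_smul_left, h ψ h1 h2 h3]; ring

lemma HasWeakDeriv.neg {d : ℕ} {l : List (Fin d)} {v g : L2 d} (h : HasWeakDeriv l v g) :
    HasWeakDeriv l (-v) (-g) := by
  simpa using h.smul (-1)

lemma HasWeakDeriv.sub {d : ℕ} {l : List (Fin d)} {v g v' g' : L2 d} (h : HasWeakDeriv l v g)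
    (h' : HasWeakDeriv l v' g') : HasWeakDeriv l (v - v') (g - g') := by
  simpa [sub_eq_add_neg] using h.add h'.neg

lemma HasWeakDerivZeroTrace.hasWeakDeriv {d : ℕ} {i : Fin d} {v g : L2 d}
    (h : HasWeakDerivZeroTrace i v g) : HasWeakDeriv [i] v g := by
  intro ψ h1 _ _
  simpa [pdList] using h ψ h1

lemma HasWeakDeriv.of_cons {d : ℕ} {i : Fin d} {l : List (Fin d)} {v w g : L2 d}
    (h : HasWeakDeriv l v w) (h' : HasWeakDeriv (i :: l) v g) : HasWeakDeriv [i] w g := by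
  intro ψ h1 h2 h3
  have e1 := h (pd i ψ) (h1.pd i) (hasCompactSupport_pd h2 i) ((tsupport_pd ψ i).trans h3)
  have e2 := h' ψ h1 h2 h3
  rw [pdList_pd h1] at e1
  change ∫ x in cube d, v x * pd i (pdList l ψ) x = _ at e2
  rw [e1] at e2
  change ∫ x in cube d, w x * pd i ψ x = _
  have hp : ((-1 : ℝ) ^ l.length) ≠ 0 := pow_ne_zero _ (by norm_num)
  refine mul_left_cancel₀ hp (e2.trans ?_)
  simp [pow_succ]

lemma HasWeakDeriv.of_cons_cons {d : ℕ} {i : Fin d} {l : List (Fin d)} {v w g : L2 d}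
    (h : HasWeakDeriv (l ++ l) v w) (h' : HasWeakDeriv ((i :: l) ++ (i :: l)) v g) :
    HasWeakDeriv [i, i] w g := by
  intro ψ h1 h2 h3
  have e1 := h (pd i (pd i ψ)) ((h1.pd i).pd i) (hasCompactSupport_pd (hasCompactSupport_pd h2 i) i)
    (((tsupport_pd _ i).trans (tsupport_pd ψ i)).trans h3)
  have e2 := h' ψ h1 h2 h3
  have e3 : pdList ((i :: l) ++ (i :: l)) ψ = pdList (l ++ l) (pd i (pd i ψ)) := by
    rw [pdList_append, pdList_append]
    change pd i (pdList l (pd i (pdList l ψ))) = _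
    rw [pdList_pd (h1.pdList l),
      pdList_pd (h1.pd i), pdList_pd h1, pdList_pd ((h1.pdList l).pd i), pdList_pd (h1.pdList l)]
  rw [e3, e1] at e2
  change ∫ x in cube d, w x * pd i (pd i ψ) x = _
  have hlen : ((-1 : ℝ) ^ (l ++ l).length) = 1 := by
    rw [List.length_append]; exact Even.neg_one_pow ⟨_, rfl⟩
  have hlen' : ((-1 : ℝ) ^ ((i :: l) ++ (i :: l)).length) = 1 := by
    rw [List.length_append]; exact Even.neg_one_pow ⟨_, rfl⟩
  rw [hlen, hlen'] at e2
  simpa using e2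

lemma HasWeakDerivZeroTrace.dirichlet {d : ℕ} {i : Fin d} {v v' g : L2 d}
    (h : HasWeakDerivZeroTrace i v v') (h' : HasWeakDeriv [i, i] v g) : HasDirichletDeriv2 i v g :=
  ⟨v', h, h.hasWeakDeriv.of_cons h'⟩

/-! ### Derivatives and trigonometric coefficients -/

lemma coef_eq_pr {d : ℕ} (σ : Fin d → Bool) (v : L2 d) (n : Fin d → ℕ) :
    coef σ v n = pr v fun l => trig (σ l) (n l) := coef_eq_integral σ v n

lemma coef_update {d : ℕ} (σ : Fin d → Bool) (i : Fin d) (b : Bool) (v : L2 d) (n : Fin d → ℕ) :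
    coef (Function.update σ i b) v n =
      pr v (Function.update (fun l => trig (σ l) (n l)) i (trig b (n i))) := by
  rw [coef_eq_pr]
  congr 1
  funext l
  by_cases h : l = i
  · subst h; simp
  · simp [Function.update_of_ne h]

lemma contDiff_update {d : ℕ} {α : Fin d → ℝ → ℝ}
    (hα : ∀ l, ContDiff ℝ ((⊤ : ℕ∞) : WithTop ℕ∞) (α l)) (i : Fin d) {β : ℝ → ℝ}
    (hβ : ContDiff ℝ ((⊤ : ℕ∞) : WithTop ℕ∞) β) (l : Fin d) :
    ContDiff ℝ ((⊤ : ℕ∞) : WithTop ℕ∞) (Function.update α i β l) := by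
  by_cases h : l = i
  · subst h; simpa using hβ
  · simpa [Function.update_of_ne h] using hα l

lemma HasWeakDerivZeroTrace.pr_trig {d : ℕ} {i : Fin d} {v g : L2 d}
    (h : HasWeakDerivZeroTrace i v g) {α : Fin d → ℝ → ℝ}
    (hα : ∀ l, ContDiff ℝ ((⊤ : ℕ∞) : WithTop ℕ∞) (α l)) (k : ℕ) :
    pr g (Function.update α i (trig false k)) =
      Real.pi * k * pr v (Function.update α i (trig true k)) := by
  have := h.pr_deriv (contDiff_update hα i (contDiff_trig false k))
  rw [Function.update_self, Function.update_idem, deriv_trig_false, pr_update_const_mul] at this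
  linarith

lemma HasWeakDeriv.pr_trig {d : ℕ} {i : Fin d} {v g : L2 d}
    (h : HasWeakDeriv [i] v g) {α : Fin d → ℝ → ℝ}
    (hα : ∀ l, ContDiff ℝ ((⊤ : ℕ∞) : WithTop ℕ∞) (α l)) (k : ℕ) :
    pr g (Function.update α i (trig true k)) =
      - (Real.pi * k) * pr v (Function.update α i (trig false k)) := by
  have := h.pr_deriv (contDiff_update hα i (contDiff_trig true k)) (by simp [trig])
    (by simp [trig, mul_comm Real.pi, Real.sin_nat_mul_pi])
  rw [Function.update_self, Function.update_idem, deriv_trig_true, pr_update_const_mul] at this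
  linarith

lemma HasDirichletDeriv2.pr_trig {d : ℕ} {i : Fin d} {v g : L2 d}
    (h : HasDirichletDeriv2 i v g) {α : Fin d → ℝ → ℝ}
    (hα : ∀ l, ContDiff ℝ ((⊤ : ℕ∞) : WithTop ℕ∞) (α l)) (k : ℕ) :
    pr g (Function.update α i (trig true k)) =
      - (Real.pi * k) ^ 2 * pr v (Function.update α i (trig true k)) := by
  obtain ⟨v', h1, h2⟩ := h
  rw [h2.pr_trig hα, h1.pr_trig hα]; ring

/-- The derivative exchanges sine and cosine. Zero trace is what allows the cosine as a test
function, since it does not vanish at the faces. -/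
lemma HasWeakDerivZeroTrace.coef_eq {d : ℕ} {i : Fin d} {v g : L2 d}
    (h : HasWeakDerivZeroTrace i v g) (σ : Fin d → Bool) (n : Fin d → ℕ) :
    coef (Function.update σ i false) g n =
      Real.pi * n i * coef (Function.update σ i true) v n := by
  rw [coef_update, coef_update, h.pr_trig fun l => contDiff_trig _ _]

/-- Here the test function is a sine, which vanishes at both faces, so no trace condition on `v` is
needed. -/
lemma HasWeakDeriv.coef_eq {d : ℕ} {i : Fin d} {v g : L2 d}
    (h : HasWeakDeriv [i] v g) (σ : Fin d → Bool) (n : Fin d → ℕ) :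
    coef (Function.update σ i true) g n =
      - (Real.pi * n i) * coef (Function.update σ i false) v n := by
  rw [coef_update, coef_update, h.pr_trig fun l => contDiff_trig _ _]

lemma HasDirichletDeriv2.coef_eq {d : ℕ} {i : Fin d} {v g : L2 d}
    (h : HasDirichletDeriv2 i v g) {σ : Fin d → Bool} (hσ : σ i = true) (n : Fin d → ℕ) :
    coef σ g n = - (Real.pi * n i) ^ 2 * coef σ v n := by
  obtain ⟨v', h1, h2⟩ := h
  have e : Function.update σ i true = σ := by rw [← hσ, Function.update_eq_self]
  have e1 := h1.coef_eq σ n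
  have e2 := h2.coef_eq σ n
  rw [e] at e1 e2
  rw [e2, e1]; ring

lemma HasNeumannDeriv2.coef_eq {d : ℕ} {i : Fin d} {v g : L2 d}
    (h : HasNeumannDeriv2 i v g) {σ : Fin d → Bool} (hσ : σ i = false) (n : Fin d → ℕ) :
    coef σ g n = - (Real.pi * n i) ^ 2 * coef σ v n := by
  obtain ⟨v', h1, h2⟩ := h
  have e : Function.update σ i false = σ := by rw [← hσ, Function.update_eq_self]
  have e1 := h1.coef_eq σ n
  have e2 := h2.coef_eq σ n
  rw [e] at e1 e2
  rw [e2, e1]; ring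

lemma HasHelmholtz.coef_eq {d : ℕ} {i : Fin d} {v g : L2 d}
    (h : HasHelmholtz i v g) {σ : Fin d → Bool} (hσ : σ i = false) (n : Fin d → ℕ) :
    coef σ g n = (1 + (Real.pi * n i) ^ 2) * coef σ v n := by
  obtain ⟨w, h1, rfl⟩ := h
  rw [coef_sub, h1.coef_eq hσ]; ring

/-- Classical derivatives are weak derivatives. -/
lemma hasWeakDeriv_toL {d : ℕ} {ψ : (Fin d → ℝ) → ℝ} (hψ : IsSmooth ψ) (i : Fin d) :
    HasWeakDeriv [i] (toL ψ) (toL (pd i ψ)) := by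
  intro χ h1 h2 h3
  have hz : ∀ {F : (Fin d → ℝ) → ℝ} {x}, x ∉ cube d → F x * χ x = 0 := by
    intro F x hx
    have : χ x = 0 := image_eq_zero_of_notMem_tsupport fun h => hx (h3 h)
    simp [this]
  have hz' : ∀ {F : (Fin d → ℝ) → ℝ} {x}, x ∉ cube d → F x * pd i χ x = 0 := by
    intro F x hx
    have : pd i χ x = 0 :=
      image_eq_zero_of_notMem_tsupport fun h => hx (h3 (tsupport_pd χ i h))
    simp [this]
  have e1 : ∫ x in cube d, (toL ψ : L2 d) x * pd i χ x = ∫ x, ψ x * pd i χ x := by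
    rw [← setIntegral_eq_integral_of_forall_compl_eq_zero (s := cube d)
      (f := fun x => ψ x * pd i χ x) fun x hx => hz' hx]
    refine integral_congr_ae ?_
    filter_upwards [coeFn_toL hψ.continuous] with x hx
    rw [hx]
  have e2 : ∫ x in cube d, (toL (pd i ψ) : L2 d) x * χ x = ∫ x, pd i ψ x * χ x := by
    rw [← setIntegral_eq_integral_of_forall_compl_eq_zero (s := cube d)
      (f := fun x => pd i ψ x * χ x) fun x hx => hz hx]
    refine integral_congr_ae ?_
    filter_upwards [coeFn_toL (hψ.pd i).continuous] with x hx
    rw [hx]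
  change ∫ x in cube d, (toL ψ : L2 d) x * pd i χ x = _
  rw [e1, e2]
  have dψ : Differentiable ℝ ψ := ContDiff.differentiable hψ (by simp)
  have dχ : Differentiable ℝ χ := ContDiff.differentiable h1 (by simp)
  have hI : ∀ {F G : (Fin d → ℝ) → ℝ}, Continuous F → Continuous G → HasCompactSupport G →
      Integrable fun x => F x * G x := fun hF hG hc =>
    (hF.mul hG).integrable_of_hasCompactSupport hc.mul_left
  have := integral_mul_fderiv_eq_neg_fderiv_mul_of_integrable (μ := volume)
    (f := ψ) (g := χ) (v := Pi.single i 1)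
    (hI (hψ.pd i).continuous h1.continuous h2)
    (hI hψ.continuous (h1.pd i).continuous (hasCompactSupport_pd h2 i))
    (hI hψ.continuous h1.continuous h2) (fun x _ => dψ x) (fun x _ => dχ x)
  simpa [pd] using this

lemma Good.update_false {d : ℕ} {σ : Fin d → Bool} {n : Fin d → ℕ} (h : Good σ n) (i : Fin d) :
    Good (Function.update σ i false) n := by
  intro l hl
  by_cases hli : l = i
  · subst hli; simp at hl
  · rw [Function.update_of_ne hli] at hl; exact h l hl

/-- A function whose sine series in direction `i` can be differentiated in `L²` has a derivative
with zero trace. -/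
lemma exists_zeroTrace_deriv {d : ℕ} {i : Fin d} {σ : Fin d → Bool} (hσ : σ i = true) {v : L2 d}
    (h : Summable fun n => (Real.pi * n i * coef σ v n) ^ 2) :
    ∃ g, HasWeakDerivZeroTrace i v g := by
  have e : Function.update σ i true = σ := by rw [← hσ, Function.update_eq_self]
  obtain ⟨g, hg⟩ := exists_of_coef (Function.update σ i false) _ h (by
    intro n hn
    by_cases hg : Good σ n
    · exact absurd (hg.update_false i) hn
    · rw [coef_eq_zero hg, mul_zero])
  -- Green's formula is the equality of two Parseval sums, with sines in direction `i` on the left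
  -- and cosines on the right. The coefficients of `pd i ψ` follow from those of `ψ` without a
  -- condition on `ψ`.
  refine ⟨g, hasWeakDerivZeroTrace_iff.2 fun ψ hψ => ?_⟩
  have h1 := parseval σ v (toL (pd i ψ))
  have h2 := (parseval (Function.update σ i false) g (toL ψ)).neg
  refine h1.unique (h2.congr_fun fun n => ?_)
  have := (hasWeakDeriv_toL hψ i).coef_eq σ n
  rw [e] at this
  rw [this, hg]; ring

/-! ### Sine and cosine coefficients -/

/-- The coefficients in the sine system. -/
def sc {d : ℕ} (v : L2 d) (n : Fin d → ℕ) : ℝ := coef (fun _ => true) v n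

/-- The coefficients in the cosine system. -/
def cc {d : ℕ} (v : L2 d) (n : Fin d → ℕ) : ℝ := coef (fun _ => false) v n

/-- The eigenvalues of `-∂ᵢᵢ`. -/
def lam {d : ℕ} (n : Fin d → ℕ) (i : Fin d) : ℝ := (Real.pi * n i) ^ 2

/-- The eigenvalues of `-Δ`. -/
def Lam {d : ℕ} (n : Fin d → ℕ) : ℝ := ∑ i, lam n i

/-- The eigenvalues of `∏ᵢ (1 - a ∂ᵢᵢ)`. -/
def wt {d : ℕ} (a : ℝ) (n : Fin d → ℕ) : ℝ := ∏ i, (1 + a * lam n i)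

lemma lam_nonneg {d : ℕ} (n : Fin d → ℕ) (i : Fin d) : 0 ≤ lam n i := sq_nonneg _

lemma Lam_nonneg {d : ℕ} (n : Fin d → ℕ) : 0 ≤ Lam n := Finset.sum_nonneg fun i _ => lam_nonneg n i

lemma one_add_sum_le_prod {ι : Type*} (s : Finset ι) (f : ι → ℝ) (hf : ∀ i, 0 ≤ f i) :
    1 + ∑ i ∈ s, f i ≤ ∏ i ∈ s, (1 + f i) := by
  classical
  induction s using Finset.induction_on with
  | empty => simp
  | insert i s hi ih =>
    rw [Finset.sum_insert hi, Finset.prod_insert hi]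
    have : 0 ≤ ∑ i ∈ s, f i := Finset.sum_nonneg fun i _ => hf i
    nlinarith [hf i, mul_nonneg (hf i) this]

/-- The mixed terms of the product are nonnegative, so splitting only adds to 1 - a Δ. With a = τ/2
this is the stability of the velocity step; with a = 1 it bounds the divergence in the dual norm of
A. -/
lemma one_add_Lam_le_wt {d : ℕ} {a : ℝ} (ha : 0 ≤ a) (n : Fin d → ℕ) : 1 + a * Lam n ≤ wt a n := by
  rw [Lam, Finset.mul_sum]
  exact one_add_sum_le_prod _ _ fun i => mul_nonneg ha (lam_nonneg n i)

lemma one_le_wt {d : ℕ} {a : ℝ} (ha : 0 ≤ a) (n : Fin d → ℕ) : 1 ≤ wt a n := by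
  have := one_add_Lam_le_wt ha n
  have := mul_nonneg ha (Lam_nonneg n)
  linarith

/-- The domain of the splitting operator does not depend on τ, so `Reg` can be defined with a = 1.
The constant does depend on τ and is used only for membership, never in an estimate. -/
lemma wt_le_mul_wt {d : ℕ} {a b : ℝ} (ha : 0 < a) (hb : 0 < b) :
    ∃ C, 0 ≤ C ∧ ∀ n : Fin d → ℕ, wt a n ≤ C * wt b n := by
  refine ⟨∏ _i : Fin d, (1 + a / b), Finset.prod_nonneg fun _ _ => by positivity, fun n => ?_⟩
  rw [wt, wt, ← Finset.prod_mul_distrib]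
  refine Finset.prod_le_prod (fun i _ => ?_) fun i _ => ?_
  · have := mul_nonneg ha.le (lam_nonneg n i); linarith
  · have := lam_nonneg n i
    have e : (1 + a / b) * (1 + b * lam n i) = 1 + a / b + b * lam n i + a * lam n i := by
      field_simp
      ring
    rw [e]
    have : 0 ≤ a / b := by positivity
    nlinarith [mul_nonneg hb.le (lam_nonneg n i)]

lemma lam_le_Lam {d : ℕ} (n : Fin d → ℕ) (i : Fin d) : lam n i ≤ Lam n :=
  Finset.single_le_sum (fun j _ => lam_nonneg n j) (Finset.mem_univ i)

lemma Lam_le_wt {d : ℕ} (n : Fin d → ℕ) : Lam n ≤ wt 1 n := by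
  have := one_add_Lam_le_wt zero_le_one n; linarith

lemma freq_le_wt {d : ℕ} (n : Fin d → ℕ) (i : Fin d) : |Real.pi * n i| ≤ wt 1 n := by
  have h1 := one_add_Lam_le_wt zero_le_one n
  have h2 := lam_le_Lam n i
  unfold lam at h2
  nlinarith [abs_nonneg (Real.pi * n i), sq_abs (Real.pi * n i), sq_nonneg (|Real.pi * n i| - 1)]

lemma wt_eq_sum {d : ℕ} (a : ℝ) (n : Fin d → ℕ) :
    wt a n = ∑ S : Finset (Fin d), a ^ S.card * ∏ i ∈ S, lam n i := by
  rw [wt, Finset.prod_one_add, Finset.powerset_univ]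
  refine Finset.sum_congr rfl fun S _ => ?_
  rw [Finset.prod_mul_distrib, Finset.prod_const]

section
variable {d : ℕ}

lemma sc_add (v w : L2 d) (n : Fin d → ℕ) : sc (v + w) n = sc v n + sc w n := coef_add _ _ _ _
lemma sc_sub (v w : L2 d) (n : Fin d → ℕ) : sc (v - w) n = sc v n - sc w n := coef_sub _ _ _ _
lemma sc_neg (v : L2 d) (n : Fin d → ℕ) : sc (-v) n = - sc v n := coef_neg _ _ _
lemma sc_smul (a : ℝ) (v : L2 d) (n : Fin d → ℕ) : sc (a • v) n = a * sc v n := coef_smul _ _ _ _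
lemma sc_zero (n : Fin d → ℕ) : sc (0 : L2 d) n = 0 := coef_zero _ _
lemma sc_sum {ι : Type*} (s : Finset ι) (v : ι → L2 d) (n : Fin d → ℕ) :
    sc (∑ i ∈ s, v i) n = ∑ i ∈ s, sc (v i) n := coef_sum _ _ _ _
lemma cc_add (v w : L2 d) (n : Fin d → ℕ) : cc (v + w) n = cc v n + cc w n := coef_add _ _ _ _
lemma cc_sub (v w : L2 d) (n : Fin d → ℕ) : cc (v - w) n = cc v n - cc w n := coef_sub _ _ _ _
lemma cc_smul (a : ℝ) (v : L2 d) (n : Fin d → ℕ) : cc (a • v) n = a * cc v n := coef_smul _ _ _ _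
lemma cc_zero (n : Fin d → ℕ) : cc (0 : L2 d) n = 0 := coef_zero _ _
lemma cc_sum {ι : Type*} (s : Finset ι) (v : ι → L2 d) (n : Fin d → ℕ) :
    cc (∑ i ∈ s, v i) n = ∑ i ∈ s, cc (v i) n := coef_sum _ _ _ _

end

/-! ### Regular functions -/

/-- `v` is in the domain of `∏ᵢ (1 - ∂ᵢᵢ)` with Dirichlet conditions. -/
def Reg {d : ℕ} (v : L2 d) : Prop := Summable fun n => (wt 1 n * sc v n) ^ 2

lemma summable_sq_of_le {ι : Type*} {f g : ι → ℝ} (C : ℝ) (h : ∀ n, |f n| ≤ C * |g n|)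
    (hg : Summable fun n => g n ^ 2) : Summable fun n => f n ^ 2 := by
  refine Summable.of_nonneg_of_le (fun n => sq_nonneg _) (fun n => ?_) (hg.mul_left (C ^ 2))
  rw [← sq_abs, ← sq_abs (g n), ← mul_pow]
  exact pow_le_pow_left₀ (abs_nonneg _) (h n) 2

lemma summable_sq_add {ι : Type*} {f g : ι → ℝ} (hf : Summable fun n => f n ^ 2)
    (hg : Summable fun n => g n ^ 2) : Summable fun n => (f n + g n) ^ 2 := by
  refine Summable.of_nonneg_of_le (fun n => sq_nonneg _) (fun n => ?_)
    ((hf.mul_left 2).add (hg.mul_left 2))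
  nlinarith [sq_nonneg (f n - g n)]

lemma Reg.summable_mul {d : ℕ} {v : L2 d} (h : Reg v) {m : (Fin d → ℕ) → ℝ} {C : ℝ}
    (hm : ∀ n, |m n| ≤ C * wt 1 n) : Summable fun n => (m n * sc v n) ^ 2 := by
  refine summable_sq_of_le C (fun n => ?_) h
  rw [abs_mul, abs_mul, ← mul_assoc,
    abs_of_nonneg (zero_le_one.trans (one_le_wt zero_le_one n))]
  exact mul_le_mul_of_nonneg_right (hm n) (abs_nonneg _)

lemma Reg.add {d : ℕ} {v w : L2 d} (hv : Reg v) (hw : Reg w) : Reg (v + w) := by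
  unfold Reg
  simp_rw [sc_add, mul_add]
  exact summable_sq_add hv hw

lemma Reg.smul {d : ℕ} {v : L2 d} (hv : Reg v) (c : ℝ) : Reg (c • v) := by
  unfold Reg
  simp_rw [sc_smul]
  refine (Summable.mul_left (c ^ 2) hv).congr fun n => ?_
  ring

lemma Reg.sub {d : ℕ} {v w : L2 d} (hv : Reg v) (hw : Reg w) : Reg (v - w) := by
  have := hv.add (hw.smul (-1))
  simpa [sub_eq_add_neg] using this

lemma sc_eq_zero_of_not_good {d : ℕ} {n : Fin d → ℕ} (h : ¬ Good (fun _ => true) n) (v : L2 d) :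
    sc v n = 0 := coef_eq_zero h v

lemma Reg.exists_mul {d : ℕ} {v : L2 d} (h : Reg v) {m : (Fin d → ℕ) → ℝ} {C : ℝ}
    (hm : ∀ n, |m n| ≤ C * wt 1 n) : ∃ z : L2 d, ∀ n, sc z n = m n * sc v n :=
  exists_of_coef _ _ (h.summable_mul hm) fun n hn => by rw [sc_eq_zero_of_not_good hn, mul_zero]

lemma Reg.exists_wt {d : ℕ} {v : L2 d} (h : Reg v) {a : ℝ} (ha : 0 < a) :
    ∃ z : L2 d, ∀ n, sc z n = wt a n * sc v n := by
  obtain ⟨C, _, hC⟩ := wt_le_mul_wt (d := d) ha one_pos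
  exact h.exists_mul (C := C) fun n => by
    rw [abs_of_nonneg (zero_le_one.trans (one_le_wt ha.le n))]; exact hC n

lemma Reg.exists_Lam {d : ℕ} {v : L2 d} (h : Reg v) : ∃ z : L2 d, ∀ n, sc z n = Lam n * sc v n :=
  h.exists_mul (C := 1) fun n => by
    rw [abs_of_nonneg (Lam_nonneg n), one_mul]; exact Lam_le_wt n

lemma Reg.of_wt {d : ℕ} {v z : L2 d} {a : ℝ} (ha : 0 < a) (h : ∀ n, sc z n = wt a n * sc v n) :
    Reg v := by
  obtain ⟨C, hC0, hC⟩ := wt_le_mul_wt (d := d) one_pos ha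
  refine summable_sq_of_le C (fun n => ?_) (parseval_norm (fun _ => true) z).summable
  change _ ≤ C * |sc z n|
  rw [h, abs_mul, abs_mul, abs_of_nonneg (zero_le_one.trans (one_le_wt ha.le n)),
    abs_of_nonneg (zero_le_one.trans (one_le_wt zero_le_one n)), ← mul_assoc]
  exact mul_le_mul_of_nonneg_right (hC n) (abs_nonneg _)

lemma Reg.exists_zeroTrace {d : ℕ} {v : L2 d} (h : Reg v) (i : Fin d) :
    ∃ g, HasWeakDerivZeroTrace i v g :=
  exists_zeroTrace_deriv (σ := fun _ => true) rfl (h.summable_mul (C := 1) fun n => by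
    rw [one_mul]; exact freq_le_wt n i)

lemma Reg.sc_deriv2 {d : ℕ} {v g : L2 d} (h : Reg v) {i : Fin d} (hg : HasWeakDeriv [i, i] v g)
    (n : Fin d → ℕ) : sc g n = - lam n i * sc v n := by
  obtain ⟨v', hv'⟩ := h.exists_zeroTrace i
  exact (hv'.dirichlet hg).coef_eq rfl n

/-- Coefficients of iterated second derivatives of a function that vanishes on the boundary. -/
lemma pr_deriv2_list {d : ℕ} {u : L2 d} (hu : MemH10 u) {w : List (Fin d) → L2 d}
    (hw : ∀ l : List (Fin d), l.Nodup → HasWeakDeriv (l ++ l) u (w l)) (n : Fin d → ℕ)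
    (l : List (Fin d)) (hl : l.Nodup) : ∀ α : Fin d → ℝ → ℝ,
      (∀ i, ContDiff ℝ ((⊤ : ℕ∞) : WithTop ℕ∞) (α i)) → (∀ i ∈ l, α i = trig true (n i)) →
      pr (w l) α = (l.map fun i => - lam n i).prod * pr u α := by
  induction l with
  | nil =>
    intro α _ _
    have : HasWeakDeriv [] u u := fun ψ _ _ _ => by simp [pdList]
    rw [(hw [] List.nodup_nil).unique this]
    simp
  | cons i l ih =>
    intro α hα hs
    have hnd := List.nodup_cons.1 hl
    have h1 := (hw l hnd.2).of_cons_cons (hw (i :: l) hl)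
    have h2 : HasWeakDeriv [i, i] u (w [i]) := hw [i] (List.nodup_singleton i)
    have step : pr (w (i :: l)) α = (l.map fun i => - lam n i).prod * pr (w [i]) α := by
      -- Nothing is known about traces of the higher derivatives `w l`. With a compactly supported
      -- factor in direction `i`, ∂ᵢᵢ moves onto that factor, the induction hypothesis replaces `w
      -- l` by a multiple of `u`, and ∂ᵢᵢ moves back onto `u`.
      refine pr_eq_of_compact_support (i := i) hα fun β hβ hβs => ?_
      have hα' := contDiff_update hα i hβ
      have e1 := h1.pr_deriv_deriv hα' (by simpa using hβs)
      have e2 := h2.pr_deriv_deriv hα' (by simpa using hβs)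
      rw [Function.update_self, Function.update_idem] at e1 e2
      rw [← e1, ← e2]
      refine ih hnd.2 _ (contDiff_update hα i (contDiff_deriv (contDiff_deriv hβ))) ?_
      intro j hj
      rw [Function.update_of_ne (fun h : j = i => hnd.1 (h ▸ hj))]
      exact hs j (List.mem_cons_of_mem _ hj)
    obtain ⟨g, hg⟩ := hu i
    -- Only now does the boundary condition enter, and only that of `u` itself.
    have e := (hg.dirichlet h2).pr_trig hα (n i)
    rw [← hs i List.mem_cons_self, Function.update_eq_self] at e
    rw [step, e, List.map_cons, List.prod_cons, lam]
    ring

lemma sc_deriv2_finset {d : ℕ} {u : L2 d} (hu : MemH10 u) {w : List (Fin d) → L2 d}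
    (hw : ∀ l : List (Fin d), l.Nodup → HasWeakDeriv (l ++ l) u (w l)) (S : Finset (Fin d))
    (n : Fin d → ℕ) : sc (w S.toList) n = (-1) ^ S.card * (∏ i ∈ S, lam n i) * sc u n := by
  have := pr_deriv2_list hu hw n S.toList S.nodup_toList (fun l => trig true (n l))
    (fun i => contDiff_trig _ _) (fun _ _ => rfl)
  rw [sc, coef_eq_pr, this, Finset.prod_map_toList, sc, coef_eq_pr, Finset.prod_neg]

lemma sc_sum_deriv2 {d : ℕ} {u : L2 d} (hu : MemH10 u) {w : List (Fin d) → L2 d}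
    (hw : ∀ l : List (Fin d), l.Nodup → HasWeakDeriv (l ++ l) u (w l)) (a : ℝ)
    (n : Fin d → ℕ) :
    sc (∑ S : Finset (Fin d), (-a) ^ S.card • w S.toList) n = wt a n * sc u n := by
  rw [sc_sum, wt_eq_sum, Finset.sum_mul]
  refine Finset.sum_congr rfl fun S _ => ?_
  rw [sc_smul, sc_deriv2_finset hu hw, ← mul_assoc, ← mul_assoc, ← mul_pow]
  simp

/-! ### The quadratic forms of `-Δ` and of the splitting operator -/

/-- The form `⟨∏ᵢ (1 - a ∂ᵢᵢ) v, v⟩`. -/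
def qB {d : ℕ} (a : ℝ) (v : L2 d) : ℝ := ∑' n, wt a n * sc v n ^ 2

/-- The form `⟨-Δ v, v⟩`. -/
def qL {d : ℕ} (v : L2 d) : ℝ := ∑' n, Lam n * sc v n ^ 2

lemma hasSum_qB {d : ℕ} {a : ℝ} {v z : L2 d} (hz : ∀ n, sc z n = wt a n * sc v n) :
    HasSum (fun n => wt a n * sc v n ^ 2) (qB a v) ∧ qB a v = inner ℝ z v := by
  have : HasSum (fun n => wt a n * sc v n ^ 2) (inner ℝ z v) := by
    refine (parseval (fun _ => true) z v).congr_fun fun n => ?_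
    change _ = sc z n * sc v n
    rw [hz]; ring
  rw [qB, this.tsum_eq]
  exact ⟨this, rfl⟩

lemma hasSum_qL {d : ℕ} {v : L2 d} (h : Reg v) :
    HasSum (fun n => Lam n * sc v n ^ 2) (qL v) := by
  obtain ⟨z, hz⟩ := h.exists_Lam
  have : HasSum (fun n => Lam n * sc v n ^ 2) (inner ℝ z v) := by
    refine (parseval (fun _ => true) z v).congr_fun fun n => ?_
    change _ = sc z n * sc v n
    rw [hz]; ring
  rw [qL, this.tsum_eq]
  exact this

lemma qL_eq_sum {d : ℕ} {v : L2 d} {g : Fin d → L2 d} (hv : Reg v)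
    (hg : ∀ i, HasWeakDerivZeroTrace i v (g i)) : qL v = ∑ i, ‖g i‖ ^ 2 := by
  refine (hasSum_qL hv).unique ?_
  have := hasSum_sum (s := Finset.univ) fun i _ =>
    parseval_norm (Function.update (fun _ => true) i false) (g i)
  refine this.congr_fun fun n => ?_
  rw [Lam, Finset.sum_mul]
  refine Finset.sum_congr rfl fun i _ => ?_
  rw [(hg i).coef_eq, Function.update_eq_self i (fun _ : Fin d => true), sc, lam]
  ring

lemma norm_add_qL_le_qB {d : ℕ} {a : ℝ} (ha : 0 < a) {v : L2 d} (h : Reg v) :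
    ‖v‖ ^ 2 + a * qL v ≤ qB a v := by
  obtain ⟨z, hz⟩ := h.exists_wt ha
  refine hasSum_le (fun n => ?_) ((parseval_norm (fun _ => true) v).add ((hasSum_qL h).mul_left a))
    (hasSum_qB hz).1
  change sc v n ^ 2 + _ ≤ _
  nlinarith [one_add_Lam_le_wt ha.le n, sq_nonneg (sc v n)]

/-- For each coefficient, with w the weight and Λ the eigenvalue, 2a(w(a-b) + τΛb) = w(a² - b²) + (w
- τΛ/2)(a-b)² + (τ/2)Λ(a+b)², and w - τΛ/2 ≥ 1. Later a and b are consecutive increments of the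
error, so a + b is a difference over two steps. -/
lemma energy_component {d : ℕ} {τ : ℝ} (hτ : 0 < τ) {a b z : L2 d} (ha : Reg a) (hb : Reg b)
    (hz : ∀ n, sc z n = wt (τ / 2) n * (sc a n - sc b n) + τ * Lam n * sc b n) :
    qB (τ / 2) a - qB (τ / 2) b + ‖a - b‖ ^ 2 + τ / 2 * qL (a + b) ≤ 2 * inner ℝ z a := by
  have hτ2 : 0 < τ / 2 := by positivity
  obtain ⟨za, hza⟩ := ha.exists_wt hτ2
  obtain ⟨zb, hzb⟩ := hb.exists_wt hτ2
  refine hasSum_le (fun n => ?_) ((((hasSum_qB hza).1.sub (hasSum_qB hzb).1).add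
    (parseval_norm (fun _ => true) (a - b))).add ((hasSum_qL (ha.add hb)).mul_left (τ / 2)))
    ((parseval (fun _ => true) z a).mul_left 2)
  change _ + sc (a - b) n ^ 2 + _ ≤ 2 * (sc z n * sc a n)
  rw [hz, sc_sub, sc_add]
  nlinarith [mul_nonneg (sub_nonneg.2 (one_add_Lam_le_wt hτ2.le n)) (sq_nonneg (sc a n - sc b n))]

/-! ### Integration by parts -/

/-- Parseval with sines in direction `i` for the left side and cosines throughout for the right. The
trace of `q` is free because that of `v` vanishes. -/
lemma inner_grad_eq_neg {d : ℕ} {i : Fin d} {q G v D : L2 d} (hq : HasWeakDeriv [i] q G)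
    (hv : HasWeakDerivZeroTrace i v D) : inner ℝ G v = - inner ℝ q D := by
  refine (parseval (Function.update (fun _ => false) i true) G v).unique
    ((parseval (fun _ => false) q D).neg.congr_fun fun n => ?_)
  have e : Function.update (fun _ : Fin d => false) i false = fun _ => false :=
    Function.update_eq_self i (fun _ : Fin d => false)
  have h1 := hq.coef_eq (fun _ => false) n
  have h2 := hv.coef_eq (fun _ => false) n
  rw [e] at h1 h2
  rw [h1, h2]; ring

/-- Two integrations by parts without second derivatives: in the systems with a cosine in direction
`i` and in direction `j` respectively, both sides have the same terms, pairing the sine coefficients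
of `v` with the coefficients of `w` that have cosines in both directions. -/
lemma inner_cross {d : ℕ} {i j : Fin d} (hij : i ≠ j) {v w vi vj wi wj : L2 d}
    (hvi : HasWeakDerivZeroTrace i v vi) (hvj : HasWeakDerivZeroTrace j v vj)
    (hwi : HasWeakDerivZeroTrace i w wi) (hwj : HasWeakDerivZeroTrace j w wj) :
    inner ℝ vi wj = inner ℝ vj wi := by
  set s : Fin d → Bool := fun _ => true with hs
  refine (parseval (Function.update s i false) vi wj).unique
    ((parseval (Function.update s j false) vj wi).congr_fun fun n => ?_)
  have es : ∀ k, Function.update s k true = s := fun k => Function.update_eq_self k s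
  have e1 : ∀ k l : Fin d, k ≠ l →
      Function.update (Function.update s k false) l true = Function.update s k false := by
    intro k l hkl
    rw [Function.update_comm hkl, es]
  have h1 := hvi.coef_eq s n
  have h2 := hvj.coef_eq s n
  have h3 := hwj.hasWeakDeriv.coef_eq (Function.update s i false) n
  have h4 := hwi.hasWeakDeriv.coef_eq (Function.update s j false) n
  rw [e1 _ _ hij] at h3
  rw [e1 _ _ hij.symm, Function.update_comm hij.symm] at h4
  rw [es] at h1 h2
  rw [h1, h2, h3, h4]; ring

lemma sum_lt_symm {d : ℕ} (F : Fin d → Fin d → ℝ) (hs : ∀ i j, F i j = F j i)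
    (h0 : ∀ i, F i i = 0) :
    2 * ∑ i, ∑ j ∈ Finset.univ.filter (fun j => i < j), F i j = ∑ i, ∑ j, F i j := by
  have h1 : ∀ i j, F i j = (if i < j then F i j else 0) + (if j < i then F j i else 0) := by
    intro i j
    rcases lt_trichotomy i j with h | h | h
    · simp [h, h.not_gt]
    · subst h; simp [h0]
    · simp [h, h.not_gt, hs i j]
  simp_rw [Finset.sum_filter]
  conv_rhs => enter [2, i, 2, j]; rw [h1 i j]
  simp_rw [Finset.sum_add_distrib]
  rw [Finset.sum_comm (f := fun i j => if j < i then F j i else 0)]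
  ring

/-- `‖∇v‖² = ‖div v‖² + ‖curl v‖²` for fields that vanish on the boundary. -/
lemma grad_eq_div_add_curl {d : ℕ} {v : Fin d → L2 d} {g : Fin d → Fin d → L2 d}
    (hg : ∀ i j, HasWeakDerivZeroTrace i (v j) (g i j)) :
    ∑ j, ∑ i, ‖g i j‖ ^ 2 = ‖∑ i, g i i‖ ^ 2 +
      ∑ i, ∑ j ∈ Finset.univ.filter (fun j => i < j), ‖g i j - g j i‖ ^ 2 := by
  -- The cross terms of the curl sum to the square of the divergence.
  have hx : ∀ i j, inner ℝ (g i j) (g j i) = inner ℝ (g i i) (g j j) := by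
    intro i j
    by_cases h : i = j
    · subst h; rfl
    · rw [inner_cross h (hg i j) (hg j j) (hg i i) (hg j i), real_inner_comm]
  have h1 := sum_lt_symm (fun i j => ‖g i j - g j i‖ ^ 2) (fun i j => by rw [norm_sub_rev])
    (fun i => by simp)
  have h2 : ∑ i, ∑ j, ‖g i j - g j i‖ ^ 2 =
      2 * ∑ j, ∑ i, ‖g i j‖ ^ 2 - 2 * ‖∑ i, g i i‖ ^ 2 := by
    simp_rw [norm_sub_sq_real, hx, Finset.sum_add_distrib, Finset.sum_sub_distrib,
      ← Finset.mul_sum, ← inner_sum, ← sum_inner, real_inner_self_eq_norm_sq]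
    rw [Finset.sum_comm (f := fun i j => ‖g i j‖ ^ 2)]
    ring
  linarith

/-! ### The divergence in the dual norm -/

/-- Cauchy–Schwarz over the directions produces the factor Σᵢ λᵢ = Λ, which is at most the weight of
A. Component `i` is expanded with a sine in direction `i` only, the system in which ∂ᵢ leads to pure
cosines. -/
lemma cc_div_sq_le {d : ℕ} {v D : Fin d → L2 d}
    (hD : ∀ i, HasWeakDerivZeroTrace i (v i) (D i)) (n : Fin d → ℕ) :
    cc (∑ i, D i) n ^ 2 ≤
      wt 1 n * ∑ i, coef (Function.update (fun _ => false) i true) (v i) n ^ 2 := by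
  have e : ∀ i, cc (D i) n = Real.pi * n i *
      coef (Function.update (fun _ => false) i true) (v i) n := by
    intro i
    have := (hD i).coef_eq (fun _ => false) n
    rwa [Function.update_eq_self i (fun _ : Fin d => false)] at this
  rw [cc_sum]
  simp_rw [e]
  refine (Finset.sum_mul_sq_le_sq_mul_sq _ _ _).trans ?_
  exact mul_le_mul_of_nonneg_right (Lam_le_wt n) (Finset.sum_nonneg fun i _ => sq_nonneg _)

/-- `x` represents `q` in the energy space of `∏ᵢ (1 - ∂ᵢᵢ)` with Neumann conditions. -/
def JRel {d : ℕ} (q x : L2 d) : Prop := ∀ n, cc x n = √(wt 1 n) * cc q n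

lemma JRel.add {d : ℕ} {q x q' x' : L2 d} (h : JRel q x) (h' : JRel q' x') :
    JRel (q + q') (x + x') := fun n => by rw [cc_add, cc_add, h, h']; ring

lemma JRel.smul {d : ℕ} {q x : L2 d} (h : JRel q x) (c : ℝ) : JRel (c • q) (c • x) := fun n => by
  rw [cc_smul, cc_smul, h]; ring

lemma JRel.sub {d : ℕ} {q x q' x' : L2 d} (h : JRel q x) (h' : JRel q' x') :
    JRel (q - q') (x - x') := fun n => by rw [cc_sub, cc_sub, h, h']; ring

lemma JRel.zero {d : ℕ} : JRel (0 : L2 d) 0 := fun n => by rw [cc_zero, mul_zero]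

lemma JRel.unique {d : ℕ} {q x x' : L2 d} (h : JRel q x) (h' : JRel q x') : x = x' :=
  eq_of_coef_eq (fun _ => false) fun n => (h n).trans (h' n).symm

lemma exists_JRel {d : ℕ} {q g : L2 d} (h : ∀ n, cc g n = wt 1 n * cc q n) : ∃ x, JRel q x := by
  refine exists_of_coef _ _ ?_ fun n hn => absurd (fun l hl => by simp at hl) hn
  refine summable_sq_of_le 1 (fun n => ?_) (parseval_norm (fun _ => false) g).summable
  change _ ≤ 1 * |cc g n|
  have h1 := one_le_wt zero_le_one n
  have h2 : √(wt 1 n) ≤ wt 1 n := by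
    rw [Real.sqrt_le_left (by linarith)]; nlinarith
  rw [h, abs_mul, abs_mul, one_mul, abs_of_nonneg (Real.sqrt_nonneg _),
    abs_of_nonneg (zero_le_one.trans h1)]
  exact mul_le_mul_of_nonneg_right h2 (abs_nonneg _)

/-- ⟨q, A r⟩ = ⟨A^{1/2} q, A^{1/2} r⟩, with the square root taken on cosine coefficients. -/
lemma inner_eq_inner_J {d : ℕ} {q x r y g : L2 d} (hq : JRel q x) (hr : JRel r y)
    (h : ∀ n, cc g n = wt 1 n * cc r n) : inner ℝ q g = inner ℝ x y := by
  refine (parseval (fun _ => false) q g).unique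
    ((parseval (fun _ => false) x y).congr_fun fun n => ?_)
  change cc q n * cc g n = cc x n * cc y n
  have h1 := one_le_wt zero_le_one n
  rw [h, hq, hr]
  have := Real.mul_self_sqrt (zero_le_one.trans h1)
  linear_combination (- cc q n * cc r n) * this

/-- If A q = div v, then ‖A^{1/2} q‖ is the dual norm of div v. That the constant is one is
essential: the pressure extrapolation costs exactly the numerical dissipation of the velocity step.
-/
lemma norm_J_sq_le {d : ℕ} {v D : Fin d → L2 d}
    (hD : ∀ i, HasWeakDerivZeroTrace i (v i) (D i)) {q x : L2 d} (hx : JRel q x)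
    (h : ∀ n, cc (∑ i, D i) n = wt 1 n * cc q n) : ‖x‖ ^ 2 ≤ ∑ i, ‖v i‖ ^ 2 := by
  refine hasSum_le (fun n => ?_) (parseval_norm (fun _ => false) x)
    (hasSum_sum (s := Finset.univ) fun i _ =>
      parseval_norm (Function.update (fun _ => false) i true) (v i))
  change cc x n ^ 2 ≤ _
  have h1 := one_le_wt zero_le_one n
  have h2 := cc_div_sq_le hD n
  rw [h] at h2
  rw [hx, mul_pow, Real.sq_sqrt (zero_le_one.trans h1)]
  have h3 : 0 < wt 1 n := by linarith
  refine le_of_mul_le_mul_left ?_ h3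
  linarith

/-- Each differentiated direction passes from cosine to sine. As every direction occurs at most
once, a sine is never differentiated, so the exact pressure needs no boundary condition. -/
lemma coef_mixed_list {d : ℕ} {q : L2 d} {w : List (Fin d) → L2 d}
    (hw : ∀ l : List (Fin d), l.Nodup → HasWeakDeriv l q (w l)) (n : Fin d → ℕ)
    (l : List (Fin d)) (hl : l.Nodup) :
    coef (fun i => decide (i ∈ l)) (w l) n = (l.map fun i => - (Real.pi * n i)).prod * cc q n := by
  induction l with
  | nil =>
    have : HasWeakDeriv [] q q := fun ψ _ _ _ => by simp [pdList]
    rw [(hw [] List.nodup_nil).unique this]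
    simp [cc]
  | cons i l ih =>
    have hnd := List.nodup_cons.1 hl
    have h1 := ((hw l hnd.2).of_cons (hw (i :: l) hl)).coef_eq (fun i => decide (i ∈ l)) n
    have e1 : Function.update (fun j => decide (j ∈ l)) i true = fun j => decide (j ∈ i :: l) := by
      funext j
      by_cases h : j = i
      · subst h; simp
      · simp [h]
    have e2 : Function.update (fun j => decide (j ∈ l)) i false = fun j => decide (j ∈ l) := by
      funext j
      by_cases h : j = i
      · subst h; simp [hnd.1]
      · simp [Function.update_of_ne h]
    rw [e1, e2, ih hnd.2] at h1
    rw [h1, List.map_cons, List.prod_cons]; ring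

/-- Expanding the product ∏ (1 + λᵢ) over subsets identifies the energy norm of A with the sum of
the squared mixed derivatives, the norm in which the exact pressure is regular in time. -/
lemma exists_JRel_of_mixed {d : ℕ} {q : L2 d} {w : List (Fin d) → L2 d}
    (hw : ∀ l : List (Fin d), l.Nodup → HasWeakDeriv l q (w l)) :
    ∃ x, JRel q x ∧ ‖x‖ ^ 2 = ∑ S : Finset (Fin d), ‖w S.toList‖ ^ 2 := by
  have key : HasSum (fun n => (√(wt 1 n) * cc q n) ^ 2)
      (∑ S : Finset (Fin d), ‖w S.toList‖ ^ 2) := by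
    refine (hasSum_sum (s := Finset.univ) fun S _ =>
      parseval_norm (fun i => decide (i ∈ Finset.toList S)) (w S.toList)).congr_fun fun n => ?_
    rw [mul_pow, Real.sq_sqrt (zero_le_one.trans (one_le_wt zero_le_one n)), wt_eq_sum,
      Finset.sum_mul]
    refine Finset.sum_congr rfl fun S _ => ?_
    rw [coef_mixed_list hw n _ S.nodup_toList, Finset.prod_map_toList, mul_pow,
      ← Finset.prod_pow]
    simp [lam]
  obtain ⟨x, hx⟩ := exists_of_coef (fun _ => false) _ key.summable
    fun n hn => absurd (fun l hl => by simp at hl) hn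
  refine ⟨x, hx, (parseval_norm (fun _ => false) x).unique (key.congr_fun fun n => ?_)⟩
  rw [hx]

/-! ### The scheme in terms of coefficients -/

/-- On sine coefficients the one-dimensional operators commute, so the intermediate velocities can
be eliminated and both schemes take the same factorized form. -/
lemma velocityStep_coef {d : ℕ} (hd : d = 2 ∨ d = 3) {τ : ℝ} (hτ : 0 < τ) {F u v : Field d}
    {q : L2 d} (hu : ∀ i, Reg (u i)) (h : VelocityStep d τ F q u v) :
    ∃ G : Field d, HasGrad q G ∧ ∀ i n, wt (τ / 2) n * (sc (v i) n - sc (u i) n) =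
      τ * (-(Lam n * sc (u i) n) - sc (G i) n + sc (F i) n) := by
  rcases hd with rfl | rfl
  · obtain ⟨w, wxx, uyy, vyy, G, hw, huy, hv, hG, e1, e2⟩ := h
    refine ⟨G, hG, fun i n => ?_⟩
    have c1 := congrArg (fun z : Field 2 => sc (z i) n) e1
    have c2 := congrArg (fun z : Field 2 => sc (z i) n) e2
    simp only [Pi.add_apply, Pi.sub_apply, Pi.smul_apply, sc_add, sc_sub, sc_smul] at c1 c2
    have a1 : sc (wxx i) n = - lam n 0 * sc (w i) n := (hw i).coef_eq rfl n
    have a2 : sc (vyy i) n = - lam n 1 * sc (v i) n := (hv i).coef_eq rfl n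
    have a3 := (hu i).sc_deriv2 (huy i) n
    rw [a1, a2] at c2
    rw [a1, a3] at c1
    simp only [wt, Lam, Fin.prod_univ_two, Fin.sum_univ_two]
    field_simp at c1 c2
    -- With a, b = (τ/2)λ₀, (τ/2)λ₁, the half steps are weighted by 1 - a and 1 + a, so that `w`
    -- cancels; then (1-a)(1-b) = (1+a)(1+b) - 2(a+b) produces the Laplacian.
    linear_combination (1 / 2 - τ / 4 * lam n 0) * c1 + (1 / 2 + τ / 4 * lam n 0) * c2
  · obtain ⟨ξ, η, ζ, L, G, uxx, uyy, uzz, ηxx, ζyy, vzz, hL, hG, hux, huy, huz, hη, hζ, hv,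
      e1, e2, e3, e4⟩ := h
    refine ⟨G, hG, fun i n => ?_⟩
    obtain ⟨D, hD, hLD⟩ := hL
    have c1 := congrArg (fun z : Field 3 => sc (z i) n) e1
    have c2 := congrArg (fun z : Field 3 => sc (z i) n) e2
    have c3 := congrArg (fun z : Field 3 => sc (z i) n) e3
    have c4 := congrArg (fun z : Field 3 => sc (z i) n) e4
    simp only [Pi.add_apply, Pi.sub_apply, Pi.smul_apply, Pi.zero_apply, sc_add, sc_sub, sc_smul,
      sc_zero] at c1 c2 c3 c4
    have a1 : sc (ηxx i) n = - lam n 0 * sc (η i) n := (hη i).coef_eq rfl n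
    have a2 : sc (ζyy i) n = - lam n 1 * sc (ζ i) n := (hζ i).coef_eq rfl n
    have a3 : sc (vzz i) n = - lam n 2 * sc (v i) n := (hv i).coef_eq rfl n
    have b1 := (hu i).sc_deriv2 (hux i) n
    have b2 := (hu i).sc_deriv2 (huy i) n
    have b3 := (hu i).sc_deriv2 (huz i) n
    have b4 : sc (L i) n = - Lam n * sc (u i) n := by
      rw [hLD, sc_sum, Lam, neg_mul, Finset.sum_mul, ← Finset.sum_neg_distrib]
      exact Finset.sum_congr rfl fun j _ => by rw [(hu i).sc_deriv2 (hD i j) n]; ring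
    rw [b4] at c1
    rw [a1, b1] at c2
    rw [a2, b2] at c3
    rw [a3, b3] at c4
    simp only [wt, Fin.prod_univ_three]
    field_simp at c1 c2 c3 c4
    -- Each correction reads (1 + (τ/2)λ)(new - u) = old - u, so the three factors multiply up to
    -- the weight times v - u, which equals ξ - u.
    linear_combination c1 + 1 / 2 * c2 + 1 / 2 * (1 + τ / 2 * lam n 0) * c3
      + 1 / 2 * (1 + τ / 2 * lam n 0) * (1 + τ / 2 * lam n 1) * c4

lemma hasA_coef {d : ℕ} (hd : d = 2 ∨ d = 3) {q g : L2 d} (h : HasA d q g) (n : Fin d → ℕ) :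
    cc g n = wt 1 n * cc q n := by
  rcases hd with rfl | rfl
  · obtain ⟨_, w, h1, h2⟩ := h
    have e1 : cc w n = _ := h1.coef_eq (σ := fun _ => false) rfl n
    have e2 : cc g n = _ := h2.coef_eq (σ := fun _ => false) rfl n
    change cc g n = _ * cc w n at e2
    change cc w n = _ * cc q n at e1
    rw [e2, e1]
    simp only [wt, lam, Fin.prod_univ_two]
    ring
  · obtain ⟨_, w₁, w₂, h1, h2, h3⟩ := h
    have e1 : cc w₁ n = _ := h1.coef_eq (σ := fun _ => false) rfl n
    have e2 : cc w₂ n = _ := h2.coef_eq (σ := fun _ => false) rfl n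
    have e3 : cc g n = _ := h3.coef_eq (σ := fun _ => false) rfl n
    change cc w₁ n = _ * cc q n at e1
    change cc w₂ n = _ * cc w₁ n at e2
    change cc g n = _ * cc w₂ n at e3
    rw [e3, e2, e1]
    simp only [wt, lam, Fin.prod_univ_three]
    ring

/-! ### Increments of functions of time -/

section Time

variable {E : Type*} [NormedAddCommGroup E]

/-- `g` is Lipschitz on `[0,T]`. -/
def Lip (T M : ℝ) (g : ℝ → E) : Prop :=
  ∀ a ∈ Set.Icc 0 T, ∀ b ∈ Set.Icc 0 T, ‖g a - g b‖ ≤ M * |a - b|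

/-- Increments of `g` over intervals of equal length differ by a quantity of second order. -/
def Inc (T M : ℝ) (g : ℝ → E) : Prop :=
  ∀ a b h : ℝ, 0 ≤ h → a ∈ Set.Icc 0 T → a + h ∈ Set.Icc 0 T → b ∈ Set.Icc 0 T →
    b + h ∈ Set.Icc 0 T → ‖(g (a + h) - g a) - (g (b + h) - g b)‖ ≤ M * h * |a - b|

lemma Lip.mono {T M M' : ℝ} {g : ℝ → E} (h : Lip T M g) (hM : M ≤ M') : Lip T M' g :=
  fun a ha b hb => (h a ha b hb).trans (mul_le_mul_of_nonneg_right hM (abs_nonneg _))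

lemma Inc.mono {T M M' : ℝ} {g : ℝ → E} (h : Inc T M g) (hM : M ≤ M') : Inc T M' g :=
  fun a b s hs h1 h2 h3 h4 => (h a b s hs h1 h2 h3 h4).trans (by gcongr)

lemma Lip.continuousOn {T M : ℝ} {g : ℝ → E} (h : Lip T M g) (hM : 0 ≤ M) :
    ContinuousOn g (Set.Icc 0 T) := by
  have : LipschitzOnWith M.toNNReal g (Set.Icc 0 T) := by
    refine LipschitzOnWith.of_dist_le_mul fun a ha b hb => ?_
    rw [dist_eq_norm, dist_eq_norm, Real.coe_toNNReal _ hM]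
    exact h a ha b hb
  exact this.continuousOn

lemma Inc.add {T M M' : ℝ} {g g' : ℝ → E} (h : Inc T M g) (h' : Inc T M' g') :
    Inc T (M + M') (fun t => g t + g' t) := by
  intro a b s hs h1 h2 h3 h4
  have e1 := h a b s hs h1 h2 h3 h4
  have e2 := h' a b s hs h1 h2 h3 h4
  rw [show (g (a + s) + g' (a + s) - (g a + g' a)) - (g (b + s) + g' (b + s) - (g b + g' b)) =
    ((g (a + s) - g a) - (g (b + s) - g b)) + ((g' (a + s) - g' a) - (g' (b + s) - g' b)) by abel]
  refine (norm_add_le _ _).trans ?_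
  linarith

lemma Inc.neg {T M : ℝ} {g : ℝ → E} (h : Inc T M g) : Inc T M (fun t => - g t) := by
  intro a b s hs h1 h2 h3 h4
  have e1 := h a b s hs h1 h2 h3 h4
  rwa [show (-g (a + s) - -g a) - (-g (b + s) - -g b) =
    -((g (a + s) - g a) - (g (b + s) - g b)) by abel, norm_neg]

lemma Inc.sum {ι : Type*} {T : ℝ} (s : Finset ι) {M : ι → ℝ} {g : ι → ℝ → E}
    (h : ∀ j ∈ s, Inc T (M j) (g j)) : Inc T (∑ j ∈ s, M j) (fun t => ∑ j ∈ s, g j t) := by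
  classical
  induction s using Finset.induction_on with
  | empty => intro a b t _ _ _ _ _; simp
  | insert j s hj ih =>
    simp_rw [Finset.sum_insert hj]
    exact (h j (Finset.mem_insert_self _ _)).add
      (ih fun k hk => h k (Finset.mem_insert_of_mem hk))

variable [NormedSpace ℝ E]

lemma norm_integral_le_of_bound {T M : ℝ} {g : ℝ → E}
    (hb : ∀ᵐ s ∂(volume.restrict (Set.Ioc 0 T)), ‖g s‖ ≤ M) {a b : ℝ}
    (ha : a ∈ Set.Icc 0 T) (hb' : b ∈ Set.Icc 0 T) :
    ‖∫ s in a..b, g s‖ ≤ M * |b - a| := by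
  refine intervalIntegral.norm_integral_le_of_norm_le_const_ae ?_
  filter_upwards [(ae_restrict_iff' measurableSet_Ioc).1 hb] with s hs hs'
  refine hs ⟨(le_min ha.1 hb'.1).trans_lt hs'.1, hs'.2.trans (max_le ha.2 hb'.2)⟩

lemma sub_eq_integral {T : ℝ} {g g' : ℝ → E} (hi : IntegrableOn g' (Set.Ioc 0 T))
    (h : ∀ t ∈ Set.Icc (0 : ℝ) T, g t = g 0 + ∫ s in (0 : ℝ)..t, g' s) {a b : ℝ}
    (ha : a ∈ Set.Icc 0 T) (hb : b ∈ Set.Icc 0 T) : g b - g a = ∫ s in a..b, g' s := by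
  have hii : ∀ t ∈ Set.Icc (0 : ℝ) T, IntervalIntegrable g' volume 0 t := fun t ht =>
    (intervalIntegrable_iff_integrableOn_Ioc_of_le ht.1).2
      (hi.mono_set (Set.Ioc_subset_Ioc_right ht.2))
  rw [h a ha, h b hb, ← intervalIntegral.integral_interval_sub_left (hii b hb) (hii a ha)]
  abel

lemma lip_of_memWInf_one {T : ℝ} {g : ℝ → E} (h : MemWInf T 1 g) : ∃ M, 0 ≤ M ∧ Lip T M g := by
  obtain ⟨g', hg', he⟩ := h
  have hg' : MemLp g' ⊤ (volume.restrict (Set.Ioc 0 T)) := hg'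
  have hb : ∀ᵐ s ∂(volume.restrict (Set.Ioc 0 T)),
      ‖g' s‖ ≤ (eLpNormEssSup g' (volume.restrict (Set.Ioc 0 T))).toReal := by
    have hfin : eLpNormEssSup g' (volume.restrict (Set.Ioc 0 T)) ≠ ⊤ := by
      have := hg'.2; rw [eLpNorm_exponent_top] at this; exact this.ne
    filter_upwards [ae_le_eLpNormEssSup (f := g') (μ := volume.restrict (Set.Ioc 0 T))] with s hs
    rw [← toReal_enorm]
    exact ENNReal.toReal_mono hfin hs
  have hi : IntegrableOn g' (Set.Ioc 0 T) := hg'.integrable le_top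
  refine ⟨(eLpNormEssSup g' (volume.restrict (Set.Ioc 0 T))).toReal, ENNReal.toReal_nonneg, fun a ha b hb' => ?_⟩
  rw [sub_eq_integral hi he hb' ha]
  exact norm_integral_le_of_bound hb hb' ha

/-- The derivative is Lipschitz, and both increments are integrals of it over [0,h], shifted by a
and by b. -/
lemma inc_of_memWInf_two {T : ℝ} {g : ℝ → E} (h : MemWInf T 2 g) :
    ∃ M, 0 ≤ M ∧ Lip T M g ∧ Inc T M g := by
  obtain ⟨g', hg', he⟩ := h
  obtain ⟨M, hM, hL⟩ := lip_of_memWInf_one hg'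
  have hc := hL.continuousOn hM
  obtain ⟨M', hM'⟩ := isCompact_Icc.exists_bound_of_continuousOn hc
  have hi : IntegrableOn g' (Set.Ioc 0 T) :=
    (hc.integrableOn_Icc).mono_set Set.Ioc_subset_Icc_self
  refine ⟨max M M', hM.trans (le_max_left _ _), ?_, ?_⟩
  · refine Lip.mono (M := M') (fun a ha b hb' => ?_) (le_max_right _ _)
    rw [sub_eq_integral hi he hb' ha]
    refine norm_integral_le_of_bound ?_ hb' ha
    refine (ae_restrict_iff' measurableSet_Ioc).2 (Filter.Eventually.of_forall fun s hs => ?_)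
    exact hM' s ⟨hs.1.le, hs.2⟩
  · refine Inc.mono (M := M) (fun a b s hs h1 h2 h3 h4 => ?_) (le_max_left _ _)
    have key : ∀ c, c ∈ Set.Icc 0 T → c + s ∈ Set.Icc 0 T →
        g (c + s) - g c = ∫ y in (0 : ℝ)..s, g' (c + y) ∧
          IntervalIntegrable (fun y => g' (c + y)) volume 0 s := by
      intro c hc1 hc2
      constructor
      · rw [sub_eq_integral hi he hc1 hc2, intervalIntegral.integral_comp_add_left]
        simp
      · refine ContinuousOn.intervalIntegrable ?_
        rw [Set.uIcc_of_le hs]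
        refine hc.comp (by fun_prop) fun y hy => ?_
        exact ⟨by linarith [hc1.1, hy.1], by linarith [hc2.2, hy.2]⟩
    rw [(key a h1 h2).1, (key b h3 h4).1,
      ← intervalIntegral.integral_sub (key a h1 h2).2 (key b h3 h4).2]
    have : ‖∫ y in (0 : ℝ)..s, (g' (a + y) - g' (b + y))‖ ≤ M * |a - b| * |s - 0| := by
      refine intervalIntegral.norm_integral_le_of_norm_le_const fun y hy => ?_
      rw [Set.uIoc_of_le hs] at hy
      have := hL (a + y) ⟨by linarith [h1.1, hy.1], by linarith [h2.2, hy.2]⟩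
        (b + y) ⟨by linarith [h3.1, hy.1], by linarith [h4.2, hy.2]⟩
      rwa [show a + y - (b + y) = a - b by ring] at this
    rw [sub_zero, abs_of_nonneg hs] at this
    linarith

/-- Second order consistency of the midpoint rule. -/
lemma midpoint_error {T M M' τ t : ℝ} {g r : ℝ → E} (hg : Lip T M' g) (hM' : 0 ≤ M')
    (hr : Inc T M r) (hM : 0 ≤ M)
    (hd : ∀ s ∈ Set.Ioo 0 T, HasDerivAt g (r s) s) (hτ : 0 < τ) (ht : 0 ≤ t) (htT : t + τ ≤ T) :
    ‖g (t + τ) - g t - τ • r (t + τ / 2)‖ ≤ M * τ ^ 3 := by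
  set m := t + τ / 2 with hm
  -- Symmetrized about the midpoint, the derivative of the error in `h` is a second difference of
  -- `r`, which `Inc` bounds.
  set F : ℝ → E := fun h => g (m + h) - g (m - h) - (2 * h) • r m with hF
  have hmem : ∀ h ∈ Set.Icc 0 (τ / 2), m + h ∈ Set.Icc 0 T ∧ m - h ∈ Set.Icc 0 T := by
    intro h hh
    exact ⟨⟨by linarith [hh.1], by linarith [hh.2]⟩, ⟨by linarith [hh.2], by linarith [hh.1]⟩⟩
  have hgc := hg.continuousOn hM'
  have hFc : ContinuousOn F (Set.Icc 0 (τ / 2)) := by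
    refine ((hgc.comp (by fun_prop) fun h hh => (hmem h hh).1).sub
      (hgc.comp (by fun_prop) fun h hh => (hmem h hh).2)).sub (by fun_prop)
  have hFd : ∀ h ∈ Set.Ico 0 (τ / 2), HasDerivWithinAt F
      (r (m + h) + r (m - h) - (2 : ℝ) • r m) (Set.Ici h) h := by
    intro h hh
    have d1 : HasDerivAt (fun h => g (m + h)) (r (m + h)) h := by
      have := (hd (m + h) ⟨by linarith [hh.1], by linarith [hh.2]⟩).scomp h
        ((hasDerivAt_id h).const_add m)
      simpa [Function.comp_def] using this
    have d2 : HasDerivAt (fun h => g (m - h)) (- r (m - h)) h := by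
      have := (hd (m - h) ⟨by linarith [hh.2], by linarith [hh.1]⟩).scomp h
        ((hasDerivAt_id h).const_sub m)
      simpa [Function.comp_def] using this
    have d3 : HasDerivAt (fun h : ℝ => (2 * h) • r m) ((2 : ℝ) • r m) h := by
      have := ((hasDerivAt_id h).const_mul (2 : ℝ)).smul_const (r m)
      simpa using this
    have := ((d1.sub d2).sub d3).hasDerivWithinAt (s := Set.Ici h)
    rw [sub_neg_eq_add] at this
    exact this
  have hb : ∀ h ∈ Set.Ico 0 (τ / 2), ‖r (m + h) + r (m - h) - (2 : ℝ) • r m‖ ≤ M * τ ^ 2 := by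
    intro h hh
    have hI := hmem h ⟨hh.1, hh.2.le⟩
    have hm' := (hmem 0 ⟨le_rfl, by positivity⟩).1
    rw [add_zero] at hm'
    have := hr m (m - h) h hh.1 hm' hI.1 hI.2 (by simpa using hm')
    rw [show m - h + h = m by ring, show m - (m - h) = h by ring, abs_of_nonneg hh.1] at this
    rw [show r (m + h) + r (m - h) - (2 : ℝ) • r m = r (m + h) - r m - (r m - r (m - h)) by
      rw [two_smul]; abel]
    refine this.trans ?_
    have : h * h ≤ τ ^ 2 := by nlinarith [hh.1, hh.2]
    nlinarith
  have := norm_image_sub_le_of_norm_deriv_right_le_segment hFc hFd hb (τ / 2)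
    ⟨by positivity, le_rfl⟩
  simp only [hF] at this
  rw [show m + τ / 2 = t + τ by rw [hm]; ring, show m - τ / 2 = t by rw [hm]; ring,
    show 2 * (τ / 2) = τ by ring] at this
  simp only [add_zero, sub_zero, sub_self, mul_zero, zero_smul] at this
  refine this.trans ?_
  have : 0 ≤ M * τ ^ 3 := by positivity
  nlinarith

end Time

/-! ### Consistency -/

/-- Separates the expansion of B into the identity, the Laplacian and the splitting terms. -/
lemma sum_finset_eq_card {d : ℕ} {M : Type*} [AddCommMonoid M] (F : Finset (Fin d) → M) :
    ∑ S, F S = F ∅ + ∑ j, F {j} + ∑ S with 2 ≤ S.card, F S := by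
  classical
  rw [← Finset.sum_filter_not_add_sum_filter Finset.univ (fun S : Finset (Fin d) => 2 ≤ S.card)]
  congr 1
  have : (Finset.univ.filter fun S : Finset (Fin d) => ¬ 2 ≤ S.card) =
      insert ∅ (Finset.univ.image fun j : Fin d => ({j} : Finset (Fin d))) := by
    ext S
    simp only [Finset.mem_filter, Finset.mem_univ, true_and, Finset.mem_insert, Finset.mem_image,
      not_le]
    constructor
    · intro h
      rcases Nat.lt_succ_iff_lt_or_eq.1 h with h | h
      · left; exact Finset.card_eq_zero.1 (by omega)
      · right
        obtain ⟨j, hj⟩ := Finset.card_eq_one.1 h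
        exact ⟨j, hj.symm⟩
    · rintro (rfl | ⟨j, rfl⟩) <;> simp
  rw [this, Finset.sum_insert (by simp), Finset.sum_image (Finset.singleton_injective.injOn)]

/-- The derivatives of the velocity that enter the splitting operator. -/
lemma exists_deriv2_family {d : ℕ} {T : ℝ} {u : ℝ → Field d} (hu : VelocityRegular T u) :
    ∃ (W : Fin d → List (Fin d) → ℝ → L2 d) (M : Fin d → List (Fin d) → ℝ),
      (∀ i l, 0 ≤ M i l) ∧
      (∀ i l, l.Nodup → ∀ t ∈ Set.Icc (0 : ℝ) T, HasWeakDeriv (l ++ l) (u t i) (W i l t)) ∧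
      (∀ i l, l.Nodup → Lip T (M i l) (W i l)) ∧
      (∀ i l, l.Nodup → l.length ≤ 1 → Inc T (M i l) (W i l)) := by
  have key : ∀ i (l : List (Fin d)), ∃ (W : ℝ → L2 d) (M : ℝ), 0 ≤ M ∧ (l.Nodup →
      (∀ t ∈ Set.Icc (0 : ℝ) T, HasWeakDeriv (l ++ l) (u t i) (W t)) ∧ Lip T M W ∧
        (l.length ≤ 1 → Inc T M W)) := by
    intro i l
    by_cases hl : l.Nodup
    · by_cases h : l.length ≤ 1
      · obtain ⟨g, hg, hm⟩ := hu.h2 i (l ++ l) (by rw [List.length_append]; omega)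
        obtain ⟨M, hM, h1, h2⟩ := inc_of_memWInf_two hm
        exact ⟨g, M, hM, fun _ => ⟨hg, h1, fun _ => h2⟩⟩
      · obtain ⟨g, hg, hm⟩ := hu.dB i l hl (by omega)
        obtain ⟨M, hM, h1⟩ := lip_of_memWInf_one hm
        exact ⟨g, M, hM, fun _ => ⟨hg, h1, fun h' => absurd h' h⟩⟩
    · exact ⟨fun _ => 0, 0, le_rfl, fun h => absurd h hl⟩
  choose W M h0 h using key
  exact ⟨W, M, h0, fun i l hl => (h i l hl).1, fun i l hl => (h i l hl).2.1,
    fun i l hl => (h i l hl).2.2⟩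

lemma VelocityRegular.reg {d : ℕ} {T : ℝ} {u : ℝ → Field d} (hu : VelocityRegular T u)
    {t : ℝ} (ht : t ∈ Set.Icc 0 T) (i : Fin d) : Reg (u t i) := by
  obtain ⟨W, -, -, hW, -, -⟩ := exists_deriv2_family hu
  exact Reg.of_wt one_pos (sc_sum_deriv2 (hu.h10 i t ht) (w := fun l => W i l t)
    (fun l hl => hW i l hl t ht) 1)

/-- There are three sources of error. The midpoint rule for u_t gives `R₁`. Replacing Δu at the
midpoint by the average of its end values, as the linear part of B does, gives `R₂`. The mixed
derivatives in B carry at least τ² and act on an increment of size τ; after division by τ they are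
of size τ² too. -/
lemma residual_bound {d : ℕ} {T : ℝ} (hT : 0 < T) {f u : ℝ → Field d} {p : ℝ → L2 d}
    (hf : ∀ i, MemWInf T 2 (fun t => f t i)) (hsol : IsStokesSolution T f u p)
    (hu : VelocityRegular T u) (hp : PressureRegular T p) (i : Fin d) :
    ∃ C, 0 ≤ C ∧ ∀ τ t : ℝ, 0 < τ → 0 ≤ t → t + τ ≤ T → ∀ G : L2 d,
      HasWeakDeriv [i] (p (t + τ / 2)) G → ∃ R : L2 d, ‖R‖ ≤ C * τ ^ 2 ∧
        ∀ n, wt (τ / 2) n * (sc (u (t + τ) i) n - sc (u t i) n) =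
          τ * (-(Lam n * sc (u t i) n) - sc G n + sc (f (t + τ / 2) i) n + sc R n) := by
  obtain ⟨W, M, hM0, hW, hLip, hInc⟩ := exists_deriv2_family hu
  obtain ⟨Gp, hGp, hGm⟩ := hp.mixed [i] (List.nodup_singleton i)
  obtain ⟨Mp, hMp, -, hGinc⟩ := inc_of_memWInf_two hGm
  obtain ⟨Mf, hMf, -, hfinc⟩ := inc_of_memWInf_two (hf i)
  have hu0 : ∀ t ∈ Set.Icc 0 T, W i [] t = u t i := fun t ht =>
    (hW i [] List.nodup_nil t ht).unique fun ψ _ _ _ => by simp [pdList]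
  set L : ℝ → L2 d := fun t => ∑ j, W i [j] t with hL
  set ML := ∑ j, M i [j] with hML
  have hML0 : 0 ≤ ML := Finset.sum_nonneg fun j _ => hM0 i [j]
  have hLinc : Inc T ML L := Inc.sum _ fun j _ => hInc i [j] (List.nodup_singleton j) (by simp)
  set r : ℝ → L2 d := fun t => (L t + - Gp t) + f t i with hr
  have hrinc : Inc T (ML + Mp + Mf) r := (hLinc.add hGinc.neg).add hfinc
  have hder : ∀ s ∈ Set.Ioo 0 T, HasDerivAt (W i []) (r s) s := by
    intro s hs
    obtain ⟨L', G', hL', hG', hd⟩ := hsol.momentum s ⟨hs.1, hs.2.le⟩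
    have hsI : s ∈ Set.Icc 0 T := ⟨hs.1.le, hs.2.le⟩
    obtain ⟨D, hD, hLD⟩ := hL'
    have e1 : L' i = L s := by
      rw [hLD]
      exact Finset.sum_congr rfl fun j _ => (hD i j).unique (hW i [j] (List.nodup_singleton j) s hsI)
    have e2 : G' i = Gp s := (hG' i).unique (hGp s hsI)
    have h1 := (hasDerivWithinAt_pi.1 hd i).hasDerivAt (Icc_mem_nhds hs.1 hs.2)
    have e3 : (L' - G' + f s) i = r s := by
      rw [Pi.add_apply, Pi.sub_apply, e1, e2, hr, sub_eq_add_neg]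
    rw [e3] at h1
    refine h1.congr_of_eventuallyEq ?_
    filter_upwards [Icc_mem_nhds hs.1 hs.2] with y hy
    exact hu0 y hy
  -- Powers of τ beyond the second are traded for powers of `T`.
  set MB := ∑ S : Finset (Fin d) with 2 ≤ S.card, M i S.toList * T ^ (S.card - 2) with hMB
  have hMB0 : 0 ≤ MB := Finset.sum_nonneg fun S _ => mul_nonneg (hM0 _ _) (by positivity)
  refine ⟨(ML + Mp + Mf) + ML + MB, by positivity, ?_⟩
  intro τ t hτ ht htT G hG
  have htI : t ∈ Set.Icc 0 T := ⟨ht, by linarith⟩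
  have htI' : t + τ ∈ Set.Icc 0 T := ⟨by linarith, htT⟩
  have htm : t + τ / 2 ∈ Set.Icc 0 T := ⟨by linarith, by linarith⟩
  have hτT : τ ≤ T := by linarith
  have hGe : G = Gp (t + τ / 2) := hG.unique (hGp _ htm)
  set δ : Finset (Fin d) → L2 d := fun S => W i S.toList (t + τ) - W i S.toList t with hδ
  set B : L2 d := ∑ S : Finset (Fin d) with 2 ≤ S.card, (-(τ / 2)) ^ S.card • δ S with hB
  set R₁ : L2 d := τ⁻¹ • (W i [] (t + τ) - W i [] t - τ • r (t + τ / 2)) with hR₁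
  set R₂ : L2 d := -((1 / 2 : ℝ) • ((L (t + τ) - L (t + τ / 2)) - (L (t + τ / 2) - L t))) with hR₂
  refine ⟨R₁ + R₂ + τ⁻¹ • B, ?_, fun n => ?_⟩
  · have b1 : ‖R₁‖ ≤ (ML + Mp + Mf) * τ ^ 2 := by
      have := midpoint_error (hLip i [] List.nodup_nil) (hM0 i []) hrinc (by positivity) hder hτ
        ht htT
      rw [hR₁, norm_smul, norm_inv, Real.norm_of_nonneg hτ.le, inv_mul_le_iff₀ hτ]
      linarith [this]
    have b2 : ‖R₂‖ ≤ ML * τ ^ 2 := by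
      have := hLinc (t + τ / 2) t (τ / 2) (by positivity) htm
        (by rwa [show t + τ / 2 + τ / 2 = t + τ by ring]) htI htm
      rw [show t + τ / 2 + τ / 2 = t + τ by ring, show t + τ / 2 - t = τ / 2 by ring,
        abs_of_pos (by positivity)] at this
      rw [hR₂, norm_neg, norm_smul]
      have h2 : ‖(1 / 2 : ℝ)‖ = 1 / 2 := by norm_num
      rw [h2]
      nlinarith [mul_nonneg hML0 (sq_nonneg τ)]
    have b3 : ‖τ⁻¹ • B‖ ≤ MB * τ ^ 2 := by
      rw [norm_smul, norm_inv, Real.norm_of_nonneg hτ.le, inv_mul_le_iff₀ hτ, hB, hMB,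
        Finset.sum_mul, Finset.mul_sum]
      refine norm_sum_le_of_le _ fun S hS => ?_
      have hc : 2 ≤ S.card := (Finset.mem_filter.1 hS).2
      have hl := hLip i S.toList S.nodup_toList (t + τ) htI' t htI
      rw [show t + τ - t = τ by ring, abs_of_pos hτ] at hl
      rw [norm_smul, norm_pow, norm_neg, Real.norm_of_nonneg (by positivity)]
      have h1 : (τ / 2) ^ S.card ≤ τ ^ 2 * T ^ (S.card - 2) := by
        calc (τ / 2) ^ S.card ≤ τ ^ S.card := by gcongr; linarith
          _ = τ ^ 2 * τ ^ (S.card - 2) := by rw [← pow_add]; congr 1; omega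
          _ ≤ τ ^ 2 * T ^ (S.card - 2) := by gcongr
      calc (τ / 2) ^ S.card * ‖δ S‖
          ≤ (τ ^ 2 * T ^ (S.card - 2)) * (M i S.toList * τ) := by gcongr
        _ = τ * (M i S.toList * T ^ (S.card - 2) * τ ^ 2) := by ring
    calc ‖R₁ + R₂ + τ⁻¹ • B‖ ≤ ‖R₁‖ + ‖R₂‖ + ‖τ⁻¹ • B‖ := norm_add₃_le
      _ ≤ _ := by linarith
  · have c1 := sc_sum_deriv2 (hu.h10 i _ htI') (w := fun l => W i l (t + τ))
      (fun l hl => hW i l hl _ htI') (τ / 2) n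
    have c0 := sc_sum_deriv2 (hu.h10 i _ htI) (w := fun l => W i l t)
      (fun l hl => hW i l hl _ htI) (τ / 2) n
    have hs : ∑ S : Finset (Fin d), (-(τ / 2)) ^ S.card • W i S.toList (t + τ) -
        ∑ S : Finset (Fin d), (-(τ / 2)) ^ S.card • W i S.toList t =
        (W i [] (t + τ) - W i [] t) - (τ / 2) • (L (t + τ) - L t) + B := by
      rw [← Finset.sum_sub_distrib]
      simp_rw [← smul_sub]
      rw [sum_finset_eq_card]
      simp only [Finset.card_empty, pow_zero, one_smul, Finset.toList_empty, Finset.card_singleton,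
        pow_one, Finset.toList_singleton, hB, hδ, hL]
      rw [← Finset.smul_sum, ← Finset.sum_sub_distrib, neg_smul]
      abel
    have hLt : sc (L t) n = - (Lam n * sc (u t i) n) := by
      rw [hL, sc_sum, Lam, Finset.sum_mul, ← Finset.sum_neg_distrib]
      refine Finset.sum_congr rfl fun j _ => ?_
      rw [(hu.reg htI i).sc_deriv2 (hW i [j] (List.nodup_singleton j) t htI)]
      ring
    have hvec : (W i [] (t + τ) - W i [] t) - (τ / 2) • (L (t + τ) - L t) + B =
        τ • (L t - G + f (t + τ / 2) i + (R₁ + R₂ + τ⁻¹ • B)) := by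
      have s1 : τ • R₁ = W i [] (t + τ) - W i [] t - τ • r (t + τ / 2) := by
        rw [hR₁, smul_smul, mul_inv_cancel₀ hτ.ne', one_smul]
      have s2 : τ • (τ⁻¹ • B) = B := by rw [smul_smul, mul_inv_cancel₀ hτ.ne', one_smul]
      rw [smul_add, smul_add, smul_add, smul_add τ R₁, s1, s2, hR₂, hGe]
      simp only [hr]
      module
    have := congrArg (fun z => sc z n) (hs.trans hvec)
    simp only [sc_sub, sc_smul, sc_add] at this
    rw [mul_sub, ← c1, ← c0, this, hLt, sc_add, sc_add, sc_smul τ⁻¹ B]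

lemma sum_sq_le_sq_sum {ι : Type*} (s : Finset ι) (f : ι → ℝ) (hf : ∀ i, 0 ≤ f i) :
    ∑ i ∈ s, f i ^ 2 ≤ (∑ i ∈ s, f i) ^ 2 := by
  simp_rw [pow_two, Finset.sum_mul]
  refine Finset.sum_le_sum fun i hi => mul_le_mul_of_nonneg_left ?_ (hf i)
  exact Finset.single_le_sum (fun j _ => hf j) hi

/-- The pressure as a function of time with values in the energy space. -/
lemma exists_J_path {d : ℕ} {T : ℝ} {p : ℝ → L2 d} (hp : PressureRegular T p) :
    ∃ (J : ℝ → L2 d) (C : ℝ), 0 ≤ C ∧ (∀ t ∈ Set.Icc 0 T, JRel (p t) (J t)) ∧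
      Lip T C J ∧ Inc T C J := by
  have key : ∀ l : List (Fin d), ∃ (W : ℝ → L2 d) (M : ℝ), 0 ≤ M ∧ (l.Nodup →
      (∀ t ∈ Set.Icc (0 : ℝ) T, HasWeakDeriv l (p t) (W t)) ∧ Lip T M W ∧ Inc T M W) := by
    intro l
    by_cases hl : l.Nodup
    · obtain ⟨g, hg, hm⟩ := hp.mixed l hl
      obtain ⟨M, hM, h1, h2⟩ := inc_of_memWInf_two hm
      exact ⟨g, M, hM, fun _ => ⟨hg, h1, h2⟩⟩
    · exact ⟨fun _ => 0, 0, le_rfl, fun h => absurd h hl⟩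
  choose W M hM h using key
  have hJ : ∀ t, ∃ x, t ∈ Set.Icc 0 T → JRel (p t) x := by
    intro t
    by_cases ht : t ∈ Set.Icc 0 T
    · obtain ⟨x, hx, -⟩ := exists_JRel_of_mixed (q := p t) (w := fun l => W l t)
        fun l hl => (h l hl).1 t ht
      exact ⟨x, fun _ => hx⟩
    · exact ⟨0, fun h => absurd h ht⟩
  choose J hJ using hJ
  have bound : ∀ {q x : L2 d} {w : List (Fin d) → L2 d} {ε : ℝ}, 0 ≤ ε → JRel q x →
      (∀ l : List (Fin d), l.Nodup → HasWeakDeriv l q (w l)) →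
      (∀ l : List (Fin d), l.Nodup → ‖w l‖ ≤ M l * ε) →
      ‖x‖ ≤ (∑ S : Finset (Fin d), M S.toList) * ε := by
    intro q x w ε hε hx hw hb
    obtain ⟨x', hx', hn⟩ := exists_JRel_of_mixed hw
    rw [hx.unique hx']
    refine (sq_le_sq₀ (norm_nonneg _) (mul_nonneg (Finset.sum_nonneg fun S _ => hM _) hε)).1 ?_
    rw [hn, Finset.sum_mul]
    refine (Finset.sum_le_sum fun S _ => ?_).trans (sum_sq_le_sq_sum Finset.univ
      (fun S : Finset (Fin d) => M S.toList * ε) fun S => mul_nonneg (hM _) hε)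
    exact pow_le_pow_left₀ (norm_nonneg _) (hb _ S.nodup_toList) 2
  refine ⟨J, ∑ S : Finset (Fin d), M S.toList, Finset.sum_nonneg fun S _ => hM _,
    fun t ht => hJ t ht, ?_, ?_⟩
  · intro a ha b hb
    refine bound (w := fun l => W l a - W l b) (abs_nonneg _) ((hJ a ha).sub (hJ b hb)) ?_ ?_
    · exact fun l hl => ((h l hl).1 a ha).sub ((h l hl).1 b hb)
    · exact fun l hl => (h l hl).2.1 a ha b hb
  · intro a b s hs h1 h2 h3 h4
    rw [mul_assoc]
    refine bound (w := fun l => (W l (a + s) - W l a) - (W l (b + s) - W l b))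
      (mul_nonneg hs (abs_nonneg _))
      (((hJ _ h2).sub (hJ _ h1)).sub ((hJ _ h4).sub (hJ _ h3))) ?_ ?_
    · exact fun l hl => (((h l hl).1 _ h2).sub ((h l hl).1 _ h1)).sub
        (((h l hl).1 _ h4).sub ((h l hl).1 _ h3))
    · intro l hl
      rw [← mul_assoc]
      exact (h l hl).2.2 a b s hs h1 h2 h3 h4

lemma exists_grad_path {d : ℕ} {T : ℝ} {p : ℝ → L2 d} (hp : PressureRegular T p) :
    ∃ (G : ℝ → Field d) (C : ℝ), 0 ≤ C ∧ (∀ t ∈ Set.Icc 0 T, HasGrad (p t) (G t)) ∧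
      ∀ i, Lip T C (fun t => G t i) := by
  choose G hG hm using fun i => hp.mixed [i] (List.nodup_singleton i)
  choose M hM hL _ using fun i => inc_of_memWInf_two (hm i)
  refine ⟨fun t i => G i t, ∑ i, M i, Finset.sum_nonneg fun i _ => hM i,
    fun t ht i => hG i t ht, fun i => ?_⟩
  exact (hL i).mono (Finset.single_le_sum (fun j _ => hM j) (Finset.mem_univ i))

/-! ### The energy estimate -/

/-- The squared `L²` norm of the curl, in terms of the gradient `g i j = ∂ᵢ vⱼ`. -/
def curlSq {d : ℕ} (g : Fin d → Fin d → L2 d) : ℝ :=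
  ∑ i, ∑ j ∈ Finset.univ.filter (fun j => i < j), ‖g i j - g j i‖ ^ 2

lemma curlSq_nonneg {d : ℕ} (g : Fin d → Fin d → L2 d) : 0 ≤ curlSq g :=
  Finset.sum_nonneg fun _ _ => Finset.sum_nonneg fun _ _ => sq_nonneg _

/-- The error equations of the scheme, with consistency errors controlled by `C`. The field `g` is
the gradient of the velocity error, `φ` the pressure increment (`0` for `k = 0`), `X` and `P` are
the images of `φ` and of the exact increment in the energy space, `ψ` is the pressure error. -/
structure ErrorSystem (d K : ℕ) (τ χ C : ℝ) where
  e : ℕ → Field d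
  g : ℕ → Fin d → Fin d → L2 d
  (φ X P N ν ψ ext : ℕ → L2 d)
  (Γ Ξ R : ℕ → Field d)
  e_zero : e 0 = 0
  φ_zero : φ 0 = 0
  reg : ∀ k ≤ K, ∀ i, Reg (e k i)
  zeroTrace : ∀ k ≤ K, ∀ i j, HasWeakDerivZeroTrace i (e k j) (g k i j)
  penalty : ∀ k ≤ K, ∀ n, cc (∑ i, g k i i) n = wt 1 n * cc (τ • φ k) n
  jrel_φ : ∀ k ≤ K, JRel (φ k) (X k)
  jrel_N : ∀ k, k + 1 < K → JRel (N (k + 1)) (ν (k + 1))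
  grad : ∀ k < K, HasGrad (ψ k) (Γ k)
  momentum : ∀ k < K, ∀ i n, wt (τ / 2) n * (sc (e (k + 1) i) n - sc (e k i) n) =
    τ * (-(Lam n * sc (e k i) n) - sc (Γ k i) n + sc (R k i) n)
  residual : ∀ k < K, ∀ i, ‖R k i‖ ≤ C * τ ^ 2
  ψ_incr : ∀ k, k + 1 < K → ψ (k + 1) - ψ k = N (k + 1) - (2 : ℝ) • φ (k + 1) + φ k
    - (χ / 2) • (∑ i, g (k + 1) i i + ∑ i, g k i i) + ext k
  grad_ext : ∀ k, k + 1 < K → HasGrad (ext k) (Ξ k)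
  Ξ_zero : ∀ i, ‖Ξ 0 i‖ ≤ C * τ
  Ξ_succ : ∀ k i, Ξ (k + 1) i = 0
  Γ_zero : ∀ i, ‖Γ 0 i‖ ≤ C * τ
  P_zero : ‖P 0‖ ≤ C * τ
  P_one : ‖P 1‖ ≤ C * τ
  P_incr : ∀ k < K, ‖P (k + 1) - P k‖ ≤ C * τ ^ 2
  ν_incr : ∀ k, k + 1 < K → ‖ν (k + 1) - ((2 : ℝ) • P (k + 1) - P k)‖ ≤ C * τ ^ 2

namespace ErrorSystem

variable {d K : ℕ} {τ χ C : ℝ} (s : ErrorSystem d K τ χ C)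

/-- The divergence of the error. -/
def D (k : ℕ) : L2 d := ∑ i, s.g k i i

/-- The error of the pressure increment in the energy space. -/
def Q (k : ℕ) : L2 d := s.P k - s.X k

/-- The discrete energy of the increment from step `k` to step `k + 1`. -/
def energy (k : ℕ) : ℝ :=
  ∑ i, qB (τ / 2) (s.e (k + 1) i - s.e k i) + τ ^ 2 * ‖s.Q (k + 1)‖ ^ 2
    + χ * τ * ‖s.D (k + 1)‖ ^ 2 - χ * τ / 2 * ‖s.D (k + 1) - s.D k‖ ^ 2

lemma D_zero (hK : 0 < K) : s.D 0 = 0 := by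
  have h : ∀ i, s.g 0 i i = 0 := by
    intro i
    have h1 := (s.zeroTrace 0 hK.le i i).hasWeakDeriv
    rw [s.e_zero] at h1
    refine h1.unique fun ψ _ _ _ => ?_
    have h0 := Lp.coeFn_zero ℝ 2 (volume.restrict (cube d))
    have e : ∀ F : (Fin d → ℝ) → ℝ, ∫ x in cube d, (0 : L2 d) x * F x = 0 := by
      intro F
      rw [integral_eq_zero_of_ae]
      filter_upwards [h0] with x hx
      rw [hx]; simp
    rw [Pi.zero_apply, e, e, mul_zero]
  simp [D, h]

lemma zeroTrace_sub {i : Fin d} {v g v' g' : L2 d} (h : HasWeakDerivZeroTrace i v g)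
    (h' : HasWeakDerivZeroTrace i v' g') : HasWeakDerivZeroTrace i (v - v') (g - g') := by
  rw [hasWeakDerivZeroTrace_iff] at *
  intro ψ hψ
  rw [inner_sub_left, inner_sub_left, h ψ hψ, h' ψ hψ]; ring

lemma sum_qL_eq {v : Field d} (hv : ∀ i, Reg (v i)) {g : Fin d → Fin d → L2 d}
    (hg : ∀ i j, HasWeakDerivZeroTrace i (v j) (g i j)) :
    ∑ j, qL (v j) = ‖∑ i, g i i‖ ^ 2 + curlSq g := by
  rw [curlSq, ← grad_eq_div_add_curl hg]
  exact Finset.sum_congr rfl fun j _ => qL_eq_sum (hv j) fun i => hg i j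

lemma D_sub (k l : ℕ) : s.D k - s.D l = ∑ i, (s.g k i i - s.g l i i) := by
  rw [D, D, ← Finset.sum_sub_distrib]

lemma le_sum_qB (hτ : 0 < τ) {k : ℕ} (hk : k < K) :
    ∑ i, ‖s.e (k + 1) i - s.e k i‖ ^ 2 + τ / 2 * (‖s.D (k + 1) - s.D k‖ ^ 2
      + curlSq fun i j => s.g (k + 1) i j - s.g k i j) ≤
    ∑ i, qB (τ / 2) (s.e (k + 1) i - s.e k i) := by
  have hr : ∀ i, Reg (s.e (k + 1) i - s.e k i) := fun i => (s.reg _ hk i).sub (s.reg _ hk.le i)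
  have h1 := sum_qL_eq (v := fun i => s.e (k + 1) i - s.e k i) hr
    (g := fun i j => s.g (k + 1) i j - s.g k i j)
    fun i j => zeroTrace_sub (s.zeroTrace _ hk i j) (s.zeroTrace _ hk.le i j)
  rw [D_sub, ← h1, Finset.mul_sum, ← Finset.sum_add_distrib]
  exact Finset.sum_le_sum fun i _ => norm_add_qL_le_qB (by positivity) (hr i)

/-- The negative term of the energy is absorbed by the divergence part of the gradient contained in
the form of B, because χ ≤ 1; the curl part is left over. -/
lemma le_energy (hτ : 0 < τ) (hχ₁ : χ ≤ 1) {k : ℕ} (hk : k < K) :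
    ∑ i, ‖s.e (k + 1) i - s.e k i‖ ^ 2 + τ / 2 * (curlSq fun i j => s.g (k + 1) i j - s.g k i j)
      + τ ^ 2 * ‖s.Q (k + 1)‖ ^ 2 + χ * τ * ‖s.D (k + 1)‖ ^ 2 ≤ s.energy k := by
  have h := s.le_sum_qB hτ hk
  have : χ * τ / 2 * ‖s.D (k + 1) - s.D k‖ ^ 2 ≤ τ / 2 * ‖s.D (k + 1) - s.D k‖ ^ 2 := by
    gcongr; nlinarith
  rw [energy]
  nlinarith

/-- The discrete `L²` norm squared controls the pressure increment in the energy space. -/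
lemma norm_X_second_diff (hτ : 0 < τ) {k : ℕ} (hk : k + 1 < K) :
    τ ^ 2 * ‖s.X (k + 2) - (2 : ℝ) • s.X (k + 1) + s.X k‖ ^ 2 ≤
      ∑ i, ‖(s.e (k + 2) i - s.e (k + 1) i) - (s.e (k + 1) i - s.e k i)‖ ^ 2 := by
  have hz := fun i => zeroTrace_sub
    (zeroTrace_sub (s.zeroTrace (k + 2) hk i i) (s.zeroTrace (k + 1) hk.le i i))
    (zeroTrace_sub (s.zeroTrace (k + 1) hk.le i i) (s.zeroTrace k (by omega) i i))
  have hx := (((s.jrel_φ (k + 2) hk).sub ((s.jrel_φ (k + 1) hk.le).smul 2)).add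
    (s.jrel_φ k (by omega))).smul τ
  have := norm_J_sq_le hz hx (fun n => by
    have h2 := s.penalty (k + 2) hk n
    have h1 := s.penalty (k + 1) hk.le n
    have h0 := s.penalty k (by omega) n
    simp only [Finset.sum_sub_distrib, cc_sub, cc_add, cc_smul] at *
    rw [h2, h1, h0]; ring)
  rwa [norm_smul, mul_pow, Real.norm_of_nonneg hτ.le] at this

lemma norm_X_one (hτ : 0 < τ) (hK : 0 < K) :
    τ ^ 2 * ‖s.X 1‖ ^ 2 ≤ ∑ i, ‖s.e 1 i‖ ^ 2 := by
  have := norm_J_sq_le (fun i => s.zeroTrace 1 hK i i) ((s.jrel_φ 1 hK).smul τ) (s.penalty 1 hK)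
  rwa [norm_smul, mul_pow, Real.norm_of_nonneg hτ.le] at this

/-- The tested error equation. -/
lemma energy_identity (hτ : 0 < τ) {k : ℕ} (hk : k + 1 < K) :
    ∑ i, qB (τ / 2) (s.e (k + 2) i - s.e (k + 1) i) - ∑ i, qB (τ / 2) (s.e (k + 1) i - s.e k i)
      + ∑ i, ‖(s.e (k + 2) i - s.e (k + 1) i) - (s.e (k + 1) i - s.e k i)‖ ^ 2
      + τ / 2 * (‖s.D (k + 2) - s.D k‖ ^ 2 + curlSq fun i j => s.g (k + 2) i j - s.g k i j) ≤
    2 * τ * ∑ i, inner ℝ (s.R (k + 1) i - s.R k i - s.Ξ k i) (s.e (k + 2) i - s.e (k + 1) i)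
      + 2 * τ ^ 2 * inner ℝ (s.ν (k + 1) - (2 : ℝ) • s.X (k + 1) + s.X k) (s.X (k + 2) - s.X (k + 1))
      - χ * τ * inner ℝ (s.D (k + 1) + s.D k) (s.D (k + 2) - s.D (k + 1)) := by
  have hr2 := fun i => (s.reg (k + 2) hk i).sub (s.reg (k + 1) hk.le i)
  have hr1 := fun i => (s.reg (k + 1) hk.le i).sub (s.reg k (by omega) i)
  have hzt := fun i => zeroTrace_sub (s.zeroTrace (k + 2) hk i i) (s.zeroTrace (k + 1) hk.le i i)
  have hc : ∀ i, qB (τ / 2) (s.e (k + 2) i - s.e (k + 1) i) - qB (τ / 2) (s.e (k + 1) i - s.e k i)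
      + ‖(s.e (k + 2) i - s.e (k + 1) i) - (s.e (k + 1) i - s.e k i)‖ ^ 2
      + τ / 2 * qL (s.e (k + 2) i - s.e k i) ≤
      2 * τ * inner ℝ (s.R (k + 1) i - s.R k i - (s.Γ (k + 1) i - s.Γ k i))
        (s.e (k + 2) i - s.e (k + 1) i) := by
    intro i
    have := energy_component (z := τ • (s.R (k + 1) i - s.R k i - (s.Γ (k + 1) i - s.Γ k i)))
      hτ (hr2 i) (hr1 i) (fun n => by
        have h1 := s.momentum (k + 1) hk i n
        have h0 := s.momentum k (by omega) i n
        simp only [sc_smul, sc_sub]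
        linear_combination h0 - h1)
    rw [real_inner_smul_left, show s.e (k + 2) i - s.e (k + 1) i + (s.e (k + 1) i - s.e k i) =
      s.e (k + 2) i - s.e k i by abel] at this
    linarith
  have hsum := Finset.sum_le_sum fun i (_ : i ∈ Finset.univ) => hc i
  simp only [Finset.sum_add_distrib, Finset.sum_sub_distrib, ← Finset.mul_sum] at hsum
  have hq := sum_qL_eq (v := fun i => s.e (k + 2) i - s.e k i)
    (fun i => (s.reg (k + 2) hk i).sub (s.reg k (by omega) i))
    (g := fun i j => s.g (k + 2) i j - s.g k i j)
    fun i j => zeroTrace_sub (s.zeroTrace (k + 2) hk i j) (s.zeroTrace k (by omega) i j)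
  rw [hq, ← D_sub] at hsum
  -- the pressure term
  set θ : L2 d := s.N (k + 1) - (2 : ℝ) • s.φ (k + 1) + s.φ k
    - (χ / 2) • (s.D (k + 1) + s.D k) with hθ
  have hψ : s.ψ (k + 1) - s.ψ k = θ + s.ext k := s.ψ_incr k hk
  have hgθ : ∀ i, HasWeakDeriv [i] θ (s.Γ (k + 1) i - s.Γ k i - s.Ξ k i) := by
    intro i
    have := ((s.grad (k + 1) hk i).sub (s.grad k (by omega) i)).sub (s.grad_ext k hk i)
    rwa [hψ, add_sub_cancel_right] at this
  have hibp : ∑ i, inner ℝ (s.Γ (k + 1) i - s.Γ k i - s.Ξ k i) (s.e (k + 2) i - s.e (k + 1) i) =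
      - inner ℝ θ (s.D (k + 2) - s.D (k + 1)) := by
    rw [D_sub, inner_sum, ← Finset.sum_neg_distrib]
    exact Finset.sum_congr rfl fun i _ => inner_grad_eq_neg (hgθ i) (hzt i)
  have hJ : inner ℝ (s.N (k + 1) - (2 : ℝ) • s.φ (k + 1) + s.φ k) (s.D (k + 2) - s.D (k + 1)) =
      τ * inner ℝ (s.ν (k + 1) - (2 : ℝ) • s.X (k + 1) + s.X k) (s.X (k + 2) - s.X (k + 1)) := by
    rw [← real_inner_smul_right]
    refine inner_eq_inner_J (((s.jrel_N k hk).sub ((s.jrel_φ (k + 1) hk.le).smul 2)).add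
      (s.jrel_φ k (by omega))) (((s.jrel_φ (k + 2) hk).sub (s.jrel_φ (k + 1) hk.le)).smul τ) ?_
    intro n
    have h2 : cc (s.D (k + 2)) n = _ := s.penalty (k + 2) hk n
    have h1 : cc (s.D (k + 1)) n = _ := s.penalty (k + 1) hk.le n
    simp only [cc_sub, cc_smul] at *
    rw [h2, h1]; ring
  have hθD : inner ℝ θ (s.D (k + 2) - s.D (k + 1)) =
      τ * inner ℝ (s.ν (k + 1) - (2 : ℝ) • s.X (k + 1) + s.X k) (s.X (k + 2) - s.X (k + 1))
      - χ / 2 * inner ℝ (s.D (k + 1) + s.D k) (s.D (k + 2) - s.D (k + 1)) := by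
    rw [hθ, inner_sub_left, hJ, real_inner_smul_left]
  have hsplit : ∑ i, inner ℝ (s.R (k + 1) i - s.R k i - (s.Γ (k + 1) i - s.Γ k i))
        (s.e (k + 2) i - s.e (k + 1) i) =
      ∑ i, inner ℝ (s.R (k + 1) i - s.R k i - s.Ξ k i) (s.e (k + 2) i - s.e (k + 1) i)
      - ∑ i, inner ℝ (s.Γ (k + 1) i - s.Γ k i - s.Ξ k i) (s.e (k + 2) i - s.e (k + 1) i) := by
    rw [← Finset.sum_sub_distrib]
    refine Finset.sum_congr rfl fun i _ => ?_
    rw [← inner_sub_left]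
    congr 1
    abel
  rw [hsplit, hibp, hθD] at hsum
  linarith

end ErrorSystem

/-! ### Telescoping identities for the penalty and for the extrapolated pressure. -/

section Hilbert

variable {H : Type*} [NormedAddCommGroup H] [InnerProductSpace ℝ H]

/-- The penalty is explicit, so the average and the increment belong to adjacent steps. Two
differences telescope, and only the square over two steps has the wrong sign. -/
lemma penalty_identity (D₀ D₁ D₂ : H) : 2 * inner ℝ (D₁ + D₀) (D₂ - D₁) =
    2 * (‖D₂‖ ^ 2 - ‖D₁‖ ^ 2) - ‖D₂ - D₀‖ ^ 2 - (‖D₂ - D₁‖ ^ 2 - ‖D₁ - D₀‖ ^ 2) := by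
  simp only [norm_sub_sq_real, inner_add_left, inner_sub_right, real_inner_self_eq_norm_sq]
  rw [real_inner_comm D₂ D₀, real_inner_comm D₂ D₁, real_inner_comm D₁ D₀]
  ring

/-- Linear extrapolation differs from Q₂ by a second difference, whose square is the only price paid
for treating the pressure explicitly. -/
lemma extrapolation_identity (Q₀ Q₁ Q₂ : H) : 2 * inner ℝ ((2 : ℝ) • Q₁ - Q₀) (Q₂ - Q₁) =
    ‖Q₂‖ ^ 2 - ‖Q₁‖ ^ 2 + ‖Q₁ - Q₀‖ ^ 2 - ‖Q₂ - (2 : ℝ) • Q₁ + Q₀‖ ^ 2 := by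
  have : Q₂ - (2 : ℝ) • Q₁ + Q₀ = (Q₂ - Q₁) - (Q₁ - Q₀) := by rw [two_smul]; abel
  rw [this, norm_sub_sq_real (Q₂ - Q₁)]
  simp only [norm_sub_sq_real, inner_sub_left, inner_sub_right, real_inner_smul_left,
    real_inner_self_eq_norm_sq]
  rw [real_inner_comm Q₂ Q₀, real_inner_comm Q₂ Q₁, real_inner_comm Q₁ Q₀]
  ring

/-- The extrapolated pressure term, up to consistency errors of size `ε`. -/
lemma pressure_term_le {ε S τ A : ℝ} (hε : 0 ≤ ε) (hτ : 0 < τ)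
    (X₀ X₁ X₂ P₀ P₁ P₂ ν : H)
    (hP₁ : ‖P₁ - P₀‖ ≤ ε) (hP₂ : ‖P₂ - P₁‖ ≤ ε) (hν : ‖ν - ((2 : ℝ) • P₁ - P₀)‖ ≤ ε)
    (hS₀ : τ * ‖P₀ - X₀‖ ≤ S) (hS₁ : τ * ‖P₁ - X₁‖ ≤ S) (hS₂ : τ * ‖P₂ - X₂‖ ≤ S)
    (hX : τ * ‖X₂ - (2 : ℝ) • X₁ + X₀‖ ≤ A) :
    2 * τ ^ 2 * inner ℝ (ν - (2 : ℝ) • X₁ + X₀) (X₂ - X₁) ≤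
      τ ^ 2 * ‖P₁ - X₁‖ ^ 2 - τ ^ 2 * ‖P₂ - X₂‖ ^ 2 + A ^ 2 + 4 * τ * ε * A + 10 * τ * ε * S
        + 6 * τ ^ 2 * ε ^ 2 := by
  set Q₀ := P₀ - X₀ with hQ₀
  set Q₁ := P₁ - X₁ with hQ₁
  set Q₂ := P₂ - X₂ with hQ₂
  set ρ₁ := ν - ((2 : ℝ) • P₁ - P₀) with hρ₁
  set ρ₂ := P₂ - P₁ with hρ₂
  have e1 : ν - (2 : ℝ) • X₁ + X₀ = ρ₁ + ((2 : ℝ) • Q₁ - Q₀) := by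
    rw [hρ₁, hQ₁, hQ₀, smul_sub]; abel
  have e2 : X₂ - X₁ = ρ₂ - (Q₂ - Q₁) := by rw [hρ₂, hQ₁, hQ₂]; abel
  have e3 : inner ℝ (ν - (2 : ℝ) • X₁ + X₀) (X₂ - X₁) =
      inner ℝ ρ₁ ρ₂ - inner ℝ ρ₁ (Q₂ - Q₁) + inner ℝ ((2 : ℝ) • Q₁ - Q₀) ρ₂
        - inner ℝ ((2 : ℝ) • Q₁ - Q₀) (Q₂ - Q₁) := by
    rw [e1, e2, inner_add_left, inner_sub_right ρ₁ ρ₂ (Q₂ - Q₁),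
      inner_sub_right _ ρ₂ (Q₂ - Q₁)]
    ring
  have id := extrapolation_identity Q₀ Q₁ Q₂
  have b1 : inner ℝ ρ₁ ρ₂ ≤ ε * ε :=
    (real_inner_le_norm _ _).trans (mul_le_mul hν hP₂ (norm_nonneg _) hε)
  have b2 : - inner ℝ ρ₁ (Q₂ - Q₁) ≤ ε * (‖Q₂‖ + ‖Q₁‖) := by
    refine (neg_le_abs _).trans ((abs_real_inner_le_norm _ _).trans ?_)
    exact mul_le_mul hν (norm_sub_le _ _) (norm_nonneg _) hε
  have b3 : inner ℝ ((2 : ℝ) • Q₁ - Q₀) ρ₂ ≤ (2 * ‖Q₁‖ + ‖Q₀‖) * ε := by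
    refine (real_inner_le_norm _ _).trans (mul_le_mul ?_ hP₂ (norm_nonneg _) (by positivity))
    refine (norm_sub_le _ _).trans ?_
    rw [norm_smul]; norm_num
  -- Second differences of Q and of X differ by that of the exact increments P, at most 2ε.
  have b4 : τ * ‖Q₂ - (2 : ℝ) • Q₁ + Q₀‖ ≤ A + τ * (2 * ε) := by
    have : Q₂ - (2 : ℝ) • Q₁ + Q₀ =
        ((P₂ - P₁) - (P₁ - P₀)) - (X₂ - (2 : ℝ) • X₁ + X₀) := by
      rw [hQ₀, hQ₁, hQ₂, smul_sub, two_smul]; abel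
    have h1 : ‖Q₂ - (2 : ℝ) • Q₁ + Q₀‖ ≤ (ε + ε) + ‖X₂ - (2 : ℝ) • X₁ + X₀‖ := by
      rw [this]
      exact (norm_sub_le _ _).trans (add_le_add_left ((norm_sub_le _ _).trans
        (add_le_add hP₂ hP₁)) _)
    nlinarith
  have b5 : τ ^ 2 * ‖Q₂ - (2 : ℝ) • Q₁ + Q₀‖ ^ 2 ≤ (A + τ * (2 * ε)) ^ 2 := by
    rw [← mul_pow]
    exact pow_le_pow_left₀ (by positivity) b4 2
  have b6 : 0 ≤ τ ^ 2 * ‖Q₁ - Q₀‖ ^ 2 := by positivity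
  have b7 : τ * (τ * ‖Q₂‖) * ε ≤ τ * S * ε := by gcongr
  have b8 : τ * (τ * ‖Q₁‖) * ε ≤ τ * S * ε := by gcongr
  have b9 : τ * (τ * ‖Q₀‖) * ε ≤ τ * S * ε := by gcongr
  have hτ2 : 0 < τ ^ 2 := by positivity
  rw [e3]
  have id' := congrArg (fun z => τ ^ 2 * z) id
  have m1 := mul_le_mul_of_nonneg_left b1 hτ2.le
  have m2 := mul_le_mul_of_nonneg_left b2 hτ2.le
  have m3 := mul_le_mul_of_nonneg_left b3 hτ2.le
  linarith

end Hilbert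

/-! ### One step of the discrete energy inequality, and the initial energy. -/

namespace ErrorSystem

variable {d K : ℕ} {τ χ C : ℝ} (s : ErrorSystem d K τ χ C)

lemma sum_inner_le {v w : Field d} {a b : ℝ} (hb : 0 ≤ b) (hv : ∀ i, ‖v i‖ ≤ a)
    (hw : ∑ i, ‖w i‖ ^ 2 ≤ b ^ 2) : ∑ i, inner ℝ (v i) (w i) ≤ d * (a * b) := by
  have : ∀ i ∈ Finset.univ, inner ℝ (v i) (w i) ≤ a * b := by
    intro i _
    have hwi : ‖w i‖ ≤ b := by
      refine (sq_le_sq₀ (norm_nonneg _) hb).1 (le_trans ?_ hw)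
      exact Finset.single_le_sum (f := fun i => ‖w i‖ ^ 2) (fun j _ => sq_nonneg _)
        (Finset.mem_univ i)
    exact (real_inner_le_norm _ _).trans
      (mul_le_mul (hv i) hwi (norm_nonneg _) ((norm_nonneg _).trans (hv i)))
  have := Finset.sum_le_card_nsmul Finset.univ _ _ this
  simpa using this

/-- The term `A²` from the pressure cancels the dissipation ‖δ²e‖², and the penalty term is absorbed
by the divergence. Errors linear in the unknowns are bounded through the common bound `S`. The
constant 18 is 10 from the pressure plus 8 from 4A ≤ 8S; the term for k = 0 comes from `Ξ`, which is
only of first order. -/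
lemma energy_step (hτ : 0 < τ) (hC : 0 ≤ C) (hχ₀ : 0 < χ) (hχ₁ : χ ≤ 1) {S : ℝ} (hS : 0 ≤ S)
    (hE : ∀ k < K, s.energy k ≤ S ^ 2) (hQ : τ * ‖s.Q 0‖ ≤ S) {k : ℕ} (hk : k + 1 < K) :
    s.energy (k + 1) + τ / 2 * (curlSq fun i j => s.g (k + 2) i j - s.g k i j) ≤
      s.energy k + (4 * d * C + 18 * C) * τ ^ 3 * S + 6 * C ^ 2 * τ ^ 6
        + if k = 0 then 2 * d * C * τ ^ 2 * S else 0 := by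
  have low : ∀ j < K, ∑ i, ‖s.e (j + 1) i - s.e j i‖ ^ 2 ≤ S ^ 2 ∧ τ * ‖s.Q (j + 1)‖ ≤ S := by
    intro j hj
    have h1 := s.le_energy hτ hχ₁ hj
    have h2 := hE j hj
    have c1 : 0 ≤ τ / 2 * (curlSq fun i l => s.g (j + 1) i l - s.g j i l) :=
      mul_nonneg (by positivity) (curlSq_nonneg _)
    have c2 : 0 ≤ χ * τ * ‖s.D (j + 1)‖ ^ 2 := by positivity
    have c3 : 0 ≤ ∑ i, ‖s.e (j + 1) i - s.e j i‖ ^ 2 := Finset.sum_nonneg fun _ _ => sq_nonneg _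
    have c4 : 0 ≤ τ ^ 2 * ‖s.Q (j + 1)‖ ^ 2 := by positivity
    refine ⟨by linarith, (sq_le_sq₀ (by positivity) hS).1 ?_⟩
    rw [mul_pow]; linarith
  have hQall : ∀ j ≤ K, τ * ‖s.Q j‖ ≤ S := by
    intro j hj
    cases j with
    | zero => exact hQ
    | succ j => exact (low j hj).2
  set Asq := ∑ i, ‖(s.e (k + 2) i - s.e (k + 1) i) - (s.e (k + 1) i - s.e k i)‖ ^ 2 with hAsq
  have hAsq0 : 0 ≤ Asq := Finset.sum_nonneg fun _ _ => sq_nonneg _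
  set A := √Asq with hA
  have hAA : A ^ 2 = Asq := Real.sq_sqrt hAsq0
  have hA0 : 0 ≤ A := Real.sqrt_nonneg _
  have hA2 : A ≤ 2 * S := by
    refine (sq_le_sq₀ hA0 (by positivity)).1 ?_
    rw [hAA]
    have h1 := (low (k + 1) hk).1
    have h2 := (low k (by omega)).1
    have : Asq ≤ ∑ i, (2 * ‖s.e (k + 1 + 1) i - s.e (k + 1) i‖ ^ 2
        + 2 * ‖s.e (k + 1) i - s.e k i‖ ^ 2) := by
      refine Finset.sum_le_sum fun i _ => ?_
      have := norm_sub_le (s.e (k + 2) i - s.e (k + 1) i) (s.e (k + 1) i - s.e k i)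
      have h3 := pow_le_pow_left₀ (norm_nonneg _) this 2
      nlinarith [sq_nonneg (‖s.e (k + 2) i - s.e (k + 1) i‖ - ‖s.e (k + 1) i - s.e k i‖)]
    rw [Finset.sum_add_distrib, ← Finset.mul_sum, ← Finset.mul_sum] at this
    nlinarith
  have hid := s.energy_identity hτ hk
  have hX : τ * ‖s.X (k + 2) - (2 : ℝ) • s.X (k + 1) + s.X k‖ ≤ A := by
    refine (sq_le_sq₀ (by positivity) hA0).1 ?_
    rw [hAA, mul_pow]
    exact s.norm_X_second_diff hτ hk
  have hP := pressure_term_le (ε := C * τ ^ 2) (S := S) (by positivity) hτ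
    (s.X k) (s.X (k + 1)) (s.X (k + 2)) (s.P k) (s.P (k + 1)) (s.P (k + 2)) (s.ν (k + 1))
    (s.P_incr k (by omega)) (s.P_incr (k + 1) hk) (s.ν_incr k hk)
    (hQall k (by omega)) (hQall (k + 1) hk.le) (hQall (k + 2) hk) hX
  have hD := penalty_identity (s.D k) (s.D (k + 1)) (s.D (k + 2))
  have hres : ∑ i, inner ℝ (s.R (k + 1) i - s.R k i - s.Ξ k i) (s.e (k + 2) i - s.e (k + 1) i) ≤
      d * ((2 * (C * τ ^ 2) + if k = 0 then C * τ else 0) * S) := by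
    refine sum_inner_le (v := fun i => s.R (k + 1) i - s.R k i - s.Ξ k i)
      (w := fun i => s.e (k + 2) i - s.e (k + 1) i) hS (fun i => ?_) (low (k + 1) hk).1
    have h1 := s.residual (k + 1) hk i
    have h0 := s.residual k (by omega) i
    have h2 : ‖s.Ξ k i‖ ≤ if k = 0 then C * τ else 0 := by
      cases k with
      | zero => simpa using s.Ξ_zero i
      | succ k => simp [s.Ξ_succ k i]
    refine (norm_sub_le _ _).trans (add_le_add ((norm_sub_le _ _).trans ?_) h2)
    linarith
  have hdiv : χ * τ / 2 * ‖s.D (k + 2) - s.D k‖ ^ 2 ≤ τ / 2 * ‖s.D (k + 2) - s.D k‖ ^ 2 := by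
    gcongr; nlinarith
  have m1 := mul_le_mul_of_nonneg_left hres (by positivity : 0 ≤ 2 * τ)
  have m2 : 4 * τ * (C * τ ^ 2) * A ≤ 4 * τ * (C * τ ^ 2) * (2 * S) := by gcongr
  have m3 : 2 * τ * (d * ((2 * (C * τ ^ 2) + if k = 0 then C * τ else 0) * S)) =
      4 * d * C * τ ^ 3 * S + if k = 0 then 2 * d * C * τ ^ 2 * S else 0 := by
    split_ifs <;> ring
  have hD' := congrArg (fun z => χ * τ / 2 * z) hD
  simp only [energy]
  unfold Q
  rw [show k + 1 + 1 = k + 2 from rfl]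
  rw [hAA] at hP
  linarith

/-- As e⁰ = 0, the first equation is B e¹ = τ (R - Γ). A first-order initial pressure error
therefore costs only τ² in e¹, the same order as the final bound. -/
lemma energy_zero_le (hτ : 0 < τ) (hC : 0 ≤ C) (hχ₁ : χ ≤ 1) (hK : 0 < K) {T : ℝ}
    (hT : τ ≤ T) : s.energy 0 ≤ (4 * d * (C + C * T) ^ 2 + 2 * C ^ 2) * τ ^ 4 := by
  set C' := C + C * T with hC'
  have hTpos : 0 < T := hτ.trans_le hT
  have hC0 : 0 ≤ C' := by positivity
  have hcomp : ∀ i, ‖s.e 1 i‖ ^ 2 ≤ qB (τ / 2) (s.e 1 i) ∧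
      qB (τ / 2) (s.e 1 i) ≤ (C' * τ ^ 2) ^ 2 := by
    intro i
    have hr := s.reg 1 hK i
    have hτ2 : 0 < τ / 2 := by positivity
    have hm : ∀ n, sc (τ • (s.R 0 i - s.Γ 0 i)) n = wt (τ / 2) n * sc (s.e 1 i) n := by
      intro n
      have := s.momentum 0 hK i n
      simp only [s.e_zero, Pi.zero_apply, sc_zero, zero_add] at this
      rw [sc_smul, sc_sub]
      linarith
    have h1 := (hasSum_qB hm).2
    have h2 := norm_add_qL_le_qB hτ2 hr
    have h3 : 0 ≤ qL (s.e 1 i) := tsum_nonneg fun n => mul_nonneg (Lam_nonneg n) (sq_nonneg _)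
    have h4 : ‖s.e 1 i‖ ^ 2 ≤ qB (τ / 2) (s.e 1 i) := by nlinarith
    have h5 : ‖τ • (s.R 0 i - s.Γ 0 i)‖ ≤ C' * τ ^ 2 := by
      rw [norm_smul, Real.norm_of_nonneg hτ.le]
      have a := norm_sub_le (s.R 0 i) (s.Γ 0 i)
      have b := s.residual 0 hK i
      have c := s.Γ_zero i
      have e : C * τ ^ 2 ≤ C * T * τ := by rw [pow_two]; nlinarith [mul_le_mul_of_nonneg_left hT hC]
      have : ‖s.R 0 i - s.Γ 0 i‖ ≤ C' * τ := by rw [hC']; linarith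
      nlinarith
    have h6 := real_inner_le_norm (τ • (s.R 0 i - s.Γ 0 i)) (s.e 1 i)
    rw [← h1] at h6
    refine ⟨h4, ?_⟩
    have h7 : qB (τ / 2) (s.e 1 i) ≤ C' * τ ^ 2 * ‖s.e 1 i‖ :=
      h6.trans (mul_le_mul_of_nonneg_right h5 (norm_nonneg _))
    nlinarith [sq_nonneg (C' * τ ^ 2 - ‖s.e 1 i‖)]
  have hsum : ∑ i, qB (τ / 2) (s.e 1 i) ≤ d * (C' * τ ^ 2) ^ 2 := by
    have := Finset.sum_le_card_nsmul Finset.univ (fun i => qB (τ / 2) (s.e 1 i)) _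
      fun i _ => (hcomp i).2
    simpa using this
  have hn : ∑ i, ‖s.e 1 i‖ ^ 2 ≤ d * (C' * τ ^ 2) ^ 2 :=
    (Finset.sum_le_sum fun i _ => (hcomp i).1).trans hsum
  have hX := s.norm_X_one hτ hK
  have hQ : τ ^ 2 * ‖s.Q 1‖ ^ 2 ≤ 2 * (C * τ ^ 2) ^ 2 + 2 * (d * (C' * τ ^ 2) ^ 2) := by
    have h1 : ‖s.Q 1‖ ≤ C * τ + ‖s.X 1‖ :=
      (norm_sub_le _ _).trans (add_le_add_left s.P_one _)
    have h2 := pow_le_pow_left₀ (norm_nonneg _) h1 2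
    have h3 : ‖s.Q 1‖ ^ 2 ≤ 2 * (C * τ) ^ 2 + 2 * ‖s.X 1‖ ^ 2 := by
      nlinarith [sq_nonneg (C * τ - ‖s.X 1‖)]
    have := mul_le_mul_of_nonneg_left h3 (sq_nonneg τ)
    nlinarith
  have hq := s.le_sum_qB hτ hK
  have hD0 := s.D_zero hK
  have hc := curlSq_nonneg fun i j => s.g (0 + 1) i j - s.g 0 i j
  have hn0 : 0 ≤ ∑ i, ‖s.e (0 + 1) i - s.e 0 i‖ ^ 2 := Finset.sum_nonneg fun _ _ => sq_nonneg _
  simp only [energy]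
  simp only [zero_add, s.e_zero, Pi.zero_apply, sub_zero, hD0] at hq hn0 hc ⊢
  have hDle : τ / 2 * ‖s.D 1‖ ^ 2 ≤ ∑ i, qB (τ / 2) (s.e 1 i) := by nlinarith
  have : χ * τ / 2 * ‖s.D 1‖ ^ 2 ≤ τ / 2 * ‖s.D 1‖ ^ 2 := by gcongr; nlinarith
  have e1 : (C' * τ ^ 2) ^ 2 = C' ^ 2 * τ ^ 4 := by ring
  have e2 : (C * τ ^ 2) ^ 2 = C ^ 2 * τ ^ 4 := by ring
  rw [e1] at hsum hQ
  rw [e2] at hQ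
  nlinarith

end ErrorSystem

/-- A recursion for energies whose increments are controlled by the largest energy. -/
lemma energy_recursion {K : ℕ} (hK : 0 < K) {τ T α β γ κ Q : ℝ} (hτ : 0 < τ) (hT : τ ≤ T)
    (hKT : K * τ ≤ T) (hα : 0 ≤ α) (hβ : 0 ≤ β) (hγ : 0 ≤ γ) {E F : ℕ → ℝ}
    (hE : ∀ k < K, 0 ≤ E k) (hF : ∀ k, 0 ≤ F k) (hQ0 : 0 ≤ Q)
    (step : ∀ S, 0 ≤ S → (∀ k < K, E k ≤ S ^ 2) → Q ≤ S → ∀ k, k + 1 < K →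
      E (k + 1) + F k ≤ E k + α * τ ^ 3 * S + β * τ ^ 6 + if k = 0 then γ * τ ^ 2 * S else 0)
    (h0 : E 0 ≤ κ * τ ^ 4) (hQ : Q ^ 2 ≤ κ * τ ^ 4) :
    (∀ k < K, E k + ∑ j ∈ Finset.range k, F j ≤
      (3 * (κ + β * T ^ 2) + 2 * (α * T + γ) ^ 2) * τ ^ 4) := by
  obtain ⟨m, hm, hmax⟩ := Finset.exists_max_image (Finset.range K) E ⟨0, Finset.mem_range.2 hK⟩
  have hmK := Finset.mem_range.1 hm
  -- The initial quantity `Q` belongs to no energy, so it enters the maximum separately.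
  set M := max (E m) (Q ^ 2) with hM
  have hM0 : 0 ≤ M := (hE m hmK).trans (le_max_left _ _)
  set S := √M with hS
  have hSS : S ^ 2 = M := Real.sq_sqrt hM0
  have hS0 : 0 ≤ S := Real.sqrt_nonneg _
  have hle : ∀ k < K, E k ≤ S ^ 2 := fun k hk => by
    rw [hSS]; exact (hmax k (Finset.mem_range.2 hk)).trans (le_max_left _ _)
  have hQS : Q ≤ S := by
    refine (sq_le_sq₀ hQ0 hS0).1 ?_
    rw [hSS]; exact le_max_right _ _
  have hst := step S hS0 hle hQS
  have hTpos : 0 < T := hτ.trans_le hT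
  have ind : ∀ k < K, E k + ∑ j ∈ Finset.range k, F j ≤
      E 0 + k * (α * τ ^ 3 * S + β * τ ^ 6) + γ * τ ^ 2 * S := by
    intro k
    induction k with
    | zero => intro _; simp; positivity
    | succ k ih =>
      intro hk
      rw [Finset.sum_range_succ]
      have h1 := hst k hk
      rcases Nat.eq_zero_or_pos k with h | h
      · subst h
        simp at h1 ⊢
        linarith
      · rw [if_neg h.ne'] at h1
        have := ih (by omega)
        push_cast
        linarith
  have bound : ∀ k < K, E k + ∑ j ∈ Finset.range k, F j ≤
      (κ + β * T ^ 2) * τ ^ 4 + (α * T + γ) * τ ^ 2 * S := by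
    intro k hk
    have hkT : (k : ℝ) * τ ≤ T := by
      refine le_trans ?_ hKT
      gcongr
    have a1 : k * (α * τ ^ 3 * S) ≤ α * T * τ ^ 2 * S := by
      have := mul_le_mul_of_nonneg_right hkT (by positivity : 0 ≤ α * τ ^ 2 * S)
      linarith
    have a2 : k * (β * τ ^ 6) ≤ β * T ^ 2 * τ ^ 4 := by
      have h1 := mul_le_mul_of_nonneg_right hkT (by positivity : 0 ≤ β * τ ^ 5)
      have h2 : τ ^ 5 ≤ T * τ ^ 4 := by
        have := mul_le_mul_of_nonneg_right hT (by positivity : 0 ≤ τ ^ 4)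
        linarith
      have h3 : T * (β * τ ^ 5) ≤ T * (β * (T * τ ^ 4)) := by gcongr
      linarith
    have := ind k hk
    linarith
  -- The bound at the maximizing step is a quadratic inequality for `S`; Young's inequality solves
  -- it with no exponential growth.
  have hSb : S ^ 2 ≤ (κ + β * T ^ 2) * τ ^ 4 + (α * T + γ) * τ ^ 2 * S := by
    rw [hSS]
    refine max_le ?_ ?_
    · have := bound m hmK
      have h2 : 0 ≤ ∑ j ∈ Finset.range m, F j := Finset.sum_nonneg fun j _ => hF j
      linarith
    · refine hQ.trans ?_
      have h1 : 0 ≤ (α * T + γ) * τ ^ 2 * S := by positivity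
      have h2 : 0 ≤ β * T ^ 2 * τ ^ 4 := by positivity
      linarith
  set a := (α * T + γ) * τ ^ 2 with ha
  have hS2 : S ^ 2 ≤ 2 * ((κ + β * T ^ 2) * τ ^ 4) + a ^ 2 := by
    nlinarith [sq_nonneg (a - S)]
  intro k hk
  refine (bound k hk).trans ?_
  have : a ^ 2 = (α * T + γ) ^ 2 * τ ^ 4 := by rw [ha]; ring
  nlinarith [sq_nonneg (a - S)]

/-- The constant of the energy estimate. -/
def energyConst (d : ℕ) (C T : ℝ) : ℝ :=
  3 * ((4 * d * (C + C * T) ^ 2 + 2 * C ^ 2) + 6 * C ^ 2 * T ^ 2)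
    + 2 * ((4 * d * C + 18 * C) * T + 2 * d * C) ^ 2

lemma ErrorSystem.energy_le {d K : ℕ} {τ χ C T : ℝ} (s : ErrorSystem d K τ χ C) (hτ : 0 < τ)
    (hC : 0 ≤ C) (hχ₀ : 0 < χ) (hχ₁ : χ ≤ 1) (hK : 0 < K) (hT : τ ≤ T) (hKT : K * τ ≤ T) {k : ℕ}
    (hk : k < K) : s.energy k + ∑ j ∈ Finset.range k,
      τ / 2 * (curlSq fun i l => s.g (j + 2) i l - s.g j i l) ≤ energyConst d C T * τ ^ 4 := by
  have hX0 : s.X 0 = 0 := by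
    have := s.jrel_φ 0 hK.le
    rw [s.φ_zero] at this
    exact this.unique JRel.zero
  have hQ : (τ * ‖s.Q 0‖) ^ 2 ≤ (4 * d * (C + C * T) ^ 2 + 2 * C ^ 2) * τ ^ 4 := by
    have h1 : τ * ‖s.Q 0‖ ≤ C * τ ^ 2 := by
      rw [Q, hX0, sub_zero]
      nlinarith [s.P_zero]
    refine (pow_le_pow_left₀ (by positivity) h1 2).trans ?_
    have : 0 ≤ 4 * d * (C + C * T) ^ 2 * τ ^ 4 := by positivity
    have : 0 ≤ C ^ 2 * τ ^ 4 := by positivity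
    nlinarith
  refine energy_recursion hK hτ hT hKT (E := s.energy) (α := 4 * d * C + 18 * C)
    (β := 6 * C ^ 2) (γ := 2 * d * C)
    (F := fun j => τ / 2 * (curlSq fun i l => s.g (j + 2) i l - s.g j i l))
    (by positivity) (by positivity) (by positivity) ?_ ?_ (by positivity)
    (fun S hS hE hQS k hk => s.energy_step hτ hC hχ₀ hχ₁ hS hE hQS hk)
    (s.energy_zero_le hτ hC hχ₁ hK hT) hQ k hk
  · intro j hj
    refine le_trans ?_ (s.le_energy hτ hχ₁ hj)
    have := curlSq_nonneg fun i l => s.g (j + 1) i l - s.g j i l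
    have : 0 ≤ ∑ i, ‖s.e (j + 1) i - s.e j i‖ ^ 2 := Finset.sum_nonneg fun _ _ => sq_nonneg _
    positivity
  · exact fun j => mul_nonneg (by positivity) (curlSq_nonneg _)

/-! ### The error equations of the scheme -/

lemma HasDiv.unique {d : ℕ} {v : Field d} {g g' : L2 d} (h : HasDiv v g) (h' : HasDiv v g') :
    g = g' := by
  obtain ⟨D, hD, rfl⟩ := h
  obtain ⟨D', hD', rfl⟩ := h'
  exact Finset.sum_congr rfl fun i _ => (hD i).unique (hD' i)

lemma HasDiv.add {d : ℕ} {v w : Field d} {g g' : L2 d} (h : HasDiv v g) (h' : HasDiv w g') :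
    HasDiv (v + w) (g + g') := by
  obtain ⟨D, hD, rfl⟩ := h
  obtain ⟨D', hD', rfl⟩ := h'
  exact ⟨fun i => D i + D' i, fun i => (hD i).add (hD' i), Finset.sum_add_distrib.symm⟩

lemma HasDiv.smul {d : ℕ} {v : Field d} {g : L2 d} (h : HasDiv v g) (c : ℝ) :
    HasDiv (c • v) (c • g) := by
  obtain ⟨D, hD, rfl⟩ := h
  exact ⟨fun i => c • D i, fun i => (hD i).smul c, Finset.smul_sum⟩

/-- The step inverts B, so the increment lies in its domain as soon as the right-hand side is in L².
Regularity thus passes along the iteration, with no uniformity in τ required. -/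
lemma reg_of_velocityStep {d : ℕ} {τ : ℝ} (hτ : 0 < τ) {F u v G : Field d}
    (hu : ∀ i, Reg (u i)) (h : ∀ i n, wt (τ / 2) n * (sc (v i) n - sc (u i) n) =
      τ * (-(Lam n * sc (u i) n) - sc (G i) n + sc (F i) n)) (i : Fin d) : Reg (v i) := by
  obtain ⟨z, hz⟩ := (hu i).exists_Lam
  have : Reg (v i - u i) := Reg.of_wt (z := τ • (-z - G i + F i)) (a := τ / 2) (by positivity)
    fun n => by rw [sc_smul, sc_add, sc_sub, sc_neg, hz, sc_sub, h i n]
  simpa using this.add (hu i)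

section

variable {d : ℕ} {T τ χ : ℝ} {f uE : ℝ → Field d} {pE : ℝ → L2 d} {φs : L2 d}
  {u : ℕ → Field d} {φ p : ℕ → L2 d} {K : ℕ}

lemma IsSchemeSolution.reg (hd : d = 2 ∨ d = 3) (hτ : 0 < τ)
    (hs : IsSchemeSolution K τ χ f (uE 0) (pE 0) φs u φ p) (h0 : ∀ i, Reg (uE 0 i)) :
    ∀ k ≤ K, ∀ i, Reg (u k i) := by
  intro k
  induction k with
  | zero => intro _ i; rw [hs.init_u]; exact h0 i
  | succ k ih =>
    intro hk
    obtain ⟨G, -, hG⟩ := velocityStep_coef hd hτ (ih (by omega)) (hs.velocity k hk)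
    exact reg_of_velocityStep hτ (ih (by omega)) hG

/-- The error of the scheme satisfies the error equations, with a constant that does not depend on
the discretization. -/
lemma exists_errorSystem (hd : d = 2 ∨ d = 3) (hT : 0 < T)
    (hf : ∀ i, MemWInf T 2 (fun t => f t i)) (hsol : IsStokesSolution T f uE pE)
    (hu : VelocityRegular T uE) (hp : PressureRegular T pE) (c₀ : ℝ) :
    ∃ C, 0 ≤ C ∧ ∀ (K : ℕ) (τ χ : ℝ), 0 < τ → 0 < K → K * τ ≤ T →
      ∀ (φs : L2 d) (u : ℕ → Field d) (φ p : ℕ → L2 d),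
        IsSchemeSolution K τ χ f (uE 0) (pE 0) φs u φ p →
        H1NormLE (pE (τ / 2) - (pE 0 + φs)) (c₀ * τ) →
        ∃ s : ErrorSystem d K τ χ C, s.e = velErr τ uE u := by
  choose Cr hCr0 hCr using fun i => residual_bound hT hf hsol hu hp i
  obtain ⟨J, CJ, hCJ, hJ, hJl, hJi⟩ := exists_J_path hp
  obtain ⟨Gp, CG, hCG, hGp, hGl⟩ := exists_grad_path hp
  have hCrs : 0 ≤ ∑ i, Cr i := Finset.sum_nonneg fun i _ => hCr0 i
  -- The summands come from the velocity residual, the exact pressure in the energy space (twice,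
  -- for `ν`), the pressure gradient, and the initial data.
  set C := ∑ i, Cr i + 2 * CJ + CG + |c₀| with hC
  have hc0 := abs_nonneg c₀
  refine ⟨C, by positivity, ?_⟩
  intro K τ χ hτ hK hKT φs u φ p hs hinit
  -- times
  have tmem : ∀ k ≤ K, (k : ℝ) * τ ∈ Set.Icc 0 T := fun k hk =>
    ⟨by positivity, le_trans (by gcongr) hKT⟩
  have tsucc : ∀ k < K, (k : ℝ) * τ + τ ≤ T := by
    intro k hk
    have := (tmem (k + 1) hk).2
    push_cast at this
    linarith
  have hmid : ∀ k < K, ((k : ℝ) + 1 / 2) * τ ∈ Set.Icc 0 T := fun k hk =>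
    ⟨by positivity, by linarith [tsucc k hk]⟩
  have h0T : (0 : ℝ) ∈ Set.Icc 0 T := ⟨le_rfl, hT.le⟩
  -- velocities
  have hur := hs.reg hd hτ fun i => hu.reg h0T i
  have her : ∀ k ≤ K, ∀ i, Reg (velErr τ uE u k i) := fun k hk i =>
    (hu.reg (tmem k hk) i).sub (hur k hk i)
  have hg : ∀ k, ∃ g : Fin d → Fin d → L2 d, k ≤ K →
      ∀ i j, HasWeakDerivZeroTrace i (velErr τ uE u k j) (g i j) := by
    intro k
    by_cases hk : k ≤ K
    · choose g hg using fun i j => (her k hk j).exists_zeroTrace i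
      exact ⟨g, fun _ => hg⟩
    · exact ⟨fun _ _ => 0, fun h => absurd h hk⟩
  choose g hg using hg
  have hdiv : ∀ k ≤ K, HasDiv (u k) (-∑ i, g k i i) := by
    intro k hk
    obtain ⟨D, hD, hD0⟩ := hsol.divFree _ (tmem k hk)
    refine ⟨fun i => D i - g k i i, fun i => ?_, ?_⟩
    · have := (hD i).sub (hg k hk i i).hasWeakDeriv
      simpa [velErr] using this
    · rw [Finset.sum_sub_distrib, ← hD0, zero_sub]
  -- the discrete pressures
  have hA : ∀ k < K, ∀ n, cc (∑ i, g (k + 1) i i) n = wt 1 n * cc (τ • φ (k + 1)) n := by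
    intro k hk n
    obtain ⟨D, hD, hDA⟩ := hs.penalty k hk
    rw [hD.unique (hdiv (k + 1) hk)] at hDA
    have := hasA_coef hd hDA n
    rw [smul_neg, neg_neg, cc_smul] at this
    rw [cc_smul, mul_left_comm, ← this, ← mul_assoc, mul_inv_cancel₀ hτ.ne', one_mul]
  have hX : ∀ k, ∃ x : L2 d, k < K → JRel (φ (k + 1)) x := by
    intro k
    by_cases hk : k < K
    · obtain ⟨x, hx⟩ := exists_JRel (q := τ • φ (k + 1)) (hA k hk)
      refine ⟨τ⁻¹ • x, fun _ => ?_⟩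
      have := hx.smul τ⁻¹
      rwa [smul_smul, inv_mul_cancel₀ hτ.ne', one_smul] at this
    · exact ⟨0, fun h => absurd h hk⟩
  choose X hX using hX
  -- The sign of χ changes because the divergence of the iterate is minus that of the error.
  have hpr : ∀ k < K, p (k + 1) = p k + φ (k + 1)
      + (χ / 2) • (∑ i, g (k + 1) i i + ∑ i, g k i i) := by
    intro k hk
    obtain ⟨D, hD, hDp⟩ := hs.pressure k hk
    have := ((hdiv (k + 1) hk).add (hdiv k hk.le)).smul (1 / 2 : ℝ)
    rw [hDp, hD.unique this]
    module
  have hG : ∀ k, ∃ G : Field d, k < K → HasGrad (p k + φ k) G ∧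
      ∀ i n, wt (τ / 2) n * (sc (u (k + 1) i) n - sc (u k i) n) =
        τ * (-(Lam n * sc (u k i) n) - sc (G i) n + sc (f (((k : ℝ) + 1 / 2) * τ) i) n) := by
    intro k
    by_cases hk : k < K
    · obtain ⟨G, hG1, hG2⟩ := velocityStep_coef hd hτ (hur k hk.le) (hs.velocity k hk)
      exact ⟨G, fun _ => ⟨hG1, hG2⟩⟩
    · exact ⟨0, fun h => absurd h hk⟩
  choose G hG using hG
  set ψ : ℕ → L2 d := fun k => pE (((k : ℝ) + 1 / 2) * τ) - (p k + φ k) with hψ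
  set Γ : ℕ → Field d := fun k i => Gp (((k : ℝ) + 1 / 2) * τ) i - G k i with hΓ
  have hgrad : ∀ k < K, HasGrad (ψ k) (Γ k) := fun k hk i =>
    (hGp _ (hmid k hk) i).sub ((hG k hk).1 i)
  have hR : ∀ k i, ∃ R : L2 d, k < K → ‖R‖ ≤ Cr i * τ ^ 2 ∧
      ∀ n, wt (τ / 2) n * (sc (velErr τ uE u (k + 1) i) n - sc (velErr τ uE u k i) n) =
        τ * (-(Lam n * sc (velErr τ uE u k i) n) - sc (Γ k i) n + sc R n) := by
    intro k i
    by_cases hk : k < K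
    · have e1 : (k : ℝ) * τ + τ / 2 = ((k : ℝ) + 1 / 2) * τ := by ring
      have e2 : (k : ℝ) * τ + τ = ((k + 1 : ℕ) : ℝ) * τ := by push_cast; ring
      obtain ⟨R, hR, hRe⟩ := hCr i τ (k * τ) hτ (by positivity) (tsucc k hk)
        (Gp (((k : ℝ) + 1 / 2) * τ) i) (by rw [e1]; exact hGp _ (hmid k hk) i)
      refine ⟨R, fun _ => ⟨hR, fun n => ?_⟩⟩
      have h1 := hRe n
      have h2 := (hG k hk).2 i n
      rw [e1, e2] at h1
      simp only [velErr, hΓ, Pi.sub_apply, sc_sub]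
      linear_combination h1 - h2
    · exact ⟨0, fun h => absurd h hk⟩
  choose R hR using hR
  -- the first step
  obtain ⟨G₀, hG₀, hG₀n⟩ := hinit
  have hτ2 : ((0 : ℕ) : ℝ) + 1 / 2 = 1 / 2 := by norm_num
  have hψ0 : ψ 0 = pE (τ / 2) - (pE 0 + φs) := by
    simp only [hψ, hτ2, hs.init_p, hs.init_φ]
    rw [show 1 / 2 * τ = τ / 2 by ring]
  have hΓ0 : ∀ i, ‖Γ 0 i‖ ≤ |c₀| * τ := by
    intro i
    have h1 := hgrad 0 hK i
    rw [hψ0] at h1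
    rw [h1.unique (hG₀ i)]
    have h2 : ‖G₀ i‖ ≤ √(‖pE (τ / 2) - (pE 0 + φs)‖ ^ 2 + l2Norm G₀ ^ 2) := by
      refine Real.le_sqrt_of_sq_le ?_
      have h3 : 0 ≤ ∑ i, ‖G₀ i‖ ^ 2 := Finset.sum_nonneg fun _ _ => sq_nonneg _
      rw [l2Norm, Real.sq_sqrt h3]
      have := Finset.single_le_sum (f := fun i => ‖G₀ i‖ ^ 2) (fun j _ => sq_nonneg _)
        (Finset.mem_univ i)
      nlinarith [sq_nonneg ‖pE (τ / 2) - (pE 0 + φs)‖]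
    refine h2.trans (hG₀n.trans ?_)
    gcongr
    exact le_abs_self _
  have hτT : τ / 2 ∈ Set.Icc 0 T := by
    have := hmid 0 hK
    rw [hτ2, show 1 / 2 * τ = τ / 2 by ring] at this
    exact this
  -- exact pressure increments
  set P : ℕ → L2 d := fun k =>
    if k = 0 then J τ - J 0 else J ((k : ℝ) * τ) - J (((k : ℝ) - 1) * τ) with hP
  have hP1 : P 1 = J τ - J 0 := by simp [hP]
  have hP0 : P 0 = J τ - J 0 := by simp [hP]
  have hPs : ∀ k : ℕ, P (k + 1) = J ((k : ℝ) * τ + τ) - J ((k : ℝ) * τ) := by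
    intro k
    simp only [hP, Nat.add_eq_zero_iff, one_ne_zero, and_false, if_false]
    push_cast
    rw [show ((k : ℝ) + 1) * τ = k * τ + τ by ring, show ((k : ℝ) + 1 - 1) * τ = k * τ by ring]
  have hτmem : τ ∈ Set.Icc 0 T := by have := tmem 1 hK; simpa using this
  have hPn : ‖J τ - J 0‖ ≤ C * τ := by
    have := hJl τ hτmem 0 h0T
    rw [sub_zero, abs_of_pos hτ] at this
    refine this.trans ?_
    gcongr
    rw [hC]; linarith
  have hPi : ∀ k < K, ‖P (k + 1) - P k‖ ≤ CJ * τ ^ 2 := by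
    intro k hk
    cases k with
    | zero => rw [zero_add, hP1, hP0, sub_self, norm_zero]; positivity
    | succ k =>
      rw [hPs, hPs]
      have e : ((k + 1 : ℕ) : ℝ) * τ = k * τ + τ := by push_cast; ring
      have h1 := tmem (k + 1) hk.le
      have h2 := tmem k (by omega)
      have h3 := tsucc (k + 1) hk
      rw [e] at h1 h3 ⊢
      have := hJi (k * τ + τ) (k * τ) τ hτ.le h1 ⟨by linarith [h1.1], h3⟩ h2 h1
      rw [show (k : ℝ) * τ + τ - k * τ = τ by ring, abs_of_pos hτ] at this
      linarith
  refine ⟨{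
    e := velErr τ uE u
    g := g
    -- The given φ* need not lie in the energy space of A, so the zeroth increment is set to zero,
    -- in accordance with div e⁰ = 0, and φ* is moved to `ext`.
    φ := fun k => if k = 0 then 0 else φ k
    X := fun k => if k = 0 then 0 else X (k - 1)
    P := P
    N := fun k => pE (((k : ℝ) + 1 / 2) * τ) - pE (((k : ℝ) - 1 / 2) * τ)
    ν := fun k => J (((k : ℝ) + 1 / 2) * τ) - J (((k : ℝ) - 1 / 2) * τ)
    ψ := ψ
    ext := fun k => if k = 0 then φs else 0
    Γ := Γ
    -- The gradient of φ* = 𝗉(τ/2) - 𝗉(0) - ψ⁰, of size τ by the Lipschitz bound and the initial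
    -- hypothesis.
    Ξ := fun k i => if k = 0 then Gp (τ / 2) i - Gp 0 i - Γ 0 i else 0
    R := R
    e_zero := ?_
    φ_zero := by simp
    reg := her
    zeroTrace := hg
    penalty := ?_
    jrel_φ := ?_
    jrel_N := ?_
    grad := hgrad
    momentum := fun k hk i n => (hR k i hk).2 n
    residual := ?_
    ψ_incr := ?_
    grad_ext := ?_
    Ξ_zero := ?_
    Ξ_succ := by simp
    Γ_zero := ?_
    P_zero := by rw [hP0]; exact hPn
    P_one := by rw [hP1]; exact hPn
    P_incr := ?_
    ν_incr := ?_ }, rfl⟩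
  · simp [velErr, hs.init_u]
  · intro k hk n
    cases k with
    | zero =>
      have h1 := hdiv 0 hk
      obtain ⟨D, hD, hD0⟩ := hsol.divFree _ h0T
      rw [hs.init_u] at h1
      have h2 := h1.unique ⟨D, hD, hD0⟩
      rw [neg_eq_zero] at h2
      simp [h2, cc_zero]
    | succ k => simpa using hA k hk n
  · intro k hk
    cases k with
    | zero => simpa using JRel.zero
    | succ k => simpa using hX k hk
  · intro k hk
    refine (hJ _ (hmid (k + 1) hk)).sub (hJ _ ?_)
    have := hmid k (by omega)
    push_cast
    rwa [show (k : ℝ) + 1 - 1 / 2 = k + 1 / 2 by ring]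
  · intro k hk i
    refine (hR k i hk).1.trans ?_
    gcongr
    have := Finset.single_le_sum (fun j _ => hCr0 j) (Finset.mem_univ i)
    rw [hC]; linarith
  · intro k hk
    have h1 := hpr k (by omega)
    simp only [hψ]
    rw [h1]
    push_cast
    rw [show (k : ℝ) + 1 - 1 / 2 = k + 1 / 2 by ring]
    cases k with
    | zero =>
      simp only [zero_add, if_true, hs.init_φ]
      module
    | succ k =>
      simp only [Nat.add_eq_zero_iff, one_ne_zero, and_false, if_false]
      module
  · intro k hk i
    cases k with
    | zero =>
      simp only [if_true]
      have h1 := ((hGp _ hτT i).sub (hGp _ h0T i)).sub (hgrad 0 hK i)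
      rw [hψ0] at h1
      convert h1 using 1
      abel
    | succ k =>
      simp only [Nat.add_eq_zero_iff, one_ne_zero, and_false, if_false]
      have := (hGp 0 h0T i).sub (hGp 0 h0T i)
      rwa [sub_self, sub_self] at this
  · intro i
    simp only [if_true]
    have h1 := hGl i _ hτT 0 h0T
    rw [sub_zero, abs_of_pos (by positivity)] at h1
    have h2 := hΓ0 i
    refine (norm_sub_le _ _).trans ((add_le_add h1 h2).trans ?_)
    have : 0 ≤ (∑ i, Cr i) * τ := by positivity
    have : 0 ≤ CJ * τ := by positivity
    have : 0 ≤ CG * τ := by positivity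
    rw [hC]
    nlinarith
  · intro i
    refine (hΓ0 i).trans ?_
    gcongr
    rw [hC]; linarith
  · intro k hk
    refine (hPi k hk).trans ?_
    gcongr
    rw [hC]; linarith
  · intro k hk
    have h1 := hPi k (by omega)
    have h2 : ‖J ((((k + 1 : ℕ) : ℝ) + 1 / 2) * τ) - J ((((k + 1 : ℕ) : ℝ) - 1 / 2) * τ)
        - P (k + 1)‖ ≤ CJ * τ ^ 2 := by
      have m1 := hmid k (by omega)
      have m2 := hmid (k + 1) hk
      have m3 := tmem k (by omega)
      have m4 := tmem (k + 1) hk.le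
      have e1 : (((k + 1 : ℕ) : ℝ) + 1 / 2) * τ = (k + 1 / 2) * τ + τ := by push_cast; ring
      have e2 : (((k + 1 : ℕ) : ℝ) - 1 / 2) * τ = (k + 1 / 2) * τ := by push_cast; ring
      have e3 : ((k + 1 : ℕ) : ℝ) * τ = k * τ + τ := by push_cast; ring
      rw [e1] at m2
      rw [e3] at m4
      rw [hPs, e1, e2]
      have := hJi ((k + 1 / 2) * τ) (k * τ) τ hτ.le m1 m2 m3 m4
      rw [show ((k : ℝ) + 1 / 2) * τ - k * τ = τ / 2 by ring, abs_of_pos (by positivity)] at this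
      refine this.trans ?_
      have : 0 ≤ CJ * τ ^ 2 := by positivity
      nlinarith
    have e : ∀ ν : L2 d, ν - ((2 : ℝ) • P (k + 1) - P k) =
        (ν - P (k + 1)) - (P (k + 1) - P k) := by
      intro ν; module
    rw [e]
    refine (norm_sub_le _ _).trans ((add_le_add h2 h1).trans ?_)
    have : 0 ≤ ((∑ i, Cr i) + CG + |c₀|) * τ ^ 2 := by positivity
    rw [hC]
    linarith

end

/-! ### The norms of the statement -/

lemma wd_eq {d : ℕ} {i : Fin d} {v g : L2 d} (h : HasWeakDeriv [i] v g) : wd i v = g := by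
  have he : ∃ g : L2 d, HasWeakDeriv [i] v g := ⟨g, h⟩
  rw [wd, dif_pos he]
  exact he.choose_spec.unique h

lemma curlNorm_sq {d : ℕ} {v : Field d} {g : Fin d → Fin d → L2 d}
    (h : ∀ i j, HasWeakDeriv [i] (v j) (g i j)) : curlNorm v ^ 2 = curlSq g := by
  have : ∀ i j, wd i (v j) = g i j := fun i j => wd_eq (h i j)
  simp only [curlNorm, this]
  exact Real.sq_sqrt (curlSq_nonneg g)

lemma l2Norm_sq {d : ℕ} (v : Field d) : l2Norm v ^ 2 = ∑ i, ‖v i‖ ^ 2 :=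
  Real.sq_sqrt (Finset.sum_nonneg fun _ _ => sq_nonneg _)

lemma curlSq_smul {d : ℕ} (c : ℝ) (g : Fin d → Fin d → L2 d) :
    curlSq (fun i j => c • g i j) = c ^ 2 * curlSq g := by
  simp only [curlSq, Finset.mul_sum]
  refine Finset.sum_congr rfl fun i _ => Finset.sum_congr rfl fun j _ => ?_
  rw [← smul_sub, norm_smul, mul_pow, Real.norm_eq_abs, sq_abs]

lemma lInfSeq_sq_le {s : Finset ℕ} {a : ℕ → ℝ} {B : ℝ} (hB : 0 ≤ B) (h : ∀ k ∈ s, a k ^ 2 ≤ B) :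
    lInfSeq s a ^ 2 ≤ B := by
  have h1 : lInfSeq s a ≤ √B := by
    have : (s.sup fun k => (a k).toNNReal) ≤ (√B).toNNReal :=
      Finset.sup_le fun k hk => Real.toNNReal_le_toNNReal (Real.le_sqrt_of_sq_le (h k hk))
    have h2 := NNReal.coe_le_coe.2 this
    rwa [Real.coe_toNNReal _ (Real.sqrt_nonneg _)] at h2
  have h2 := pow_le_pow_left₀ (NNReal.coe_nonneg _) h1 2
  rwa [Real.sq_sqrt hB] at h2

end DirectionSplitting

end


/-! ### From the discrete energy to the norms of the estimate. -/

open DirectionSplitting in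
theorem mainTheorem4 (d : ℕ) (hd : d = 2 ∨ d = 3) (T : ℝ) (hT : 0 < T)
    (χ : ℝ) (hχ₀ : 0 < χ) (hχ₁ : χ ≤ 1)
    (f uE : ℝ → Field d) (pE : ℝ → L2 d)
    (hf : ∀ i, MemWInf T 2 (fun t => f t i))
    (hsol : IsStokesSolution T f uE pE)
    (hu : VelocityRegular T uE) (hp : PressureRegular T pE)
    (c₀ : ℝ) :
    ∃ c : ℝ, ∀ τ : ℝ, 0 < τ → τ ≤ T →
      ∀ (φs : L2 d) (u : ℕ → Field d) (φ p : ℕ → L2 d),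
        IsSchemeSolution ⌊T / τ⌋₊ τ χ f (uE 0) (pE 0) φs u φ p →
        H1NormLE (pE (τ / 2) - (pE 0 + φs)) (c₀ * τ) →
        (∀ k ≤ ⌊T / τ⌋₊, ∀ i, MemH1 (velErr τ uE u k i)) ∧
        lInfSeq (Finset.Icc 1 ⌊T / τ⌋₊) (fun k => l2Norm (incr (velErr τ uE u) k)) ^ 2
          + τ * lInfSeq (Finset.Icc 1 ⌊T / τ⌋₊)
              (fun k => curlNorm (incr (velErr τ uE u) k)) ^ 2
          + lTwoSeq τ (Finset.Icc 1 (⌊T / τ⌋₊ - 1))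
              (fun k => curlNorm (incr (avg (velErr τ uE u)) k)) ^ 2
          + τ * lInfSeq (Finset.range (⌊T / τ⌋₊ + 1))
              (fun k => divNorm (velErr τ uE u k)) ^ 2
        ≤ c * τ ^ 4 := by
  obtain ⟨C, hC, hsys⟩ := exists_errorSystem hd hT hf hsol hu hp c₀
  set c := energyConst d C T with hc
  -- One summand for each norm: 2c because the energy holds τ/2 times the squared curl, c/χ because
  -- it holds χτ times the squared divergence.
  refine ⟨c + 2 * c + c + c / χ, ?_⟩
  intro τ hτ hτT φs u φ p hs hinit
  set K := ⌊T / τ⌋₊ with hKdef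
  have hK : 0 < K := Nat.floor_pos.2 ((one_le_div hτ).2 hτT)
  have hKT : (K : ℝ) * τ ≤ T := by
    have := Nat.floor_le (div_nonneg hT.le hτ.le)
    rwa [le_div_iff₀ hτ] at this
  obtain ⟨s, hse⟩ := hsys K τ χ hτ hK hKT φs u φ p hs hinit
  rw [← hse]
  have hE : ∀ k < K, s.energy k + ∑ j ∈ Finset.range k,
      τ / 2 * (curlSq fun i l => s.g (j + 2) i l - s.g j i l) ≤ c * τ ^ 4 := fun k hk =>
    s.energy_le hτ hC hχ₀ hχ₁ hK hτT hKT hk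
  have hFn : ∀ j, 0 ≤ τ / 2 * (curlSq fun i l => s.g (j + 2) i l - s.g j i l) := fun j =>
    mul_nonneg (by positivity) (curlSq_nonneg _)
  have hlow : ∀ k < K, ∑ i, ‖s.e (k + 1) i - s.e k i‖ ^ 2
      + τ / 2 * (curlSq fun i j => s.g (k + 1) i j - s.g k i j)
      + χ * τ * ‖s.D (k + 1)‖ ^ 2
      + ∑ j ∈ Finset.range k, τ / 2 * (curlSq fun i l => s.g (j + 2) i l - s.g j i l)
        ≤ c * τ ^ 4 := by
    intro k hk
    have h1 := s.le_energy hτ hχ₁ hk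
    have h2 := hE k hk
    have : 0 ≤ τ ^ 2 * ‖s.Q (k + 1)‖ ^ 2 := by positivity
    linarith
  have p1 : ∀ k, 0 ≤ ∑ i, ‖s.e (k + 1) i - s.e k i‖ ^ 2 := fun k =>
    Finset.sum_nonneg fun _ _ => sq_nonneg _
  have p2 : ∀ k, 0 ≤ τ / 2 * (curlSq fun i j => s.g (k + 1) i j - s.g k i j) := fun k =>
    mul_nonneg (by positivity) (curlSq_nonneg _)
  have p3 : ∀ k, 0 ≤ χ * τ * ‖s.D k‖ ^ 2 := fun k => by positivity
  have p4 : ∀ k, 0 ≤ ∑ j ∈ Finset.range k,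
      τ / 2 * (curlSq fun i l => s.g (j + 2) i l - s.g j i l) := fun k =>
    Finset.sum_nonneg fun j _ => hFn j
  have hcτ : 0 ≤ c * τ ^ 4 := by
    have := hlow 0 hK
    linarith [p1 0, p2 0, p3 (0 + 1), p4 0]
  refine ⟨fun k hk i j => ⟨_, (s.zeroTrace k hk j i).hasWeakDeriv⟩, ?_⟩
  have b1 : lInfSeq (Finset.Icc 1 K) (fun k => l2Norm (incr s.e k)) ^ 2 ≤ c * τ ^ 4 := by
    refine lInfSeq_sq_le hcτ fun k hk => ?_
    obtain ⟨hk1, hk2⟩ := Finset.mem_Icc.1 hk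
    obtain ⟨k, rfl⟩ := Nat.exists_eq_add_of_le' hk1
    rw [l2Norm_sq]
    have := hlow k hk2
    change ∑ i, ‖s.e (k + 1) i - s.e k i‖ ^ 2 ≤ _
    linarith [p2 k, p3 (k + 1), p4 k]
  have b2 : lInfSeq (Finset.Icc 1 K) (fun k => curlNorm (incr s.e k)) ^ 2 ≤
      2 * (c * τ ^ 4) / τ := by
    refine lInfSeq_sq_le (by positivity) fun k hk => ?_
    obtain ⟨hk1, hk2⟩ := Finset.mem_Icc.1 hk
    obtain ⟨k, rfl⟩ := Nat.exists_eq_add_of_le' hk1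
    rw [curlNorm_sq (v := incr s.e (k + 1)) (g := fun i j => s.g (k + 1) i j - s.g k i j)
      fun i j => (s.zeroTrace (k + 1) hk2 i j).hasWeakDeriv.sub
        (s.zeroTrace k (by omega) i j).hasWeakDeriv]
    have := hlow k hk2
    rw [le_div_iff₀ hτ]
    linarith [p1 k, p3 (k + 1), p4 k]
  have b3 : lTwoSeq τ (Finset.Icc 1 (K - 1)) (fun k => curlNorm (incr (avg s.e) k)) ^ 2 ≤
      c * τ ^ 4 := by
    rw [lTwoSeq, Real.sq_sqrt (mul_nonneg hτ.le (Finset.sum_nonneg fun _ _ => sq_nonneg _))]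
    -- The increment of an average is half a difference over two steps, the quantity whose curl
    -- survives in the energy inequality.
    have hsum : ∑ k ∈ Finset.Icc 1 (K - 1), curlNorm (incr (avg s.e) k) ^ 2 =
        ∑ j ∈ Finset.range (K - 1), 1 / 4 * (curlSq fun i l => s.g (j + 2) i l - s.g j i l) := by
      rw [← Finset.Ico_add_one_right_eq_Icc, Finset.sum_Ico_eq_sum_range]
      refine Finset.sum_congr (by simp) fun j hj => ?_
      have hjK : j + 2 ≤ K := by have := Finset.mem_range.1 hj; omega
      rw [curlNorm_sq (v := incr (avg s.e) (1 + j))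
        (g := fun i l => (1 / 2 : ℝ) • (s.g (j + 2) i l - s.g j i l)), curlSq_smul]
      · norm_num
      · intro i l
        have h1 := ((s.zeroTrace (j + 2) hjK i l).hasWeakDeriv.sub
          (s.zeroTrace j (by omega) i l).hasWeakDeriv).smul (1 / 2 : ℝ)
        have e : incr (avg s.e) (1 + j) l = (1 / 2 : ℝ) • (s.e (j + 2) l - s.e j l) := by
          simp only [incr, avg, Nat.add_sub_cancel_left, Pi.sub_apply, Pi.smul_apply, Pi.add_apply]
          rw [show 1 + j + 1 = j + 2 by omega, show 1 + j = j + 1 by omega]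
          module
        rw [e]
        exact h1
    rw [hsum, Finset.mul_sum]
    have := hlow (K - 1) (by omega)
    have hle : ∑ j ∈ Finset.range (K - 1),
        τ * (1 / 4 * (curlSq fun i l => s.g (j + 2) i l - s.g j i l)) ≤
        ∑ j ∈ Finset.range (K - 1), τ / 2 * (curlSq fun i l => s.g (j + 2) i l - s.g j i l) :=
      Finset.sum_le_sum fun j _ => by linarith [hFn j]
    linarith [p1 (K - 1), p2 (K - 1), p3 (K - 1 + 1)]
  have b4 : lInfSeq (Finset.range (K + 1)) (fun k => divNorm (s.e k)) ^ 2 ≤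
      c * τ ^ 4 / (χ * τ) := by
    refine lInfSeq_sq_le (by positivity) fun k hk => ?_
    have hkK : k ≤ K := by have := Finset.mem_range.1 hk; omega
    have e : divNorm (s.e k) = ‖s.D k‖ := by
      rw [divNorm, ErrorSystem.D]
      congr 1
      exact Finset.sum_congr rfl fun i _ => wd_eq (s.zeroTrace k hkK i i).hasWeakDeriv
    rw [e, le_div_iff₀ (by positivity)]
    cases k with
    | zero => rw [s.D_zero hK, norm_zero]; simpa using hcτ
    | succ k =>
      have := hlow k hkK
      linarith [p1 k, p2 k, p4 k]
  have b2' := mul_le_mul_of_nonneg_left b2 hτ.le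
  have b4' := mul_le_mul_of_nonneg_left b4 hτ.le
  rw [show τ * (2 * (c * τ ^ 4) / τ) = 2 * (c * τ ^ 4) by field_simp] at b2'
  rw [show τ * (c * τ ^ 4 / (χ * τ)) = c / χ * τ ^ 4 by field_simp] at b4'
  linarith
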